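/- Let $P(x,y)$ be a real homogeneous binary form of degree $n\ge 3$ with non-zero discriminant. For $T\in \mathrm{SL}_2(\mathbb R)$ put $(P\circ T)(v)=P(T^{-1}v)$; thus $T$, acting by Möbius transformations $T(z)=\frac{az+b}{cz+d}$, maps the roots of $P(z,1)$ to the roots of $(P\circ T)(z,1)$. Let $m(P)=\inf_{v\in\mathbb Z^2\setminus 0}|P(v)|$ and $\mathrm{Spec}(P)=\{\inf_{v\in\Lambda\setminus 0}|P(v)| : \Lambda\subset\mathbb R^2 \text{ a unimodular lattice}\}$. Call $P$ *extremal* (i.e. $\mathbb Z^2$ is an extremal lattice for $P$) if $m(P)=\max\mathrm{Spec}(P)$, and *finitely minimized* if $m(P)=|P(v)|$ for some $v\in\mathbb Z^2\setminus 0$. For $\rho\in\mathbb R$ let $m_n(\rho)=\inf_{(X,Y)\in\mathbb Z\times\mathbb N,\,Y\ge1}\left|Y^n\left(\frac XY-\rho\right)\right|$, and for $\eta>0$ let $E^\eta(\rho)$ be the set of $x\in\mathbb R$ such that, for all $X\in\mathbb Z$ and $Y\ge 1$, $\left|\frac XY-x\right|<Y^{-2-\eta}$ implies $\left|\frac XY-\rho\right|<2Y^{-2-\eta}$.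 Let $\|\cdot\|$ be the Euclidean norm on $2\times2$ matrices, $B(\mathrm{id},r)=\{T\in \mathrm{SL}_2(\mathbb R):\|T-\mathrm{id}\|<r\}$, $\lambda$ the Lebesgue measure on $\mathbb{R}$ and $\mu$ a Haar measure on $\mathrm{SL}_2(\mathbb R)$. For an extremal form $Q$ of degree $n$ with distinct real roots $\rho_1,\dots,\rho_k$ of $Q(z,1)$, let $\mathrm{AEL}_Q(\varepsilon)$ be the set of all $T\in\mathrm{SL}_2(\mathbb R)$ with $\|T-\mathrm{id}\|<\varepsilon$ such that, for all $i$, $T(\rho_i)$ is finite and $m_n(T(\rho_i))>m_n(\rho_i)-\varepsilon$ (the $\varepsilon$-almost extremal transformations). For $X_1,\dots,X_k\subset\mathbb R$ let $\mathrm{AEL}_Q(\varepsilon,X_1\times\dots\times X_k,\eta)$ be the set of $T\in\mathrm{AEL}_Q(\varepsilon)$ with $T(\rho_i)\in X_i\cap E^\eta(\rho_i)$ for all $i$. Then: 1. There is $A\in\mathrm{SL}_2(\mathbb R)$ such that $P\circ A$ is extremal. 2. For every $A\in\mathrm{SL}_2(\mathbb{R})$ such that $Q=P\circ A$ is extremal,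 with $\rho_1,\dots,\rho_k$ the distinct real roots of $Q(z,1)$, for all Lebesgue measurable $X_1,\dots,X_k\subset\mathbb R$ with lower densities $a_i=\liminf_{r\to0^+}\frac{\lambda(B(\rho_i,r)\cap X_i)}{\lambda(B(\rho_i,r))}$ and all $\eta,\varepsilon>0$, $$\limsup_{r\to0^+}\frac{\mu\left(\mathrm{AEL}_Q(\varepsilon,X_1\times\dots\times X_k,\eta)\cap B(\mathrm{id},r)\right)}{\mu(B(\mathrm{id},r))}\ \ge\ 1-k\left(1-\min_i a_i\right).$$ 3. For every such $A$ and $Q$ and every $\varepsilon>0$ there is $T\in\mathrm{AEL}_Q(\varepsilon)$ such that $Q\circ T$ is finitely minimized. 4. $\mathrm{Spec}(P)$ has a maximum, and this maximum is not an isolated point of $\mathrm{Spec}(P)$. (If $k=0$, the right-hand side in 2 is read as $1$.) -/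

import Mathlib

open MvPolynomial Filter Topology MeasureTheory
open scoped ENNReal

noncomputable section

/-- The group `SL₂(ℝ)`. -/
abbrev SL2R : Type := Matrix.SpecialLinearGroup (Fin 2) ℝ

namespace BinForm

/-- The dehomogenization `F(z, 1)` of a polynomial `F(x, y)`, where `x = X 0` and `y = X 1`. -/
def dehom (F : MvPolynomial (Fin 2) ℝ) : Polynomial ℝ :=
  aeval ![(Polynomial.X : Polynomial ℝ), 1] F

/-- The discriminant of a binary form `P` of degree `n`,
`(-1) ^ (n (n - 1) / 2) * n ^ (-(n - 2)) * Res(∂P/∂x, ∂P/∂y)`, where `Res` is the resultant of two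
binary forms of degree `n - 1` (so that a root of `P` at infinity is allowed). If the coefficient
of `x ^ n` in `P` is nonzero, it is the discriminant of the polynomial `P(z, 1)`. -/
def discriminant (n : ℕ) (P : MvPolynomial (Fin 2) ℝ) : ℝ :=
  (-1) ^ (n * (n - 1) / 2) / (n : ℝ) ^ (n - 2) *
    Polynomial.resultant (dehom (pderiv 0 P)) (dehom (pderiv 1 P)) (n - 1) (n - 1)

/-- The action on forms, `(P ∘ T)(v) = P(T⁻¹ v)`: it is normalized so that `T` carries the roots
of `P(z, 1)` to the roots of `(P ∘ T)(z, 1)`. -/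
def act (P : MvPolynomial (Fin 2) ℝ) (T : SL2R) : MvPolynomial (Fin 2) ℝ :=
  aeval (fun i => ∑ j, C ((T⁻¹ : SL2R).1 i j) * X j) P

/-- The real roots of `P(z, 1) = 0`. -/
def realRoots (P : MvPolynomial (Fin 2) ℝ) : Set ℝ :=
  {z | eval ![z, 1] P = 0}

/-- The infimum of `|P|` over the nonzero vectors of the unimodular lattice `g ℤ²`. -/
def latticeMin (P : MvPolynomial (Fin 2) ℝ) (g : SL2R) : ℝ :=
  ⨅ v : {v : Fin 2 → ℤ // v ≠ 0}, |eval (g.1.mulVec fun i => (v.1 i : ℝ)) P|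

/-- The infimum of `|P|` over `ℤ² \ {0}`. -/
def formMin (P : MvPolynomial (Fin 2) ℝ) : ℝ :=
  ⨅ v : {v : Fin 2 → ℤ // v ≠ 0}, |eval (fun i => (v.1 i : ℝ)) P|

/-- `Spec(P)`, the set of the infima of `|P|` over the nonzero vectors of the unimodular lattices
of `ℝ²`; these are the lattices `g ℤ²` with `g ∈ SL₂(ℝ)`. -/
def spec (P : MvPolynomial (Fin 2) ℝ) : Set ℝ :=
  Set.range (latticeMin P)

/-- `ℤ²` is an extremal lattice for `P`. -/
def IsExtremal (P : MvPolynomial (Fin 2) ℝ) : Prop :=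
  IsGreatest (spec P) (formMin P)

/-- `P` is finitely minimized: the infimum of `|P|` over `ℤ² \ {0}` is attained. -/
def FinitelyMinimized (P : MvPolynomial (Fin 2) ℝ) : Prop :=
  ∃ v : Fin 2 → ℤ, v ≠ 0 ∧ |eval (fun i => (v i : ℝ)) P| = formMin P

/-- `inf |Yⁿ (X / Y - ρ)|` over the pairs `(X, Y)` of an integer and a positive integer. -/
def dioMin (n : ℕ) (ρ : ℝ) : ℝ :=
  ⨅ p : ℤ × ℕ+, |((p.2 : ℕ) : ℝ) ^ n * ((p.1 : ℝ) / ((p.2 : ℕ) : ℝ) - ρ)|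

/-- The denominator `c z + d` of the Möbius transformation `T = (a, b; c, d)` at `z`. -/
def denom (T : SL2R) (z : ℝ) : ℝ := T.1 1 0 * z + T.1 1 1

/-- The Möbius transformation `T(z) = (a z + b) / (c z + d)`, meaningful if `denom T z ≠ 0`. -/
def moebius (T : SL2R) (z : ℝ) : ℝ := (T.1 0 0 * z + T.1 0 1) / denom T z

/-- The Euclidean distance of `T` to the identity in the space `ℝ⁴` of all `2 × 2` matrices.
Note that `T` and `T⁻¹` have the same distance to the identity. -/
def distId (T : SL2R) : ℝ :=
  Real.sqrt (∑ i, ∑ j, (T.1 i j - (1 : Matrix (Fin 2) (Fin 2) ℝ) i j) ^ 2)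

/-- The Euclidean ball of radius `r` around the identity of `SL₂(ℝ)`. -/
def ballId (r : ℝ) : Set SL2R := {T | distId T < r}

/-- `E^η(ρ)`: the points `x` all of whose rational approximations of order `2 + η` are, up to a
factor `2`, approximations of `ρ` of the same order. -/
def approxSet (η ρ : ℝ) : Set ℝ :=
  {x | ∀ (a : ℤ) (b : ℕ), 0 < b →
    |(a : ℝ) / b - x| < 1 / (b : ℝ) ^ (2 + η) → |(a : ℝ) / b - ρ| < 2 / (b : ℝ) ^ (2 + η)}

/-- `AEL(ε)`, the `ε`-almost extremal transformations of a form `P` of degree `n` for which `ℤ²` is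
extremal: `T` is `ε`-close to the identity and, for every real root `ρ` of `P`, the corresponding
root `T(ρ)` of `P ∘ T` is a real number with `dioMin n T(ρ) > dioMin n ρ - ε`. -/
def almostExtremal (n : ℕ) (P : MvPolynomial (Fin 2) ℝ) (ε : ℝ) : Set SL2R :=
  {T | distId T < ε ∧ ∀ ρ ∈ realRoots P, denom T ρ ≠ 0 ∧
    dioMin n (moebius T ρ) > dioMin n ρ - ε}

/-- `AEL(ε, X₁ × ⋯ × X_k, η)`, for the real roots `ρ₁, …, ρ_k` of `P`. -/
def almostExtremalIn (n : ℕ) (P : MvPolynomial (Fin 2) ℝ) {k : ℕ} (ρ : Fin k → ℝ)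
    (ε : ℝ) (S : Fin k → Set ℝ) (η : ℝ) : Set SL2R :=
  {T | T ∈ almostExtremal n P ε ∧ (∀ i, moebius T (ρ i) ∈ S i) ∧
    ∀ i, moebius T (ρ i) ∈ approxSet η (ρ i)}

/-- The lower Lebesgue density of `S` at `ρ`. -/
def lowerDensity (S : Set ℝ) (ρ : ℝ) : ℝ≥0∞ :=
  liminf (fun r : ℝ => volume (Metric.ball ρ r ∩ S) / volume (Metric.ball ρ r)) (𝓝[>] 0)

end BinForm

end

/-! The maximum exists by Mahler's compactness argument. `latticeMin` is upper semicontinuous on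
`SL₂(ℝ)`. A lattice whose minimum is at least a given positive number has no short vector, so
reduction theory (`exists_reduced`) gives it a basis in a fixed compact set. Some lattice does have
a positive minimum. A generic translation makes all real roots irrational and badly enough
approximable; as `n ≥ 3` and the zeros are simple, the form then takes small values at only finitely
many integer points.

For the density statement, let `T` be close to the identity. The approximation properties of `T(ρ)`
can be worse than those of `ρ` only if some fraction approximates `T(ρ)` to order `s > 2` without
approximating `ρ` almost as well, that is, if `T(ρ)` lies in a `badSet`. Near `ρ` at scale `4 ^
(-L)`, fractions with denominators at least `2 ^ L` contribute a negligible amount, because their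
contributions form a geometric series of ratio `4 / 2 ^ s`. At most one fraction of smaller
denominator matters, and it does harm only if `L` is a resonant scale. Distinct fractions repel each
other, so resonant scales come in clusters of bounded length with gaps tending to infinity. Hence
infinitely many scales are good for finitely many roots and orders at once
(`frequently_volume_badSet_le`). This is why the conclusion is a limsup.

Densities on the line become Haar proportions by Fubini along the orbits of the unipotent group,
which acts by translations on `T(0)`. Such an orbit meets the Euclidean ball of radius `r` in an
interval centered at `0` up to `O(r ^ 2)`, so centered densities suffice
(`measure_moebius_zero_le`). Conjugation by a rotation moves `0` to `ρ` and preserves the balls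
(`measure_moebius_le`). A union bound over the roots gives `frequently_measure_exists_le`.

The maximum is not isolated for two reasons. By `exists_le_formMin_act`, all but a small proportion
of the `T` in suitable small balls lower the minimum of an extremal form by at most `δ` and make it
finitely minimized. If no extremal form is finitely minimized, the new minimum must be strictly
smaller than the maximum. If an extremal form attains its minimum at `v`, the `T` that shrink `v`
noticeably fill a fixed proportion of the ball by the doubling property, so one of them also lowers
the minimum by at most `δ`. -/

namespace BinForm

/-! ### Simple zeros, and the action of `SL₂(ℝ)` on forms. -/

/-- Every zero of the form is simple: the gradient does not vanish there. -/
def SimpleZeros (P : MvPolynomial (Fin 2) ℝ) : Prop :=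
  ∀ v : Fin 2 → ℝ, v ≠ 0 → eval v P = 0 → ∃ i, eval v (pderiv i P) ≠ 0

theorem eval_dehom (F : MvPolynomial (Fin 2) ℝ) (z : ℝ) :
    (dehom F).eval z = eval ![z, 1] F := by
  have : (Polynomial.evalRingHom z).comp
      (aeval (R := ℝ) ![(Polynomial.X : Polynomial ℝ), 1]).toRingHom = eval ![z, 1] := by
    apply MvPolynomial.ringHom_ext
    · intro r; simp
    · intro i; fin_cases i <;> simp
  exact congrArg (fun f => f F) this

theorem eval_smul_of_isHomogeneous {F : MvPolynomial (Fin 2) ℝ} {n : ℕ} (hF : F.IsHomogeneous n)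
    (c : ℝ) (v : Fin 2 → ℝ) : eval (c • v) F = c ^ n * eval v F := by
  rw [eval_eq', eval_eq', Finset.mul_sum]
  refine Finset.sum_congr rfl fun s hs => ?_
  have hs' : s 0 + s 1 = n := by
    have := hF (mem_support_iff.mp hs)
    simpa [Finsupp.weight_apply, Finsupp.sum_fintype, Fin.sum_univ_two] using this
  simp only [Fin.prod_univ_two, Pi.smul_apply, smul_eq_mul, mul_pow, ← hs', pow_add]
  ring

theorem natDegree_dehom_le {F : MvPolynomial (Fin 2) ℝ} {n : ℕ} (hF : F.IsHomogeneous n) :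
    (dehom F).natDegree ≤ n := by
  have := MvPolynomial.aeval_natDegree_le F hF.totalDegree_le (![(Polynomial.X : Polynomial ℝ), 1])
    (n := 1) (by intro i; fin_cases i <;> simp)
  simpa [dehom] using this

theorem coeff_dehom {F : MvPolynomial (Fin 2) ℝ} {n : ℕ} (hF : F.IsHomogeneous n) :
    (dehom F).coeff n = eval ![1, 0] F := by
  rw [dehom, aeval_eq_eval₂Hom, coe_eval₂Hom, eval₂_eq', eval_eq', Polynomial.finsetSum_coeff]
  refine Finset.sum_congr rfl fun s hs => ?_
  have hs' : s 0 + s 1 = n := by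
    have := hF (mem_support_iff.mp hs)
    simpa [Finsupp.weight_apply, Finsupp.sum_fintype, Fin.sum_univ_two] using this
  rw [← hs']
  simp [Fin.prod_univ_two, Polynomial.coeff_X_pow, zero_pow_eq]

/-- A common zero at infinity makes both dehomogenizations drop below the formal degree `m`. A
finite one is a common root, and the resultant is a polynomial combination of the two. -/
theorem resultant_dehom_eq_zero {F G : MvPolynomial (Fin 2) ℝ} {m : ℕ} (hm : m ≠ 0)
    (hF : F.IsHomogeneous m) (hG : G.IsHomogeneous m) {v : Fin 2 → ℝ} (hv : v ≠ 0)
    (hvF : eval v F = 0) (hvG : eval v G = 0) :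
    Polynomial.resultant (dehom F) (dehom G) m m = 0 := by
  by_cases h1 : v 1 = 0
  · have h0 : v 0 ≠ 0 := by
      intro h0; apply hv; ext i; fin_cases i <;> simp [h0, h1]
    have hv' : v = v 0 • ![1, 0] := by ext i; fin_cases i <;> simp [h1]
    have key : ∀ {H : MvPolynomial (Fin 2) ℝ}, H.IsHomogeneous m → eval v H = 0 →
        (dehom H).natDegree < m := by
      intro H hH hvH
      rw [hv', eval_smul_of_isHomogeneous hH, mul_eq_zero, or_iff_right (pow_ne_zero _ h0),
        ← coeff_dehom hH] at hvH
      refine lt_of_le_of_ne (natDegree_dehom_le hH) fun h => ?_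
      rw [← h, Polynomial.coeff_natDegree, Polynomial.leadingCoeff_eq_zero] at hvH
      rw [hvH] at h
      simp at h
      exact hm h.symm
    exact Polynomial.resultant_eq_zero_of_lt_lt _ _ _ _ (key hF hvF) (key hG hvG)
  · have hv' : v = v 1 • ![v 0 / v 1, 1] := by
      ext i; fin_cases i <;> simp [mul_div_cancel₀ _ h1]
    have key : ∀ {H : MvPolynomial (Fin 2) ℝ}, H.IsHomogeneous m → eval v H = 0 →
        (dehom H).eval (v 0 / v 1) = 0 := by
      intro H hH hvH
      rw [hv', eval_smul_of_isHomogeneous hH, mul_eq_zero, or_iff_right (pow_ne_zero _ h1),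
        ← eval_dehom] at hvH
      exact hvH
    obtain ⟨p, q, -, -, hpq⟩ := Polynomial.exists_mul_add_mul_eq_C_resultant (dehom F) (dehom G)
      (natDegree_dehom_le hF) (natDegree_dehom_le hG) (Or.inl hm)
    have := congrArg (Polynomial.eval (v 0 / v 1)) hpq
    simpa [key hF hvF, key hG hvG] using this.symm

theorem simpleZeros_of_discriminant_ne_zero {n : ℕ} (hn : 2 ≤ n) {P : MvPolynomial (Fin 2) ℝ}
    (hP : P.IsHomogeneous n) (hD : discriminant n P ≠ 0) : SimpleZeros P := by
  intro v hv _
  by_contra! h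
  exact hD (by rw [discriminant, resultant_dehom_eq_zero (by omega) hP.pderiv hP.pderiv hv
    (h 0) (h 1), mul_zero])

theorem eval_act (P : MvPolynomial (Fin 2) ℝ) (T : SL2R) (v : Fin 2 → ℝ) :
    eval v (act P T) = eval ((T⁻¹).1.mulVec v) P := by
  have : (eval v).comp (aeval (R := ℝ) (fun i => ∑ j, C ((T⁻¹ : SL2R).1 i j) * X j) :
      MvPolynomial (Fin 2) ℝ →ₐ[ℝ] _).toRingHom = eval ((T⁻¹).1.mulVec v) := by
    apply MvPolynomial.ringHom_ext
    · intro r; simp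
    · intro i; fin_cases i <;> simp
  exact congrArg (fun f => f P) this

theorem isHomogeneous_act {n : ℕ} {P : MvPolynomial (Fin 2) ℝ} (hP : P.IsHomogeneous n)
    (T : SL2R) : (act P T).IsHomogeneous n := by
  have := hP.aeval (fun i => ∑ j, C ((T⁻¹ : SL2R).1 i j) * X j) (n := 1) fun i =>
    IsHomogeneous.sum _ _ _ fun j _ => isHomogeneous_C_mul_X _ _
  simpa [act] using this

theorem act_act (P : MvPolynomial (Fin 2) ℝ) (T S : SL2R) : act (act P T) S = act P (S * T) := by
  apply MvPolynomial.funext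
  intro v
  simp only [eval_act, Matrix.mulVec_mulVec, mul_inv_rev, Matrix.SpecialLinearGroup.coe_mul]

theorem latticeMin_act (P : MvPolynomial (Fin 2) ℝ) (T g : SL2R) :
    latticeMin (act P T) g = latticeMin P (T⁻¹ * g) := by
  simp only [latticeMin, eval_act, Matrix.mulVec_mulVec, Matrix.SpecialLinearGroup.coe_mul]

theorem formMin_eq_latticeMin_one (P : MvPolynomial (Fin 2) ℝ) : formMin P = latticeMin P 1 := by
  simp [formMin, latticeMin]

theorem formMin_act (P : MvPolynomial (Fin 2) ℝ) (T : SL2R) :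
    formMin (act P T) = latticeMin P T⁻¹ := by
  rw [formMin_eq_latticeMin_one, latticeMin_act, mul_one]

theorem spec_act (P : MvPolynomial (Fin 2) ℝ) (T : SL2R) : spec (act P T) = spec P := by
  ext x
  simp only [spec, Set.mem_range, latticeMin_act]
  exact ⟨fun ⟨g, hg⟩ => ⟨_, hg⟩, fun ⟨g, hg⟩ => ⟨T * g, by simpa using hg⟩⟩

theorem formMin_act_mem_spec (P : MvPolynomial (Fin 2) ℝ) (T : SL2R) :
    formMin (act P T) ∈ spec P := ⟨T⁻¹, (formMin_act P T).symm⟩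

theorem pderiv_act (P : MvPolynomial (Fin 2) ℝ) (T : SL2R) (j : Fin 2) :
    pderiv j (act P T) = ∑ i, C ((T⁻¹ : SL2R).1 i j) * act (pderiv i P) T := by
  induction P using MvPolynomial.induction_on with
  | C a => simp [act]
  | add p q hp hq =>
    simp only [act, map_add, mul_add, Finset.sum_add_distrib] at hp hq ⊢
    rw [hp, hq]
  | mul_X p k hp =>
    have hX : pderiv j (∑ l, C ((T⁻¹ : SL2R).1 k l) * X l) =
        C ((T⁻¹ : SL2R).1 k j) := by
      fin_cases j <;> simp [pderiv_X, Fin.sum_univ_two]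
    simp only [act, map_mul, Derivation.leibniz, smul_eq_mul, map_add, mul_add,
      Finset.sum_add_distrib, aeval_X, pderiv_X] at hp ⊢
    rw [hp, hX, add_comm, Finset.mul_sum]
    rw [add_comm]
    congr 1
    · rw [Finset.sum_eq_single k (by intro b _ hb; simp [hb]) (by simp)]
      simp [mul_comm]
    · refine Finset.sum_congr rfl fun i _ => ?_
      ring

/-- By the chain rule the gradient of the transformed form is the old gradient, as a row vector,
times the invertible matrix `T⁻¹`. -/
theorem SimpleZeros.act {P : MvPolynomial (Fin 2) ℝ} (hP : SimpleZeros P) (T : SL2R) :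
    SimpleZeros (act P T) := by
  intro v hv h
  rw [eval_act] at h
  have hw : (T⁻¹).1.mulVec v ≠ 0 := by
    intro h0
    apply hv
    have := congrArg (T.1.mulVec) h0
    rwa [Matrix.mulVec_mulVec, ← Matrix.SpecialLinearGroup.coe_mul, mul_inv_cancel,
      Matrix.SpecialLinearGroup.coe_one, Matrix.one_mulVec, Matrix.mulVec_zero] at this
  obtain ⟨i, hi⟩ := hP _ hw h
  by_contra! h'
  apply hi
  have h2 : Matrix.vecMul (fun i => eval ((T⁻¹).1.mulVec v) (pderiv i P)) (T⁻¹).1 = 0 := by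
    ext j
    have := h' j
    rw [pderiv_act] at this
    simp only [map_sum, map_mul, eval_C, eval_act] at this
    simpa [Matrix.vecMul, dotProduct, mul_comm] using this
  have := congrArg (fun w => Matrix.vecMul w T.1) h2
  simp only [Matrix.vecMul_vecMul, ← Matrix.SpecialLinearGroup.coe_mul, inv_mul_cancel,
      Matrix.SpecialLinearGroup.coe_one, Matrix.vecMul_one, Matrix.zero_vecMul] at this
  exact congrFun this i

/-! ### Euclidean balls around the identity and their Haar measure. -/

instance : SigmaCompactSpace SL2R :=
  haveI : SigmaCompactSpace (Matrix (Fin 2) (Fin 2) ℝ) :=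
    inferInstanceAs (SigmaCompactSpace (Fin 2 → Fin 2 → ℝ))
  Matrix.SpecialLinearGroup.isClosedEmbedding_val.sigmaCompactSpace

theorem distId_eq (T : SL2R) : distId T =
    Real.sqrt ((T.1 0 0 - 1) ^ 2 + T.1 0 1 ^ 2 + (T.1 1 0 ^ 2 + (T.1 1 1 - 1) ^ 2)) := by
  simp [distId, Fin.sum_univ_two]

theorem mem_ballId_iff {r : ℝ} (hr : 0 < r) (T : SL2R) : T ∈ ballId r ↔
    (T.1 0 0 - 1) ^ 2 + T.1 0 1 ^ 2 + (T.1 1 0 ^ 2 + (T.1 1 1 - 1) ^ 2) < r ^ 2 := by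
  rw [ballId, Set.mem_ofPred_eq, distId_eq, Real.sqrt_lt' hr]

theorem distId_nonneg (T : SL2R) : 0 ≤ distId T := Real.sqrt_nonneg _

theorem entry_of_mem_ballId {r : ℝ} {T : SL2R} (h : T ∈ ballId r) :
    |T.1 0 0 - 1| < r ∧ |T.1 0 1| < r ∧ |T.1 1 0| < r ∧ |T.1 1 1 - 1| < r := by
  have hr : 0 < r := (distId_nonneg T).trans_lt h
  rw [mem_ballId_iff hr] at h
  refine ⟨?_, ?_, ?_, ?_⟩ <;> refine abs_lt_of_sq_lt_sq ?_ hr.le <;>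
    nlinarith [sq_nonneg (T.1 0 0 - 1),
    sq_nonneg (T.1 0 1), sq_nonneg (T.1 1 0), sq_nonneg (T.1 1 1 - 1)]

theorem mem_ballId_of_entry {r : ℝ} (hr : 0 < r) {T : SL2R} (h1 : |T.1 0 0 - 1| ≤ 3 / 8 * r)
    (h2 : |T.1 0 1| ≤ 3 / 8 * r) (h3 : |T.1 1 0| ≤ 3 / 8 * r) (h4 : |T.1 1 1 - 1| ≤ 3 / 8 * r) :
    T ∈ ballId r := by
  rw [mem_ballId_iff hr]
  have := sq_le_sq' (abs_le.mp h1).1 (abs_le.mp h1).2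
  have := sq_le_sq' (abs_le.mp h2).1 (abs_le.mp h2).2
  have := sq_le_sq' (abs_le.mp h3).1 (abs_le.mp h3).2
  have := sq_le_sq' (abs_le.mp h4).1 (abs_le.mp h4).2
  nlinarith

@[fun_prop]
theorem continuous_entry (i j : Fin 2) : Continuous fun T : SL2R => T.1 i j :=
  (continuous_subtype_val (p := fun M : Matrix (Fin 2) (Fin 2) ℝ => M.det = 1)).matrix_elem i j

theorem continuous_distId : Continuous distId := by
  unfold distId
  fun_prop

theorem isOpen_ballId (r : ℝ) : IsOpen (ballId r) := isOpen_lt continuous_distId continuous_const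

theorem one_mem_ballId {r : ℝ} (hr : 0 < r) : (1 : SL2R) ∈ ballId r := by
  rw [mem_ballId_iff hr]; simpa using by positivity

theorem ballId_subset {r s : ℝ} (h : r ≤ s) : ballId r ⊆ ballId s := fun _ hT => lt_of_lt_of_le hT h

theorem det_entries (T : SL2R) : T.1 0 0 * T.1 1 1 - T.1 0 1 * T.1 1 0 = 1 := by
  rw [← Matrix.det_fin_two]; exact T.2

theorem isCompact_setOf_entry_le (C : ℝ) : IsCompact {T : SL2R | ∀ i j, |T.1 i j| ≤ C} := by
  have : {T : SL2R | ∀ i j, |T.1 i j| ≤ C} = (fun T : SL2R => T.1) ⁻¹'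
      (Set.pi Set.univ fun _ => Set.pi Set.univ fun _ => Set.Icc (-C) C :
        Set (Fin 2 → Fin 2 → ℝ)) := by
    ext T
    exact ⟨fun h i _ j _ => abs_le.mp (h i j), fun h i j => abs_le.mpr (h i trivial j trivial)⟩
  rw [this]
  exact Matrix.SpecialLinearGroup.isClosedEmbedding_val.isCompact_preimage
    (isCompact_univ_pi fun _ => isCompact_univ_pi fun _ => isCompact_Icc)

/-- `g⁻¹ T - 1 = g⁻¹ (T - g)`, where the diagonal entries of `g` are at most `2` in absolute value
and the others at most `1`. Each entry is therefore at most `(2 + 1) r / 8`. -/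
theorem inv_mul_mem_ballId {r : ℝ} (hr : 0 < r) {g T : SL2R} (hg : g ∈ ballId 1)
    (h : ∀ i j, |T.1 i j - g.1 i j| ≤ r / 8) : g⁻¹ * T ∈ ballId r := by
  obtain ⟨h1, h2, h3, h4⟩ := entry_of_mem_ballId hg
  have hdet := det_entries g
  have key : ∀ p q e f : ℝ, |p| ≤ 2 → |q| ≤ 1 → |e| ≤ r / 8 → |f| ≤ r / 8 →
      |p * e + q * f| ≤ 3 / 8 * r := by
    intro p q e f hp hq he hf
    calc |p * e + q * f| ≤ |p| * |e| + |q| * |f| := by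
          rw [← abs_mul, ← abs_mul]; exact abs_add_le _ _
      _ ≤ 2 * (r / 8) + 1 * (r / 8) := by gcongr
      _ = _ := by ring
  have ha : |g.1 0 0| ≤ 2 := by rw [abs_lt] at h1; rw [abs_le]; constructor <;> linarith
  have hd : |g.1 1 1| ≤ 2 := by rw [abs_lt] at h4; rw [abs_le]; constructor <;> linarith
  have e00 : (g⁻¹ * T).1 0 0 - 1 = g.1 1 1 * (T.1 0 0 - g.1 0 0) +
      (-g.1 0 1) * (T.1 1 0 - g.1 1 0) := by
    simp [Matrix.mul_apply, Fin.sum_univ_two, Matrix.adjugate_fin_two]; linear_combination hdet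
  have e01 : (g⁻¹ * T).1 0 1 = g.1 1 1 * (T.1 0 1 - g.1 0 1) +
      (-g.1 0 1) * (T.1 1 1 - g.1 1 1) := by
    simp [Matrix.mul_apply, Fin.sum_univ_two, Matrix.adjugate_fin_two]; ring
  have e10 : (g⁻¹ * T).1 1 0 = g.1 0 0 * (T.1 1 0 - g.1 1 0) +
      (-g.1 1 0) * (T.1 0 0 - g.1 0 0) := by
    simp [Matrix.mul_apply, Fin.sum_univ_two, Matrix.adjugate_fin_two]; ring
  have e11 : (g⁻¹ * T).1 1 1 - 1 = g.1 0 0 * (T.1 1 1 - g.1 1 1) +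
      (-g.1 1 0) * (T.1 0 1 - g.1 0 1) := by
    simp [Matrix.mul_apply, Fin.sum_univ_two, Matrix.adjugate_fin_two]; linear_combination hdet
  apply mem_ballId_of_entry hr
  · rw [e00]; exact key _ _ _ _ hd (by rw [abs_neg]; exact h2.le) (h _ _) (h _ _)
  · rw [e01]; exact key _ _ _ _ hd (by rw [abs_neg]; exact h2.le) (h _ _) (h _ _)
  · rw [e10]; exact key _ _ _ _ ha (by rw [abs_neg]; exact h3.le) (h _ _) (h _ _)
  · rw [e11]; exact key _ _ _ _ ha (by rw [abs_neg]; exact h3.le) (h _ _) (h _ _)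

section Measure

variable [MeasurableSpace SL2R] (μ : Measure SL2R) [μ.IsHaarMeasure]

theorem measure_ballId_ne_top (r : ℝ) : μ (ballId r) ≠ ∞ := by
  refine ((measure_mono fun T hT => ?_).trans_lt
    ((isCompact_setOf_entry_le (r + 1)).measure_lt_top (μ := μ))).ne
  obtain ⟨h1, h2, h3, h4⟩ := entry_of_mem_ballId hT
  rw [abs_lt] at *
  intro i j
  rw [abs_le]
  fin_cases i <;> fin_cases j <;> simp <;> constructor <;> linarith

theorem measure_ballId_pos {r : ℝ} (hr : 0 < r) : 0 < μ (ballId r) :=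
  (isOpen_ballId r).measure_pos μ ⟨1, one_mem_ballId hr⟩

/-- The doubling property of the Haar measure near the identity. -/
theorem measure_ballId_mul_le [BorelSpace SL2R] (K : ℕ) {r : ℝ} (hr : 0 < r) (hK : K * r ≤ 1) :
    μ (ballId (K * r)) ≤ ((16 * K + 1) ^ 4 : ℕ) * μ (ballId r) := by
  classical
  -- Cells have side `r / 8`, so by `inv_mul_mem_ballId` the part of the large ball in one cell lies
  -- in a left translate of the small ball. Each coordinate takes at most `16 K + 1` values.
  let cell : SL2R → Fin 2 → Fin 2 → ℤ := fun T i j =>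
    ⌊(T.1 i j - (1 : Matrix (Fin 2) (Fin 2) ℝ) i j) * 8 / r⌋
  let s : Finset (Fin 2 → Fin 2 → ℤ) := Fintype.piFinset fun _ => Fintype.piFinset fun _ =>
    Finset.Icc (-(8 * K : ℤ)) (8 * K)
  have hcard : s.card = (16 * K + 1) ^ 4 := by
    simp only [s, Fintype.card_piFinset, Finset.prod_const, Int.card_Icc, Finset.card_univ,
      Fintype.card_fin, ← pow_mul]
    congr 1
    omega
  have hcover : ballId (K * r) ⊆ ⋃ c ∈ s, (ballId (K * r) ∩ cell ⁻¹' {c}) := by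
    intro T hT
    simp only [Set.mem_iUnion, Set.mem_inter_iff, Set.mem_preimage, Set.mem_singleton_iff]
    refine ⟨cell T, ?_, hT, rfl⟩
    obtain ⟨h1, h2, h3, h4⟩ := entry_of_mem_ballId hT
    have key : ∀ x : ℝ, |x| < K * r → ⌊x * 8 / r⌋ ∈ Finset.Icc (-(8 * K : ℤ)) (8 * K) := by
      intro x hx
      rw [abs_lt] at hx
      rw [Finset.mem_Icc, Int.le_floor, ← Int.lt_add_one_iff, Int.floor_lt, le_div_iff₀ hr,
        div_lt_iff₀ hr]
      push_cast
      constructor <;> nlinarith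
    simp only [s, Fintype.mem_piFinset]
    intro i j
    fin_cases i <;> fin_cases j <;> apply key <;> simpa
  calc μ (ballId (K * r)) ≤ μ (⋃ c ∈ s, (ballId (K * r) ∩ cell ⁻¹' {c})) := measure_mono hcover
    _ ≤ ∑ c ∈ s, μ (ballId (K * r) ∩ cell ⁻¹' {c}) := measure_biUnion_finset_le _ _
    _ ≤ ∑ c ∈ s, μ (ballId r) := by
        refine Finset.sum_le_sum fun c _ => ?_
        obtain hem | ⟨g, hg, hgc⟩ := (ballId (K * r) ∩ cell ⁻¹' {c}).eq_empty_or_nonempty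
        · simp [hem]
        rw [← measure_preimage_mul μ g⁻¹ (ballId r)]
        refine measure_mono fun T ⟨hT, hTc⟩ => ?_
        refine inv_mul_mem_ballId hr (ballId_subset hK hg) fun i j => ?_
        have h := congrFun (congrFun ((Set.mem_singleton_iff.mp hTc).trans
          (Set.mem_singleton_iff.mp hgc).symm) i) j
        have := (Int.abs_sub_lt_one_of_floor_eq_floor h).le
        rw [← sub_div, ← sub_mul, abs_div, abs_of_pos hr, div_le_one hr, abs_mul] at this
        simp only [sub_sub_sub_cancel_right] at this
        rw [abs_of_pos (by norm_num : (0 : ℝ) < 8)] at this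
        linarith
    _ = _ := by rw [Finset.sum_const, hcard, nsmul_eq_mul]

end Measure

/-! ### Fubini along unipotent orbits: the distribution of `T(0)`. -/

/-- The unipotent element acting as the translation by `t`. -/
def unipotent (t : ℝ) : SL2R := ⟨!![1, t; 0, 1], by simp⟩

theorem coe_unipotent (t : ℝ) : (unipotent t).1 = !![1, t; 0, 1] := rfl

theorem unipotent_mul_entries (t : ℝ) (T : SL2R) :
    (unipotent t * T).1 0 0 = T.1 0 0 + t * T.1 1 0 ∧
    (unipotent t * T).1 0 1 = T.1 0 1 + t * T.1 1 1 ∧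
    (unipotent t * T).1 1 0 = T.1 1 0 ∧ (unipotent t * T).1 1 1 = T.1 1 1 := by
  simp [coe_unipotent, Matrix.mul_apply, Fin.sum_univ_two]

theorem unipotent_mul_unipotent_neg (t : ℝ) : unipotent t * unipotent (-t) = 1 := by
  ext i j
  fin_cases i <;> fin_cases j <;> simp [coe_unipotent, Matrix.mul_apply, Fin.sum_univ_two]

theorem unipotent_neg_mul_unipotent (t : ℝ) : unipotent (-t) * unipotent t = 1 := by
  ext i j
  fin_cases i <;> fin_cases j <;> simp [coe_unipotent, Matrix.mul_apply, Fin.sum_univ_two]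

theorem continuous_unipotent : Continuous unipotent := by
  refine Continuous.subtype_mk ?_ _
  fun_prop

theorem moebius_zero (T : SL2R) : moebius T 0 = T.1 0 1 / T.1 1 1 := by simp [moebius, denom]

theorem moebius_unipotent_mul_zero (t : ℝ) {T : SL2R} (hT : T.1 1 1 ≠ 0) :
    moebius (unipotent t * T) 0 = t + moebius T 0 := by
  obtain ⟨-, h2, -, h4⟩ := unipotent_mul_entries t T
  rw [moebius_zero, moebius_zero, h2, h4]
  field_simp
  ring

/-- A window, in the fibration of `SL₂(ℝ)` by the orbits of the unipotent group. -/
def window (r : ℝ) : Set SL2R := {T | |moebius T 0| < r ∧ |T.1 1 0| < r ∧ |T.1 1 1 - 1| < r}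

/-- `T(0)`, `c` and `d` determine `T`: `b = d T(0)`, and the determinant gives `a`. By doubling, the
window then has measure at most a constant times that of the ball, which absorbs errors integrated
over it. -/
theorem window_subset {r : ℝ} (hr : 0 < r) (hr' : r ≤ 1 / 8) : window r ⊆ ballId ((8 : ℕ) * r) := by
  rintro T ⟨h1, h2, h3⟩
  have hdet := det_entries T
  rw [moebius_zero] at h1
  set d := T.1 1 1
  set c := T.1 1 0
  set b := T.1 0 1
  set a := T.1 0 0
  have h3' := abs_lt.mp h3
  have hd : 0 < d := by linarith
  rw [abs_div, abs_of_pos hd, div_lt_iff₀ hd] at h1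
  have hb : |b| ≤ 9 / 8 * r := by nlinarith
  have hbc : |b * c| ≤ 9 / 8 * r * (1 / 8) := by
    rw [abs_mul]; exact mul_le_mul hb (h2.le.trans hr') (abs_nonneg _) (by linarith)
  have ha : |a - 1| ≤ 3 * r := by
    have e : (a - 1) * d = b * c - (d - 1) := by linear_combination hdet
    have : |a - 1| * d ≤ |b * c| + |d - 1| := by
      rw [← abs_of_pos hd, ← abs_mul, abs_of_pos hd, e]; exact abs_sub _ _
    nlinarith [abs_nonneg (a - 1)]
  apply mem_ballId_of_entry (by positivity)
  all_goals push_cast; linarith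

theorem measurableSet_window [MeasurableSpace SL2R] [BorelSpace SL2R] (r : ℝ) :
    MeasurableSet (window r) := by
  have h (i j : Fin 2) : Measurable fun T : SL2R => T.1 i j := (continuous_entry i j).measurable
  simp only [window, moebius_zero]
  refine .inter (measurableSet_lt (((h 0 1).div (h 1 1)).abs) measurable_const)
    (.inter (measurableSet_lt ((h 1 0).abs) measurable_const)
      (measurableSet_lt (((h 1 1).sub_const 1).abs) measurable_const))

theorem measurable_moebius_zero [MeasurableSpace SL2R] [BorelSpace SL2R] :
    Measurable fun T : SL2R => moebius T 0 := by
  simp only [moebius_zero]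
  exact (continuous_entry 0 1).measurable.div (continuous_entry 1 1).measurable

/-- For fixed `t`, left invariance replaces `T` by `unipotent (-t) * T`. For fixed `T` in `E`, the
conditions on `c` and `d` hold automatically and are unaffected by the translation, so the
admissible `t` form the interval of radius `r` around `T(0)`. -/
theorem lintegral_window [MeasurableSpace SL2R] [BorelSpace SL2R] (μ : Measure SL2R)
    [μ.IsHaarMeasure] {r : ℝ} (hr : r ≤ 1 / 8) {E : Set SL2R} (hE : MeasurableSet E)
    (hEr : E ⊆ ballId r) :
    ∫⁻ T, volume {t : ℝ | T ∈ window r ∧ unipotent t * T ∈ E} ∂μ =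
      ENNReal.ofReal (2 * r) * μ E := by
  let A : Set (SL2R × ℝ) := {p | p.1 ∈ window r ∧ unipotent p.2 * p.1 ∈ E}
  let B : Set (SL2R × ℝ) := {p | unipotent (-p.2) * p.1 ∈ window r ∧ p.1 ∈ E}
  have hm : Measurable fun p : SL2R × ℝ => unipotent p.2 * p.1 :=
    ((continuous_unipotent.comp continuous_snd).mul continuous_fst).measurable
  have hm' : Measurable fun p : SL2R × ℝ => unipotent (-p.2) * p.1 :=
    ((continuous_unipotent.comp continuous_snd.neg).mul continuous_fst).measurable
  have hA : MeasurableSet A := (measurable_fst (measurableSet_window r)).inter (hm hE)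
  have hB : MeasurableSet B := (hm' (measurableSet_window r)).inter (measurable_fst hE)
  have h1 := Measure.prod_apply (μ := μ) (ν := volume) hA
  have h2 := Measure.prod_apply (μ := μ) (ν := volume) hB
  have h3 : (μ.prod volume) A = (μ.prod volume) B := by
    rw [Measure.prod_apply_symm hA, Measure.prod_apply_symm hB]
    refine lintegral_congr fun t => ?_
    rw [← measure_preimage_mul μ (unipotent t) ((fun T => (T, t)) ⁻¹' B)]
    congr 1
    ext T
    simp [A, B, ← mul_assoc, unipotent_neg_mul_unipotent]
  rw [← h3, h1] at h2
  refine h2.trans ?_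
  rw [← lintegral_indicator_const hE]
  refine lintegral_congr fun T => ?_
  by_cases hT : T ∈ E
  · rw [Set.indicator_of_mem hT]
    obtain ⟨-, -, h3, h4⟩ := entry_of_mem_ballId (hEr hT)
    have hd : T.1 1 1 ≠ 0 := by
      intro h; rw [h] at h4; norm_num at h4; linarith
    have : Prod.mk T ⁻¹' B = Metric.ball (moebius T 0) r := by
      ext t
      obtain ⟨-, -, e3, e4⟩ := unipotent_mul_entries (-t) T
      simp only [B, window, Set.mem_preimage, Set.mem_ofPred_eq, hT, and_true, e3, e4, h3, h4,
        moebius_unipotent_mul_zero _ hd, Metric.mem_ball, Real.dist_eq]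
      rw [← abs_neg]
      ring_nf
    rw [this, Real.volume_ball]
  · rw [Set.indicator_of_notMem hT]
    have : Prod.mk T ⁻¹' B = ∅ := by ext t; simp [B, hT]
    rw [this, measure_empty]

/-- The translates of an element of the window that lie in the ball form an interval, which is
almost centered. -/
theorem exists_fiber_eq_ball {r : ℝ} (hr : 0 < r) (hr' : r ≤ 1 / 8) {T : SL2R} (hT : T ∈ window r) :
    ∃ y l : ℝ, 0 ≤ l ∧ |y| + l ≤ 3 * r ∧ |y| ≤ 3 * r ^ 2 ∧ T.1 1 1 ≠ 0 ∧
      ∀ t, unipotent t * T ∈ ballId r ↔ t + moebius T 0 ∈ Metric.ball y l := by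
  obtain ⟨-, h2, h3⟩ := hT
  have hdet := det_entries T
  simp only [mem_ballId_iff hr, moebius_zero, unipotent_mul_entries]
  generalize T.1 1 1 = d at *
  generalize T.1 1 0 = c at *
  generalize T.1 0 1 = b at *
  generalize T.1 0 0 = a at *
  have h3' := abs_lt.mp h3
  have hd : 7 / 8 ≤ d := by linarith
  have hd0 : 0 < d := by linarith
  have hA : 3 / 4 ≤ c ^ 2 + d ^ 2 := by nlinarith [sq_nonneg c]
  set A := c ^ 2 + d ^ 2
  have hA0 : 0 < A := by linarith
  -- As a function of `x = t + T(0)`, the squared distance of the translate to the identity is a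
  -- quadratic polynomial with leading coefficient `A` and vertex `y`; it is below `r ^ 2` exactly
  -- when `(x - y) ^ 2 < S`. The vertex is `O(r ^ 2)` because `c` and `1 / d - 1` are both `O(r)`. A
  -- negative `S` gives radius `0` and an empty ball.
  set y := -(c * (1 / d - 1)) / A with hy
  set S := (r ^ 2 - ((1 / d - 1) ^ 2 + c ^ 2 + (d - 1) ^ 2)) / A + y ^ 2 with hS
  have hyA : y * A = -(c * (1 / d - 1)) := by rw [hy]; field_simp
  have h1d : |1 / d - 1| ≤ 8 / 7 * r := by
    have : 1 / d - 1 = -(d - 1) / d := by field_simp; ring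
    rw [this, abs_div, abs_neg, abs_of_pos hd0, div_le_iff₀ hd0]
    nlinarith
  have hyr : |y| ≤ 8 / 5 * r ^ 2 := by
    rw [hy, abs_div, abs_neg, abs_mul, abs_of_pos hA0, div_le_iff₀ hA0]
    have : |c| * |1 / d - 1| ≤ r * (8 / 7 * r) := by gcongr
    nlinarith [sq_nonneg r]
  have hSr : S ≤ (4 / 3 * r) ^ 2 := by
    have e : S * A = r ^ 2 - c ^ 2 - (d - 1) ^ 2 - ((1 / d - 1) ^ 2 - y * (y * A)) := by
      rw [hS]; field_simp; ring
    have : y * (y * A) ≤ (1 / d - 1) ^ 2 := by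
      have e2 : y * (y * A) * A = c ^ 2 * (1 / d - 1) ^ 2 := by
        calc y * (y * A) * A = (y * A) * (y * A) := by ring
          _ = _ := by rw [hyA]; ring
      have : y * (y * A) * A ≤ (1 / d - 1) ^ 2 * A := by
        rw [e2]; simp only [A]; nlinarith [mul_nonneg (sq_nonneg d) (sq_nonneg (1 / d - 1))]
      exact le_of_mul_le_mul_right this hA0
    have hSA : S * A ≤ r ^ 2 := by nlinarith [sq_nonneg c, sq_nonneg (d - 1)]
    by_contra! hcon
    nlinarith [sq_nonneg r, mul_lt_mul_of_pos_right hcon hA0]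
  have hl : Real.sqrt S ≤ 4 / 3 * r := by
    rw [Real.sqrt_le_left (by positivity)]; exact hSr
  refine ⟨y, Real.sqrt S, Real.sqrt_nonneg _, ?_, ?_, hd0.ne', fun t => ?_⟩
  · nlinarith
  · nlinarith [sq_nonneg r]
  · rw [Metric.mem_ball, Real.dist_eq, Real.lt_sqrt (abs_nonneg _), sq_abs]
    have ha : a = 1 / d + (b / d) * c := by field_simp; linarith
    have hb : b = (b / d) * d := by field_simp
    generalize b / d = x at *
    rw [ha, hb]
    have e1 : (1 / d + x * c + t * c - 1) ^ 2 + (x * d + t * d) ^ 2 + (c ^ 2 + (d - 1) ^ 2)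
        = A * (t + x) ^ 2 + 2 * (c * (1 / d - 1)) * (t + x) +
          ((1 / d - 1) ^ 2 + c ^ 2 + (d - 1) ^ 2) := by
      simp only [A]; ring
    have e2 : c * (1 / d - 1) = - (y * A) := by rw [hyA]; ring
    have e3 : A * (t + x) ^ 2 + 2 * (c * (1 / d - 1)) * (t + x) =
        (t + x - y) ^ 2 * A - y ^ 2 * A := by rw [e2]; ring
    rw [e1, e3, hS, ← sub_lt_iff_lt_add, lt_div_iff₀ hA0, sub_mul, lt_sub_iff_add_lt]

section Measure

variable [MeasurableSpace SL2R] [BorelSpace SL2R]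

/-- Each fiber of the ball is an interval of center `y = O(r ^ 2)`, contained in a ball centered at
`0` that is larger by `|y|` only. The hypothesis on centered balls thus bounds the part of the fiber
over `Y` by `h` times the fiber, plus an error that is integrated over the window. -/
theorem measure_moebius_zero_le (μ : Measure SL2R) [μ.IsHaarMeasure] {r h δ : ℝ} (hr : 0 < r)
    (hr' : r ≤ 1 / 8) (hh : 0 ≤ h) (hδ : 0 ≤ δ) {Y : Set ℝ}
    (hY : ∀ s, s ≤ 3 * r → volume (Y ∩ Metric.ball 0 s) ≤ ENNReal.ofReal (h * (2 * s) + δ * r)) :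
    μ {T | T ∈ ballId r ∧ moebius T 0 ∈ Y} ≤
      ENNReal.ofReal (h + (6 * h * r + δ) * 129 ^ 4) * μ (ballId r) := by
  wlog hYm : MeasurableSet Y generalizing Y
  · refine (measure_mono (t := {T | T ∈ ballId r ∧ moebius T 0 ∈ toMeasurable volume Y})
      fun T hT => ⟨hT.1, subset_toMeasurable volume Y hT.2⟩).trans
      (this (Y := toMeasurable volume Y) (fun s hs => ?_) (measurableSet_toMeasurable _ _))
    rw [Measure.measure_toMeasurable_inter_of_sFinite Metric.isOpen_ball.measurableSet]
    exact hY s hs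
  set E := {T | T ∈ ballId r ∧ moebius T 0 ∈ Y}
  have hB : MeasurableSet (ballId r) := (isOpen_ballId r).measurableSet
  have hE : MeasurableSet E := hB.inter (measurable_moebius_zero hYm)
  -- The term `6 h r ^ 2` is the recentering cost `2 h |y|` with `|y| ≤ 3 r ^ 2`.
  set e : ℝ := (6 * h * r + δ) * r with he
  have he0 : 0 ≤ e := by positivity
  have key : ∀ T, volume {t : ℝ | T ∈ window r ∧ unipotent t * T ∈ E} ≤
      ENNReal.ofReal h * volume {t : ℝ | T ∈ window r ∧ unipotent t * T ∈ ballId r} +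
        (window r).indicator (fun _ => ENNReal.ofReal e) T := by
    intro T
    by_cases hT : T ∈ window r
    · obtain ⟨y, l, hl, hyl, hy, hd, hball⟩ := exists_fiber_eq_ball hr hr' hT
      rw [Set.indicator_of_mem hT]
      have e1 : {t : ℝ | T ∈ window r ∧ unipotent t * T ∈ ballId r} =
          (fun t => t + moebius T 0) ⁻¹' Metric.ball y l := by
        ext t; simp only [Set.mem_ofPred_eq, hT, true_and, hball, Set.mem_preimage]
      have e2 : {t : ℝ | T ∈ window r ∧ unipotent t * T ∈ E} =
          (fun t => t + moebius T 0) ⁻¹' (Metric.ball y l ∩ Y) := by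
        ext t
        simp only [Set.mem_ofPred_eq, hT, true_and, E, hball, Set.mem_preimage, Set.mem_inter_iff,
          moebius_unipotent_mul_zero t hd]
      rw [e1, e2, measure_preimage_add_right, measure_preimage_add_right, Real.volume_ball,
        ← ENNReal.ofReal_mul hh, ← ENNReal.ofReal_add (by positivity) he0]
      calc volume (Metric.ball y l ∩ Y) ≤ volume (Y ∩ Metric.ball 0 (|y| + l)) := by
            refine measure_mono fun x hx => ⟨hx.2, ?_⟩
            have := hx.1
            rw [Metric.mem_ball, Real.dist_eq] at this
            rw [Metric.mem_ball, Real.dist_eq, sub_zero]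
            calc |x| = |y + (x - y)| := by ring_nf
              _ ≤ |y| + |x - y| := abs_add_le _ _
              _ < _ := by linarith
        _ ≤ ENNReal.ofReal (h * (2 * (|y| + l)) + δ * r) := hY _ hyl
        _ ≤ _ := by
            apply ENNReal.ofReal_le_ofReal
            rw [he]
            nlinarith [mul_le_mul_of_nonneg_left hy hh]
    · simp [hT]
  have h1 := lintegral_window μ hr' hE fun T hT => hT.1
  have h2 := lintegral_window μ hr' hB subset_rfl
  have h3 : ENNReal.ofReal (2 * r) * μ E ≤ ENNReal.ofReal h * (ENNReal.ofReal (2 * r) * μ (ballId r))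
      + ENNReal.ofReal e * μ (window r) := by
    rw [← h1, ← h2, ← lintegral_const_mul' _ _ ENNReal.ofReal_ne_top,
      ← lintegral_indicator_const (measurableSet_window r),
      ← lintegral_add_right _ (measurable_const.indicator (measurableSet_window r))]
    exact lintegral_mono key
  -- `129 = 16 * 8 + 1` is the doubling constant for the ratio `8` of `window_subset`.
  have h4 : μ (window r) ≤ ENNReal.ofReal (129 ^ 4) * μ (ballId r) := by
    refine (measure_mono (window_subset hr hr')).trans
      ((measure_ballId_mul_le μ 8 hr (by push_cast; linarith)).trans_eq ?_)
    congr 1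
    rw [← ENNReal.ofReal_natCast]
    norm_num
  have h5 : ENNReal.ofReal (2 * r) * μ E ≤
      ENNReal.ofReal (2 * r) * (ENNReal.ofReal (h + (6 * h * r + δ) * 129 ^ 4) * μ (ballId r)) := by
    refine h3.trans ((add_le_add_right (mul_le_mul_right h4 _) _).trans ?_)
    rw [← mul_assoc, ← mul_assoc, ← mul_assoc, ← add_mul, ← ENNReal.ofReal_mul hh,
      ← ENNReal.ofReal_mul he0, ← ENNReal.ofReal_mul (by positivity),
      ← ENNReal.ofReal_add (by positivity) (by positivity)]
    gcongr
    have : 0 ≤ (6 * h * r + δ) * 129 ^ 4 * r := by positivity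
    rw [he]
    nlinarith
  exact (ENNReal.mul_le_mul_iff_right (by simpa using hr) ENNReal.ofReal_ne_top).mp h5

end Measure

/-! ### From the point `0` to an arbitrary point `ρ`. -/

/-- The rotation that moves `ρ` to `0`. -/
noncomputable def rotation (ρ : ℝ) : SL2R :=
  ⟨!![1 / Real.sqrt (1 + ρ ^ 2), -(ρ / Real.sqrt (1 + ρ ^ 2));
      ρ / Real.sqrt (1 + ρ ^ 2), 1 / Real.sqrt (1 + ρ ^ 2)], by
    have : 0 < 1 + ρ ^ 2 := by positivity
    rw [Matrix.det_fin_two_of]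
    have h := Real.sq_sqrt this.le
    have := Real.sqrt_pos.mpr this
    field_simp
    linarith⟩

theorem coe_rotation (ρ : ℝ) : (rotation ρ).1 =
    !![1 / Real.sqrt (1 + ρ ^ 2), -(ρ / Real.sqrt (1 + ρ ^ 2));
      ρ / Real.sqrt (1 + ρ ^ 2), 1 / Real.sqrt (1 + ρ ^ 2)] := rfl

theorem conj_rotation_entries (ρ : ℝ) (T : SL2R) : ∃ u : ℝ, u ^ 2 * (1 + ρ ^ 2) = 1 ∧
    (rotation ρ * T * (rotation ρ)⁻¹).1 = !![
      u ^ 2 * ((T.1 0 0 - ρ * T.1 1 0) - ρ * (T.1 0 1 - ρ * T.1 1 1)),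
      u ^ 2 * (ρ * (T.1 0 0 - ρ * T.1 1 0) + (T.1 0 1 - ρ * T.1 1 1));
      u ^ 2 * ((ρ * T.1 0 0 + T.1 1 0) - ρ * (ρ * T.1 0 1 + T.1 1 1)),
      u ^ 2 * (ρ * (ρ * T.1 0 0 + T.1 1 0) + (ρ * T.1 0 1 + T.1 1 1))] := by
  have : 0 < 1 + ρ ^ 2 := by positivity
  refine ⟨1 / Real.sqrt (1 + ρ ^ 2), ?_, ?_⟩
  · rw [div_pow, Real.sq_sqrt this.le]; field_simp
  · ext i j
    fin_cases i <;> fin_cases j <;>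
      simp [coe_rotation, Matrix.mul_apply, Fin.sum_univ_two, Matrix.adjugate_fin_two,
        Matrix.vecMul, dotProduct] <;> ring

theorem distId_conj_rotation (ρ : ℝ) (T : SL2R) :
    distId (rotation ρ * T * (rotation ρ)⁻¹) = distId T := by
  obtain ⟨u, hu, h⟩ := conj_rotation_entries ρ T
  rw [distId_eq, distId_eq, h]
  congr 1
  simp only [Matrix.of_apply, Matrix.cons_val', Matrix.cons_val_zero, Matrix.cons_val_one,
    Matrix.cons_val_fin_one]
  generalize T.1 0 0 = a; generalize T.1 0 1 = b; generalize T.1 1 0 = c; generalize T.1 1 1 = d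
  have e1 : u ^ 2 * (a - ρ * c - ρ * (b - ρ * d)) - 1 =
      u ^ 2 * (a - ρ * c - ρ * (b - ρ * d) - (1 + ρ ^ 2)) := by linear_combination hu
  have e2 : u ^ 2 * (ρ * (ρ * a + c) + (ρ * b + d)) - 1 =
      u ^ 2 * (ρ * (ρ * a + c) + (ρ * b + d) - (1 + ρ ^ 2)) := by linear_combination hu
  rw [e1, e2]
  have e3 : u ^ 4 * (1 + ρ ^ 2) ^ 2 = 1 := by
    calc u ^ 4 * (1 + ρ ^ 2) ^ 2 = (u ^ 2 * (1 + ρ ^ 2)) ^ 2 := by ring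
      _ = 1 := by rw [hu, one_pow]
  linear_combination ((a - 1) ^ 2 + b ^ 2 + (c ^ 2 + (d - 1) ^ 2)) * e3

/-- The map `y ↦ (ρ + y) / (1 - ρ y)` is the inverse rotation, which carries `0` to `ρ`. -/
theorem moebius_conj_rotation (ρ : ℝ) (T : SL2R)
    (h0 : (rotation ρ * T * (rotation ρ)⁻¹).1 1 1 ≠ 0) :
    moebius T ρ = (ρ + moebius (rotation ρ * T * (rotation ρ)⁻¹) 0) /
      (1 - ρ * moebius (rotation ρ * T * (rotation ρ)⁻¹) 0) := by
  obtain ⟨u, hu, h⟩ := conj_rotation_entries ρ T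
  have hu0 : u ^ 2 ≠ 0 := fun h => by simp [h] at hu
  rw [moebius_zero]
  rw [h] at h0 ⊢
  simp only [Matrix.of_apply, Matrix.cons_val', Matrix.cons_val_zero, Matrix.cons_val_one,
    Matrix.cons_val_fin_one] at h0 ⊢
  rw [mul_div_mul_left _ _ hu0]
  have h1 := right_ne_zero_of_mul h0
  rw [moebius, denom]
  generalize T.1 0 0 = a at *; generalize T.1 0 1 = b at *
  generalize T.1 1 0 = c at *; generalize T.1 1 1 = d at *
  have h2 : (ρ * (a - ρ * c) + (b - ρ * d)) / (ρ * (ρ * a + c) + (ρ * b + d)) =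
    ((a * ρ + b) - ρ * (c * ρ + d)) / (ρ * (a * ρ + b) + (c * ρ + d)) := by ring_nf
  have h3 : ρ * (a * ρ + b) + (c * ρ + d) ≠ 0 := by
    convert h1 using 1; ring
  rw [h2]
  generalize a * ρ + b = p at *; generalize c * ρ + d = q at *
  have hρ : (1 + ρ ^ 2) ≠ 0 := by positivity
  have e1 : ρ + (p - ρ * q) / (ρ * p + q) = (1 + ρ ^ 2) * p / (ρ * p + q) := by
    field_simp; ring
  have e2 : 1 - ρ * ((p - ρ * q) / (ρ * p + q)) = (1 + ρ ^ 2) * q / (ρ * p + q) := by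
    field_simp; ring
  rw [e1, e2, div_div_div_cancel_right₀ h3, mul_div_mul_left _ _ hρ]

/-- The inverse map `x ↦ (x - ρ) / (1 + ρ x)` is Lipschitz near `ρ` with a constant close to `1 / (1
+ ρ ^ 2)`, and one-dimensional Hausdorff measure grows at most by the Lipschitz constant. -/
theorem volume_preimage_rotation_le (ρ : ℝ) {s : ℝ} (hs : |ρ| * s ≤ 1 / 10) (hs0 : 0 < s)
    (Y : Set ℝ) {b : ℝ}
    (hY : volume (Y ∩ Metric.ball ρ ((1 + ρ ^ 2) * s / (1 - |ρ| * s))) ≤ ENNReal.ofReal b) :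
    volume ((fun y => (ρ + y) / (1 - ρ * y)) ⁻¹' Y ∩ Metric.ball 0 s) ≤
      ENNReal.ofReal ((1 - |ρ| * s) ^ 2 / ((1 + ρ ^ 2) * (1 - 2 * (|ρ| * s)) ^ 2) * b) := by
  have hσ0 : 0 ≤ |ρ| * s := by positivity
  generalize hσ : |ρ| * s = σ at *
  have hq : 0 < 1 + ρ ^ 2 := by positivity
  set t := (1 + ρ ^ 2) * s / (1 - σ) with ht
  have h1σ : 0 < 1 - σ := by linarith
  have h2σ : 0 < 1 - 2 * σ := by linarith
  set K := (1 - σ) ^ 2 / ((1 + ρ ^ 2) * (1 - 2 * σ) ^ 2) with hK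
  have hK0 : 0 ≤ K := by positivity
  set φ : ℝ → ℝ := fun x => (x - ρ) / (1 + ρ * x)
  have hden : ∀ x ∈ Metric.ball ρ t, (1 + ρ ^ 2) * (1 - 2 * σ) / (1 - σ) ≤ 1 + ρ * x := by
    intro x hx
    rw [Metric.mem_ball, Real.dist_eq] at hx
    have h1 : |ρ * (x - ρ)| ≤ |ρ| * t := by
      rw [abs_mul]; gcongr
    have h2 : |ρ| * t = (1 + ρ ^ 2) * σ / (1 - σ) := by rw [ht, ← hσ]; ring
    have h3 : (1 + ρ ^ 2) * (1 - 2 * σ) / (1 - σ) = (1 + ρ ^ 2) - (1 + ρ ^ 2) * σ / (1 - σ) := by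
      field_simp; ring
    have := (abs_le.mp h1).1
    rw [h3, ← h2]
    nlinarith
  have hlow : 0 < (1 + ρ ^ 2) * (1 - 2 * σ) / (1 - σ) := by positivity
  have hLip : LipschitzOnWith K.toNNReal φ (Y ∩ Metric.ball ρ t) := by
    refine LipschitzOnWith.of_dist_le_mul fun x hx y hy => ?_
    have h1 := hden x hx.2
    have h2 := hden y hy.2
    have h1' := hlow.trans_le h1
    have h2' := hlow.trans_le h2
    rw [Real.coe_toNNReal _ hK0, Real.dist_eq, Real.dist_eq]
    have e : φ x - φ y = (1 + ρ ^ 2) / ((1 + ρ * x) * (1 + ρ * y)) * (x - y) := by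
      simp only [φ]
      rw [div_sub_div _ _ h1'.ne' h2'.ne', div_mul_eq_mul_div]
      ring
    rw [e, abs_mul]
    gcongr
    rw [abs_of_pos (by positivity), div_le_iff₀ (by positivity)]
    have h3 : ((1 + ρ ^ 2) * (1 - 2 * σ) / (1 - σ)) * ((1 + ρ ^ 2) * (1 - 2 * σ) / (1 - σ)) ≤
        (1 + ρ * x) * (1 + ρ * y) := by gcongr
    calc 1 + ρ ^ 2 = K * (((1 + ρ ^ 2) * (1 - 2 * σ) / (1 - σ)) *
          ((1 + ρ ^ 2) * (1 - 2 * σ) / (1 - σ))) := by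
            rw [hK]
            generalize 1 - 2 * σ = w at h2σ
            field_simp
      _ ≤ _ := by gcongr
  have hsub : (fun y => (ρ + y) / (1 - ρ * y)) ⁻¹' Y ∩ Metric.ball 0 s ⊆
      φ '' (Y ∩ Metric.ball ρ t) := by
    rintro y ⟨hy, hys⟩
    rw [Metric.mem_ball, Real.dist_eq, sub_zero] at hys
    have h1 : |ρ * y| ≤ σ := by rw [← hσ, abs_mul]; gcongr
    have h2 : 1 - σ ≤ 1 - ρ * y := by linarith [(abs_le.mp h1).2]
    have h3 : 0 < 1 - ρ * y := by linarith
    refine ⟨(ρ + y) / (1 - ρ * y), ⟨hy, ?_⟩, ?_⟩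
    · rw [Metric.mem_ball, Real.dist_eq]
      have e : (ρ + y) / (1 - ρ * y) - ρ = (1 + ρ ^ 2) * y / (1 - ρ * y) := by field_simp; ring
      rw [e, abs_div, abs_mul, abs_of_pos hq, abs_of_pos h3, ht]
      calc (1 + ρ ^ 2) * |y| / (1 - ρ * y) ≤ (1 + ρ ^ 2) * |y| / (1 - σ) := by gcongr
        _ < _ := by gcongr
    · simp only [φ]
      have e1 : (ρ + y) / (1 - ρ * y) - ρ = (1 + ρ ^ 2) * y / (1 - ρ * y) := by field_simp; ring
      have e2 : 1 + ρ * ((ρ + y) / (1 - ρ * y)) = (1 + ρ ^ 2) / (1 - ρ * y) := by field_simp; ring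
      rw [e1, e2]
      field_simp
  have hH := hLip.hausdorffMeasure_image_le (d := 1) zero_le_one
  rw [hausdorffMeasure_real, ENNReal.rpow_one] at hH
  calc _ ≤ volume (φ '' (Y ∩ Metric.ball ρ t)) := measure_mono hsub
    _ ≤ _ := hH
    _ ≤ ENNReal.ofReal K * ENNReal.ofReal b := by
        rw [ENNReal.ofReal]; gcongr
    _ = _ := (ENNReal.ofReal_mul hK0).symm

/-- If `Y` has upper density about `h` at `ρ` at the scale `r`, then the proportion of the
`T` in the ball of radius `r` with `T(ρ) ∈ Y` is at most about `h`. -/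
theorem measure_moebius_le [MeasurableSpace SL2R] [BorelSpace SL2R] (μ : Measure SL2R)
    [μ.IsHaarMeasure] {ρ r h δ : ℝ} (hr : 0 < r) (hr' : r ≤ 1 / 8) (hρ : 30 * |ρ| * r ≤ 1)
    (hh : 0 ≤ h) (hδ : 0 ≤ δ) {Y : Set ℝ}
    (hY : ∀ s, 0 < s → s ≤ 6 * (1 + ρ ^ 2) * r →
      volume (Y ∩ Metric.ball ρ s) ≤ ENNReal.ofReal (h * (2 * s) + δ * r)) :
    μ {T | T ∈ ballId r ∧ moebius T ρ ∈ Y} ≤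
      ENNReal.ofReal (h + (6 * h * r + 180 * h * |ρ| * r + 2 * δ) * 129 ^ 4) * μ (ballId r) := by
  -- The image of `μ` under conjugation is again a Haar measure, and the case of the point `0` holds
  -- for every Haar measure, so unimodularity of the group is not needed.
  let e : SL2R ≃* SL2R := MulAut.conj (rotation ρ)
  have he : Continuous e := by
    show Continuous fun T => rotation ρ * T * (rotation ρ)⁻¹
    fun_prop
  have he' : Continuous e.symm := by
    show Continuous fun T => (rotation ρ)⁻¹ * T * rotation ρ
    fun_prop
  have hmap : ∀ S, μ.map e S = μ (e ⁻¹' S) := by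
    intro S
    let E : SL2R ≃ₜ SL2R := { toEquiv := e.toEquiv, continuous_toFun := he, continuous_invFun := he' }
    exact E.toMeasurableEquiv.map_apply S
  have : (μ.map e).IsHaarMeasure := e.isHaarMeasure_map μ he he'
  have hball : e ⁻¹' ballId r = ballId r := by
    ext T
    show distId (rotation ρ * T * (rotation ρ)⁻¹) < r ↔ distId T < r
    rw [distId_conj_rotation]
  have hσ0 : 0 ≤ |ρ| := abs_nonneg ρ
  -- The distortion of the rotation is at most `1 + 10 |ρ| s`. With `s ≤ 3 r` it costs `20 h |ρ| s ^
  -- 2 ≤ 180 h |ρ| r ^ 2`; the old error is at most doubled.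
  have := measure_moebius_zero_le (μ.map e) hr hr' hh (δ := 180 * h * |ρ| * r + 2 * δ)
    (by positivity) (Y := (fun y => (ρ + y) / (1 - ρ * y)) ⁻¹' Y) ?_
  · rw [hmap, hmap, hball] at this
    rw [← add_assoc] at this
    refine (measure_mono ?_).trans this
    rintro T ⟨hT, hTY⟩
    have hT' : e T ∈ ballId r := by rwa [← Set.mem_preimage, hball]
    refine ⟨hT', ?_⟩
    have hd : (e T).1 1 1 ≠ 0 := by
      have := (abs_lt.mp (entry_of_mem_ballId hT').2.2.2).1
      intro h0; rw [h0] at this; linarith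
    have := moebius_conj_rotation ρ T hd
    show (ρ + moebius (e T) 0) / (1 - ρ * moebius (e T) 0) ∈ Y
    rw [this] at hTY
    exact hTY
  · intro s hs
    obtain hs0 | hs0 := le_or_gt s 0
    · simp [Metric.ball_eq_empty.mpr hs0]
    have hσ : |ρ| * s ≤ 1 / 10 := by nlinarith
    have h1 : 0 < 1 - |ρ| * s := by linarith
    have h2 : 0 < 1 - 2 * (|ρ| * s) := by linarith
    have hq : 0 < 1 + ρ ^ 2 := by positivity
    have hσ1 : 0 ≤ |ρ| * s := by positivity
    refine (volume_preimage_rotation_le ρ hσ hs0 Y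
      (b := h * (2 * ((1 + ρ ^ 2) * s / (1 - |ρ| * s))) + δ * r)
      (hY _ (by positivity) ?_)).trans (ENNReal.ofReal_le_ofReal ?_)
    · rw [div_le_iff₀ h1]
      have : (1 + ρ ^ 2) * s ≤ (1 + ρ ^ 2) * (3 * r) := by gcongr
      have h3 : 0 ≤ (1 + ρ ^ 2) * r := by positivity
      nlinarith
    · generalize hσe : |ρ| * s = σ at *
      have h3 : (1 - σ) ^ 2 ≤ 2 * (1 - 2 * σ) ^ 2 := by nlinarith
      have h4 : 1 - σ ≤ (1 + 10 * σ) * (1 - 2 * σ) ^ 2 := by nlinarith [mul_nonneg hσ1 hσ1]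
      have e1 : (1 - σ) ^ 2 / ((1 + ρ ^ 2) * (1 - 2 * σ) ^ 2) *
          (h * (2 * ((1 + ρ ^ 2) * s / (1 - σ))) + δ * r) =
          (1 - σ) / (1 - 2 * σ) ^ 2 * (h * (2 * s)) +
          (1 - σ) ^ 2 / ((1 + ρ ^ 2) * (1 - 2 * σ) ^ 2) * (δ * r) := by
        field_simp
      have h5 : (1 - σ) / (1 - 2 * σ) ^ 2 ≤ 1 + 10 * σ := by
        rw [div_le_iff₀ (by positivity)]; exact h4
      have h6 : (1 - σ) ^ 2 / ((1 + ρ ^ 2) * (1 - 2 * σ) ^ 2) ≤ 2 := by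
        rw [div_le_iff₀ (by positivity)]
        nlinarith [mul_nonneg (sq_nonneg ρ) (sq_nonneg (1 - 2 * σ))]
      have h7 : s * s ≤ 3 * r * (3 * r) := by gcongr
      have h8 : h * |ρ| * (s * s) ≤ h * |ρ| * (3 * r * (3 * r)) := by gcongr
      calc _ ≤ (1 + 10 * σ) * (h * (2 * s)) + 2 * (δ * r) := by
            rw [e1]; gcongr
        _ = h * (2 * s) + 20 * (h * |ρ| * (s * s)) + 2 * (δ * r) := by rw [← hσe]; ring
        _ ≤ _ := by nlinarith

/-! ### Exceptional rational approximations near `ρ`. -/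

/-- The points with a rational approximation of order `s` and constant `c₁` that is not an
approximation of `ρ` with the same order and constant `c₂`. -/
def badSet (s c₁ c₂ ρ : ℝ) : Set ℝ :=
  {x | ∃ (a : ℤ) (b : ℕ), 0 < b ∧ |(a : ℝ) / b - x| < c₁ / (b : ℝ) ^ s ∧
    c₂ / (b : ℝ) ^ s ≤ |(a : ℝ) / b - ρ|}

/-- Passing to lowest terms can only decrease the denominator. Comparing the two defining
inequalities eliminates the denominator: the fraction is closer to `x` than to `ρ` by the factor `c₁
/ c₂ < 1`, hence its distance to `ρ` is controlled by `|x - ρ|`. -/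
theorem exists_rat_of_mem_badSet {s c₁ c₂ ρ x : ℝ} (hs : 0 < s) (h1 : 0 < c₁) (h2 : c₁ < c₂)
    (hx : x ∈ badSet s c₁ c₂ ρ) : ∃ z : ℚ, |(z : ℝ) - x| < c₁ / (z.den : ℝ) ^ s ∧
      |(z : ℝ) - x| < c₁ / c₂ * |(z : ℝ) - ρ| ∧ (1 - c₁ / c₂) * |(z : ℝ) - ρ| ≤ |x - ρ| := by
  obtain ⟨a, b, hb, hax, haρ⟩ := hx
  have hb' : (0 : ℝ) < b := by exact_mod_cast hb
  have h2' : 0 < c₂ := h1.trans h2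
  have hz : (((a / b : ℚ) : ℚ) : ℝ) = (a : ℝ) / b := by push_cast; rfl
  have key : |(a : ℝ) / b - x| < c₁ / c₂ * |(a : ℝ) / b - ρ| := by
    calc _ < c₁ / (b : ℝ) ^ s := hax
      _ = c₁ / c₂ * (c₂ / (b : ℝ) ^ s) := by field_simp
      _ ≤ _ := by gcongr
  refine ⟨(a / b : ℚ), ?_, ?_, ?_⟩ <;> rw [hz]
  · refine hax.trans_le ?_
    have hd : ((a / b : ℚ).den : ℕ) ≤ b := by
      have : ((a / b : ℚ).den : ℤ) ∣ (b : ℤ) := by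
        have := Rat.den_dvd a (b : ℤ)
        simpa [Rat.divInt_eq_div] using this
      exact Nat.le_of_dvd hb (by exact_mod_cast this)
    have hd0 : (0 : ℝ) < ((a / b : ℚ).den : ℝ) := by exact_mod_cast (a / b : ℚ).den_pos
    gcongr
  · exact key
  · have := abs_sub_abs_le_abs_sub ((a : ℝ) / b - ρ) ((a : ℝ) / b - x)
    rw [sub_sub_sub_cancel_left] at this
    linarith

theorem one_le_mul_abs_sub {z w : ℚ} (h : z ≠ w) :
    1 ≤ (z.den : ℝ) * w.den * |(z : ℝ) - w| := by
  have hz : (0 : ℝ) < z.den := by exact_mod_cast z.den_pos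
  have hw : (0 : ℝ) < w.den := by exact_mod_cast w.den_pos
  have e : (z.den : ℝ) * w.den * ((z : ℝ) - w) = ((z.num * w.den - w.num * z.den : ℤ) : ℝ) := by
    push_cast
    rw [Rat.cast_def z, Rat.cast_def w]
    field_simp
  have hne : (z.num * w.den - w.num * z.den : ℤ) ≠ 0 := by
    intro h0
    rw [h0, Int.cast_zero, mul_eq_zero, or_iff_right (by positivity), sub_eq_zero] at e
    exact h (by exact_mod_cast e)
  calc (1 : ℝ) ≤ |((z.num * w.den - w.num * z.den : ℤ) : ℝ)| := by
        exact_mod_cast Int.one_le_abs hne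
    _ = _ := by rw [← e, abs_mul, abs_of_pos (by positivity)]

/-- The balls of radius `σ` are disjoint and fit into one ball of radius `R + σ`; shrinking them to
radius `ε` scales each volume by `ε / σ`. -/
theorem volume_biUnion_ball_le {Z : Set ℚ} {ρ R σ ε : ℝ} (hσ : 0 < σ) (hε : 0 ≤ ε)
    (hZ : ∀ z ∈ Z, |(z : ℝ) - ρ| < R)
    (hsep : ∀ z ∈ Z, ∀ w ∈ Z, z ≠ w → 2 * σ ≤ |(z : ℝ) - w|) :
    volume (⋃ z ∈ Z, Metric.ball (z : ℝ) ε) ≤ ENNReal.ofReal (ε / σ * (2 * (R + σ))) := by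
  have hdisj : Z.PairwiseDisjoint fun z : ℚ => Metric.ball (z : ℝ) σ := by
    intro z hz w hw hzw
    apply Metric.ball_disjoint_ball
    rw [Real.dist_eq]
    linarith [hsep z hz w hw hzw]
  have hR : (⋃ z ∈ Z, Metric.ball (z : ℝ) σ) ⊆ Metric.ball ρ (R + σ) := by
    refine Set.iUnion₂_subset fun z hz => Metric.ball_subset_ball' ?_
    rw [Real.dist_eq]
    linarith [hZ z hz]
  calc _ ≤ ∑' z : Z, volume (Metric.ball ((z : ℚ) : ℝ) ε) := measure_biUnion_le _ Z.to_countable _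
    _ = ∑' z : Z, ENNReal.ofReal (ε / σ) * volume (Metric.ball ((z : ℚ) : ℝ) σ) := by
        refine tsum_congr fun z => ?_
        rw [Real.volume_ball, Real.volume_ball, ← ENNReal.ofReal_mul (by positivity)]
        congr 1
        field_simp
    _ = ENNReal.ofReal (ε / σ) * volume (⋃ z ∈ Z, Metric.ball (z : ℝ) σ) := by
        rw [ENNReal.tsum_mul_left, measure_biUnion Z.to_countable hdisj
          fun _ _ => Metric.isOpen_ball.measurableSet]
    _ ≤ ENNReal.ofReal (ε / σ) * volume (Metric.ball ρ (R + σ)) := by gcongr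
    _ = _ := by rw [Real.volume_ball, ← ENNReal.ofReal_mul (by positivity)]

/-- Fractions with denominators in `[2 ^ l, 2 ^ (l + 1))` are `1 / (4 * 4 ^ l)` apart, so the balls
of radius `c / 2 ^ (l s)` around those near `ρ` have total length of order `(4 / 2 ^ s) ^ l / 4 ^
L`. This is summable over `l ≥ L` since `s > 2`, and the sum is `o(4 ^ (-L))`. -/
theorem volume_high_le {s c C : ℝ} (hs : 2 < s) (hc : 0 ≤ c) (hC : 0 ≤ C) (ρ : ℝ) (L : ℕ) :
    volume {x : ℝ | ∃ z : ℚ, 2 ^ L ≤ z.den ∧ |(z : ℝ) - ρ| < C / 4 ^ L ∧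
      |(z : ℝ) - x| < c / (z.den : ℝ) ^ s} ≤
    ENNReal.ofReal (16 * c * (C + 1) / (1 - 4 / 2 ^ s) * (4 / 2 ^ s) ^ L / 4 ^ L) := by
  have hp : (4 : ℝ) < 2 ^ s := by
    calc (4 : ℝ) = 2 ^ (2 : ℝ) := by norm_num
      _ < _ := Real.rpow_lt_rpow_of_exponent_lt one_lt_two hs
  have hpow : ∀ l : ℕ, ((2 : ℝ) ^ l) ^ s = (2 ^ s) ^ l := by
    intro l; rw [← Real.rpow_natCast, ← Real.rpow_mul zero_le_two, mul_comm,
      Real.rpow_mul zero_le_two, Real.rpow_natCast]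
  generalize (2 : ℝ) ^ s = p at *
  have hw0 : 0 < 4 / p := by positivity
  have hw1 : 4 / p < 1 := by rw [div_lt_one (by linarith)]; exact hp
  let Z : ℕ → Set ℚ := fun l => {z | 2 ^ l ≤ z.den ∧ z.den < 2 ^ (l + 1) ∧ |(z : ℝ) - ρ| < C / 4 ^ L}
  have hsub : {x : ℝ | ∃ z : ℚ, 2 ^ L ≤ z.den ∧ |(z : ℝ) - ρ| < C / 4 ^ L ∧
      |(z : ℝ) - x| < c / (z.den : ℝ) ^ s} ⊆
      ⋃ j : ℕ, ⋃ z ∈ Z (L + j), Metric.ball (z : ℝ) (c / p ^ (L + j)) := by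
    rintro x ⟨z, h1, h2, h3⟩
    have hd : z.den ≠ 0 := z.den_ne_zero
    have hl : L ≤ Nat.log 2 z.den := Nat.le_log_of_pow_le one_lt_two h1
    obtain ⟨j, hj⟩ := Nat.exists_eq_add_of_le hl
    simp only [Set.mem_iUnion]
    have h4 : 2 ^ (L + j) ≤ z.den := hj ▸ Nat.pow_log_le_self 2 hd
    refine ⟨j, z, ⟨h4, hj ▸ Nat.lt_pow_succ_log_self one_lt_two _, h2⟩, ?_⟩
    rw [Metric.mem_ball, dist_comm, Real.dist_eq]
    refine h3.trans_le ?_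
    rw [← hpow]
    have : ((2 : ℝ) ^ (L + j)) ≤ z.den := by exact_mod_cast h4
    gcongr
  have hblock : ∀ j : ℕ, volume (⋃ z ∈ Z (L + j), Metric.ball (z : ℝ) (c / p ^ (L + j))) ≤
      ENNReal.ofReal (16 * c * (C + 1) * (4 / p) ^ L / 4 ^ L * (4 / p) ^ j) := by
    intro j
    have h4 : (0 : ℝ) < 4 ^ (L + j) := by positivity
    refine (volume_biUnion_ball_le (σ := 1 / (8 * 4 ^ (L + j))) (R := C / 4 ^ L) (ρ := ρ)
      (by positivity) (by positivity) (fun z hz => hz.2.2) fun z hz w hw hzw => ?_).trans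
      (ENNReal.ofReal_le_ofReal ?_)
    · have h := one_le_mul_abs_sub hzw
      have h1 : (z.den : ℝ) ≤ 2 ^ (L + j + 1) := by exact_mod_cast hz.2.1.le
      have h2 : (w.den : ℝ) ≤ 2 ^ (L + j + 1) := by exact_mod_cast hw.2.1.le
      have h3 : (z.den : ℝ) * w.den ≤ 4 * 4 ^ (L + j) := by
        calc (z.den : ℝ) * w.den ≤ 2 ^ (L + j + 1) * 2 ^ (L + j + 1) := by gcongr
          _ = 4 * 4 ^ (L + j) := by
            rw [← mul_pow, pow_succ]; norm_num [mul_comm]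
      have h5 : 1 ≤ 4 * 4 ^ (L + j) * |(z : ℝ) - w| := h.trans (by gcongr)
      rw [← mul_div_assoc, mul_one, div_le_iff₀ (by positivity)]
      linarith
    · have h5 : 1 / (8 * (4 : ℝ) ^ (L + j)) ≤ 1 / 4 ^ L := by
        gcongr
        rw [pow_add]
        have : (1 : ℝ) ≤ 4 ^ j := one_le_pow₀ (by norm_num)
        have h6 : (0 : ℝ) < 4 ^ L := by positivity
        nlinarith
      calc c / p ^ (L + j) / (1 / (8 * 4 ^ (L + j))) * (2 * (C / 4 ^ L + 1 / (8 * 4 ^ (L + j))))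
          ≤ c / p ^ (L + j) / (1 / (8 * 4 ^ (L + j))) * (2 * (C / 4 ^ L + 1 / 4 ^ L)) := by gcongr
        _ = _ := by
          rw [div_pow, div_pow, pow_add, pow_add]
          field_simp
          ring
  have hgeo := (hasSum_geometric_of_lt_one hw0.le hw1).mul_left
    (16 * c * (C + 1) * (4 / p) ^ L / 4 ^ L)
  calc _ ≤ _ := measure_mono hsub
    _ ≤ _ := measure_iUnion_le _
    _ ≤ ∑' j : ℕ, ENNReal.ofReal (16 * c * (C + 1) * (4 / p) ^ L / 4 ^ L * (4 / p) ^ j) :=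
        ENNReal.tsum_le_tsum hblock
    _ = ENNReal.ofReal (16 * c * (C + 1) * (4 / p) ^ L / 4 ^ L * (1 - 4 / p)⁻¹) := by
        rw [← ENNReal.ofReal_tsum_of_nonneg (fun j => by positivity) hgeo.summable, hgeo.tsum_eq]
    _ = _ := by
        congr 1
        rw [← div_eq_mul_inv]
        ring

/-- The scales `4 ^ (-L)` at which `ρ` has an exceptionally good approximation. -/
def resonantScales (s δ A ρ : ℝ) : Set ℕ :=
  {L | ∃ z : ℚ, δ / 4 ^ L ≤ |(z : ℝ) - ρ| ∧ |(z : ℝ) - ρ| ≤ 1 / 4 ^ L ∧ (z.den : ℝ) ^ s ≤ A * 4 ^ L}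

/-- If one fraction serves both scales, its distance to `ρ` fixes the scale up to a bounded amount,
whence `m`. Two distinct fractions satisfy `4 ^ L ≤ 2 * den z * den w`. When `L' ≤ L + W`, the
bounds on the denominators turn this into `4 ^ (L s) ≤ 2 ^ s A ^ 2 4 ^ W * 16 ^ L`, which fails for
large `L` because `s > 2`. -/
theorem resonantScales_gap {s δ A : ℝ} (hs : 2 < s) (hδ : 0 < δ) (ρ : ℝ) :
    ∃ m : ℕ, ∀ W : ℕ, ∀ᶠ L in atTop, ∀ L' : ℕ, L ∈ resonantScales s δ A ρ →
      L' ∈ resonantScales s δ A ρ → L ≤ L' → L' < L + m ∨ L + W < L' := by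
  have hp : (4 : ℝ) < 2 ^ s := by
    calc (4 : ℝ) = 2 ^ (2 : ℝ) := by norm_num
      _ < _ := Real.rpow_lt_rpow_of_exponent_lt one_lt_two hs
  obtain ⟨m, hm⟩ := pow_unbounded_of_one_lt (1 / δ) (by norm_num : (1 : ℝ) < 4)
  refine ⟨m, fun W => ?_⟩
  have h16 : (1 : ℝ) < (2 ^ s) ^ 2 / 16 := by
    rw [lt_div_iff₀ (by norm_num)]; nlinarith
  have hev := (tendsto_pow_atTop_atTop_of_one_lt h16).eventually_gt_atTop
    (2 ^ s * A ^ 2 * 4 ^ W)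
  filter_upwards [hev] with L hL L' ⟨z, hz1, hz2, hz3⟩ ⟨w, hw1, hw2, hw3⟩ hLL'
  obtain ⟨j, rfl⟩ := Nat.exists_eq_add_of_le hLL'
  have h4L : (0 : ℝ) < 4 ^ L := by positivity
  have h4j : (0 : ℝ) < 4 ^ j := by positivity
  by_cases hzw : z = w
  · left
    subst hzw
    have h := hz1.trans hw2
    rw [pow_add, div_le_div_iff₀ h4L (by positivity), one_mul] at h
    have h1 : δ * 4 ^ j ≤ 1 := by nlinarith
    have h2 : (4 : ℝ) ^ j < 4 ^ m := by
      refine lt_of_le_of_lt ?_ hm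
      rw [le_div_iff₀ hδ]; linarith
    have := (pow_lt_pow_iff_right₀ (by norm_num : (1 : ℝ) < 4)).mp h2
    omega
  · right
    by_contra! hj
    have hjW : j ≤ W := by omega
    have hzd : (0 : ℝ) < z.den := by exact_mod_cast z.den_pos
    have hwd : (0 : ℝ) < w.den := by exact_mod_cast w.den_pos
    have h1 := one_le_mul_abs_sub hzw
    have h2 : |(z : ℝ) - w| ≤ 2 / 4 ^ L := by
      have e : (z : ℝ) - w = (z - ρ) - (w - ρ) := by ring
      have h3 : 1 / (4 : ℝ) ^ (L + j) ≤ 1 / 4 ^ L := by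
        gcongr
        · norm_num
      calc |(z : ℝ) - w| ≤ |(z : ℝ) - ρ| + |(w : ℝ) - ρ| := by rw [e]; exact abs_sub _ _
        _ ≤ 1 / 4 ^ L + 1 / 4 ^ L := add_le_add hz2 (hw2.trans h3)
        _ = _ := by ring
    have h3 : (4 : ℝ) ^ L ≤ 2 * ((z.den : ℝ) * w.den) := by
      have : 1 ≤ (z.den : ℝ) * w.den * (2 / 4 ^ L) := h1.trans (by gcongr)
      rw [mul_div_assoc', le_div_iff₀ h4L] at this
      linarith
    have h4 : ((4 : ℝ) ^ L) ^ s ≤ (2 * ((z.den : ℝ) * w.den)) ^ s := by gcongr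
    rw [Real.mul_rpow zero_le_two (by positivity), Real.mul_rpow hzd.le hwd.le] at h4
    have h5 : ((4 : ℝ) ^ L) ^ s = ((2 ^ s) ^ 2) ^ L := by
      have : (4 : ℝ) ^ L = 2 ^ (2 * L) := by rw [pow_mul]; norm_num
      rw [this, ← pow_mul, ← Real.rpow_natCast, ← Real.rpow_natCast, ← Real.rpow_mul zero_le_two,
        ← Real.rpow_mul zero_le_two, mul_comm]
    rw [h5] at h4
    have hA : 0 < A := by
      have : 0 < A * 4 ^ L := lt_of_lt_of_le (by positivity) hz3
      exact pos_of_mul_pos_left this h4L.le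
    have h6 : (z.den : ℝ) ^ s * (w.den : ℝ) ^ s ≤ (A * 4 ^ L) * (A * 4 ^ (L + j)) := by gcongr
    have h7 : (4 : ℝ) ^ j ≤ 4 ^ W := pow_le_pow_right₀ (by norm_num) hjW
    have h8 : ((2 : ℝ) ^ s) ^ 2 / 16 * 16 = (2 ^ s) ^ 2 := by ring
    have h9 : (((2 : ℝ) ^ s) ^ 2 / 16) ^ L * (4 ^ L * 4 ^ L) = ((2 ^ s) ^ 2) ^ L := by
      rw [← mul_pow, ← mul_pow]; congr 1; ring
    have h10 : (((2 : ℝ) ^ s) ^ 2 / 16) ^ L * (4 ^ L * 4 ^ L) ≤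
        (2 ^ s * A ^ 2 * 4 ^ W) * (4 ^ L * 4 ^ L) := by
      rw [h9]
      calc _ ≤ _ := h4
        _ ≤ 2 ^ s * ((A * 4 ^ L) * (A * 4 ^ (L + j))) := by gcongr
        _ = (2 ^ s * A ^ 2 * 4 ^ j) * (4 ^ L * 4 ^ L) := by rw [pow_add]; ring
        _ ≤ _ := by gcongr
    exact absurd (le_of_mul_le_mul_right h10 (by positivity)) (not_le.mpr hL)

/-- A set of natural numbers is sparse if all long enough windows far out contain a bounded number
of its elements. -/
def IsSparse (S : Set ℕ) : Prop :=
  ∃ m : ℕ, ∀ W : ℕ, ∀ᶠ L in atTop, (S ∩ Set.Ico L (L + W)).ncard ≤ m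

/-- Far out, a window of length `W` contains a single cluster, of length at most `m`, starting at
its first resonant scale. -/
theorem isSparse_resonantScales {s δ A : ℝ} (hs : 2 < s) (hδ : 0 < δ) (ρ : ℝ) :
    IsSparse (resonantScales s δ A ρ) := by
  obtain ⟨m, hm⟩ := resonantScales_gap (A := A) hs hδ ρ
  refine ⟨m, fun W => ?_⟩
  filter_upwards [eventually_forall_ge_atTop.mpr (hm W)] with L hL
  set S := resonantScales s δ A ρ ∩ Set.Ico L (L + W)
  obtain hem | hne := S.eq_empty_or_nonempty
  · simp [hem]
  obtain ⟨hK1, hK2⟩ := Nat.sInf_mem hne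
  set K := sInf S
  have hsub : S ⊆ Set.Ico K (K + m) := by
    intro L' hL'
    have hKL : K ≤ L' := Nat.sInf_le hL'
    obtain h | h := hL K hK2.1 L' hK1 hL'.1 hKL
    · exact ⟨hKL, h⟩
    · have h1 := hL'.2.2
      have h2 := hK2.1
      omega
  calc S.ncard ≤ (Set.Ico K (K + m)).ncard := Set.ncard_le_ncard hsub (Set.finite_Ico _ _)
    _ = m := by rw [Set.ncard_eq_toFinset_card']; simp

theorem IsSparse.iUnion {ι : Type*} [Finite ι] {S : ι → Set ℕ} (h : ∀ i, IsSparse (S i)) :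
    IsSparse (⋃ i, S i) := by
  have := Fintype.ofFinite ι
  choose m hm using h
  refine ⟨∑ i, m i, fun W => ?_⟩
  filter_upwards [eventually_all.mpr fun i => hm i W] with L hL
  rw [Set.iUnion_inter]
  refine le_trans ?_ (Finset.sum_le_sum fun i _ => hL i)
  have := Set.ncard_iUnion_le_of_fintype fun i => S i ∩ Set.Ico L (L + W)
  exact this

/-- The bound `m` is chosen before the window length, so a window of length `m + 1` cannot be full.
-/
theorem IsSparse.frequently_notMem {S : Set ℕ} (h : IsSparse S) : ∃ᶠ L in atTop, L ∉ S := by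
  obtain ⟨m, hm⟩ := h
  intro hcon
  obtain ⟨L, h1, h2⟩ := ((hm (m + 1)).and (eventually_forall_ge_atTop.mpr hcon)).exists
  have : S ∩ Set.Ico L (L + (m + 1)) = Set.Ico L (L + (m + 1)) := by
    refine Set.inter_eq_right.mpr fun K hK => ?_
    simpa using h2 K hK.1
  rw [this, Set.ncard_eq_toFinset_card'] at h1
  simp at h1

/-- The fractions responsible for bad points are split at denominator `2 ^ L`. The large ones are
covered by `volume_high_le`. At most one small one is close enough to `ρ`. It does little harm if it
is very near `ρ`, as bad points are then within `c₁ / c₂` times that distance of it, or if its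
denominator is large; otherwise `L` is resonant. -/
theorem volume_badSet_le {s c₁ c₂ θ δ : ℝ} (hs : 2 < s) (h1 : 0 < c₁) (h2 : c₁ < c₂) (hθ : 0 < θ)
    (hθ' : θ ≤ (1 - c₁ / c₂) / 2) (hδ : 0 < δ) (ρ : ℝ) : ∃ δ' A, 0 < δ' ∧
      ∀ᶠ L : ℕ in atTop, L ∉ resonantScales s δ' A ρ →
        volume (badSet s c₁ c₂ ρ ∩ Metric.ball ρ (θ / 4 ^ L)) ≤ ENNReal.ofReal (δ * (θ / 4 ^ L)) := by
  have hp : (4 : ℝ) < 2 ^ s := by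
    calc (4 : ℝ) = 2 ^ (2 : ℝ) := by norm_num
      _ < _ := Real.rpow_lt_rpow_of_exponent_lt one_lt_two hs
  have hw : (4 : ℝ) / 2 ^ s < 1 := by rw [div_lt_one (by linarith)]; exact hp
  have hc2 : 0 < c₂ := h1.trans h2
  have hκ : 0 < 1 - c₁ / c₂ := by linarith
  have hκ1 : c₁ / c₂ ≤ 1 := by linarith
  -- Chosen so that in both harmless cases the bad points lie in a ball of radius at most `δ θ / 8 /
  -- 4 ^ L` around the fraction.
  refine ⟨δ * θ / 8, 8 * c₁ / (δ * θ), by positivity, ?_⟩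
  have hlim : Tendsto (fun L : ℕ => 16 * c₁ * (1 + 1) / (1 - 4 / 2 ^ s) * ((4 : ℝ) / 2 ^ s) ^ L)
      atTop (𝓝 (16 * c₁ * (1 + 1) / (1 - 4 / 2 ^ s) * 0)) :=
    (tendsto_pow_atTop_nhds_zero_of_lt_one (by positivity) hw).const_mul _
  rw [mul_zero] at hlim
  filter_upwards [hlim.eventually_lt_const (show 0 < δ * θ / 2 by positivity)] with L hL hres
  have h4 : (0 : ℝ) < 4 ^ L := by positivity
  set low : Set ℝ := {x | ∃ z : ℚ, z.den < 2 ^ L ∧ |(z : ℝ) - ρ| < 1 / (2 * 4 ^ L) ∧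
    |(z : ℝ) - x| < c₁ / (z.den : ℝ) ^ s ∧ |(z : ℝ) - x| < c₁ / c₂ * |(z : ℝ) - ρ|}
  have hsub : badSet s c₁ c₂ ρ ∩ Metric.ball ρ (θ / 4 ^ L) ⊆
      {x : ℝ | ∃ z : ℚ, 2 ^ L ≤ z.den ∧ |(z : ℝ) - ρ| < 1 / 4 ^ L ∧
        |(z : ℝ) - x| < c₁ / (z.den : ℝ) ^ s} ∪ low := by
    rintro x ⟨hx, hxb⟩
    obtain ⟨z, hz1, hz2, hz3⟩ := exists_rat_of_mem_badSet (by linarith) h1 h2 hx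
    rw [Metric.mem_ball, Real.dist_eq] at hxb
    -- The upper bound on `θ` serves here: two fractions this close to `ρ` are less than `4 ^ (-L)`
    -- apart, which forces them to coincide if both denominators are below `2 ^ L`.
    have hzρ : |(z : ℝ) - ρ| < 1 / (2 * 4 ^ L) := by
      have : (1 - c₁ / c₂) * |(z : ℝ) - ρ| < (1 - c₁ / c₂) * (1 / (2 * 4 ^ L)) := by
        calc _ ≤ |x - ρ| := hz3
          _ < θ / 4 ^ L := hxb
          _ ≤ (1 - c₁ / c₂) / 2 / 4 ^ L := by gcongr
          _ = _ := by field_simp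
      exact lt_of_mul_lt_mul_left this hκ.le
    obtain h | h := le_or_gt (2 ^ L) z.den
    · left
      refine ⟨z, h, hzρ.trans_le ?_, hz1⟩
      gcongr
      linarith
    · exact Or.inr ⟨z, h, hzρ, hz1, hz2⟩
  have hhigh : volume {x : ℝ | ∃ z : ℚ, 2 ^ L ≤ z.den ∧ |(z : ℝ) - ρ| < 1 / 4 ^ L ∧
        |(z : ℝ) - x| < c₁ / (z.den : ℝ) ^ s} ≤ ENNReal.ofReal (δ * θ / 2 / 4 ^ L) := by
    refine (volume_high_le hs h1.le zero_le_one ρ L).trans (ENNReal.ofReal_le_ofReal ?_)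
    gcongr
  have hlow : volume low ≤ ENNReal.ofReal (δ * θ / 2 / 4 ^ L) := by
    obtain hem | ⟨x₀, z, hz1, hz2, hz3, hz4⟩ := low.eq_empty_or_nonempty
    · simp [hem]
    have huniq : ∀ w : ℚ, w.den < 2 ^ L → |(w : ℝ) - ρ| < 1 / (2 * 4 ^ L) → w = z := by
      intro w hw1 hw2
      by_contra hne
      have h := one_le_mul_abs_sub hne
      have e : (w : ℝ) - z = (w - ρ) - (z - ρ) := by ring
      have h3 : |(w : ℝ) - z| < 1 / 4 ^ L := by
        calc |(w : ℝ) - z| ≤ |(w : ℝ) - ρ| + |(z : ℝ) - ρ| := by rw [e]; exact abs_sub _ _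
          _ < 1 / (2 * 4 ^ L) + 1 / (2 * 4 ^ L) := add_lt_add hw2 hz2
          _ = _ := by field_simp; norm_num
      have h5 : (w.den : ℝ) ≤ 2 ^ L := by exact_mod_cast hw1.le
      have h6 : (z.den : ℝ) ≤ 2 ^ L := by exact_mod_cast hz1.le
      have h7 : (w.den : ℝ) * z.den ≤ 4 ^ L := by
        calc (w.den : ℝ) * z.den ≤ 2 ^ L * 2 ^ L := by gcongr
          _ = 4 ^ L := by rw [← mul_pow]; norm_num
      have h8 : (w.den : ℝ) * z.den * |(w : ℝ) - z| < 1 := by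
        calc _ ≤ 4 ^ L * |(w : ℝ) - z| := by gcongr
          _ < 4 ^ L * (1 / 4 ^ L) := by gcongr
          _ = 1 := by field_simp
      linarith
    have hball : ∃ ε, ε ≤ δ * θ / 4 / 4 ^ L ∧ low ⊆ Metric.ball (z : ℝ) ε := by
      by_cases hd : |(z : ℝ) - ρ| < δ * θ / 8 / 4 ^ L
      · refine ⟨c₁ / c₂ * |(z : ℝ) - ρ|, ?_, ?_⟩
        · have h9 : (0 : ℝ) ≤ δ * θ / 8 / 4 ^ L := by positivity
          have e9 : δ * θ / 4 / 4 ^ L = 2 * (δ * θ / 8 / 4 ^ L) := by ring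
          nlinarith [abs_nonneg ((z : ℝ) - ρ)]
        · rintro x ⟨w, hw1, hw2, -, hw4⟩
          rw [huniq w hw1 hw2] at hw4
          rwa [Metric.mem_ball, dist_comm, Real.dist_eq]
      · refine ⟨c₁ / (z.den : ℝ) ^ s, ?_, ?_⟩
        · have hA : 8 * c₁ / (δ * θ) * 4 ^ L < (z.den : ℝ) ^ s := by
            by_contra! hA
            refine hres ⟨z, not_lt.mp hd, hz2.le.trans ?_, hA⟩
            gcongr
            linarith
          calc c₁ / (z.den : ℝ) ^ s ≤ c₁ / (8 * c₁ / (δ * θ) * 4 ^ L) := by gcongr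
            _ = δ * θ / 8 / 4 ^ L := by field_simp
            _ ≤ _ := by gcongr; norm_num
        · rintro x ⟨w, hw1, hw2, hw3, -⟩
          rw [huniq w hw1 hw2] at hw3
          rwa [Metric.mem_ball, dist_comm, Real.dist_eq]
    obtain ⟨ε, hε, hlowε⟩ := hball
    refine (measure_mono hlowε).trans ?_
    rw [Real.volume_ball]
    apply ENNReal.ofReal_le_ofReal
    have : δ * θ / 2 / 4 ^ L = 2 * (δ * θ / 4 / 4 ^ L) := by ring
    linarith
  calc _ ≤ _ := measure_mono hsub
    _ ≤ _ := measure_union_le _ _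
    _ ≤ _ := add_le_add hhigh hlow
    _ = _ := by
      rw [← ENNReal.ofReal_add (by positivity) (by positivity)]
      congr 1
      ring

/-- At infinitely many scales, all of finitely many sets of points with exceptional approximations
have small density. -/
theorem frequently_volume_badSet_le {ι : Type*} [Finite ι] {s c₁ c₂ ρ : ι → ℝ} {θ δ : ℝ}
    (hs : ∀ i, 2 < s i) (h1 : ∀ i, 0 < c₁ i) (h2 : ∀ i, c₁ i < c₂ i) (hθ : 0 < θ)
    (hθ' : ∀ i, θ ≤ (1 - c₁ i / c₂ i) / 2) (hδ : 0 < δ) : ∃ᶠ L : ℕ in atTop, ∀ i,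
      volume (badSet (s i) (c₁ i) (c₂ i) (ρ i) ∩ Metric.ball (ρ i) (θ / 4 ^ L)) ≤
        ENNReal.ofReal (δ * (θ / 4 ^ L)) := by
  choose δ' A hδ' hev using fun i => volume_badSet_le (hs i) (h1 i) (h2 i) hθ (hθ' i) hδ (ρ i)
  have hsp := (IsSparse.iUnion fun i => isSparse_resonantScales (A := A i) (hs i) (hδ' i) (ρ i))
  refine (hsp.frequently_notMem.and_eventually (eventually_all.mpr hev)).mono fun L hL i => ?_
  refine hL.2 i fun h => hL.1 (Set.mem_iUnion.mpr ⟨i, h⟩)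

/-! ### From densities on the line to proportions of transformations. -/

theorem eventually_volume_compl_le {S : Set ℝ} (hS : NullMeasurableSet S volume) {ρ h δ : ℝ}
    (hh : 0 ≤ h) (hδ : 0 < δ) (hd : 1 - ENNReal.ofReal h ≤ lowerDensity S ρ) :
    ∀ᶠ s in 𝓝[>] (0 : ℝ), volume (Metric.ball ρ s ∩ Sᶜ) ≤ ENNReal.ofReal ((h + δ) * (2 * s)) := by
  obtain h1 | h1 := le_or_gt 1 (h + δ)
  · filter_upwards [self_mem_nhdsWithin] with s hs
    rw [Set.mem_Ioi] at hs
    refine (measure_mono Set.inter_subset_left).trans ?_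
    rw [Real.volume_ball]
    exact ENNReal.ofReal_le_ofReal (by nlinarith)
  · have hlt : 1 - ENNReal.ofReal (h + δ) < lowerDensity S ρ := by
      refine lt_of_lt_of_le ?_ hd
      rw [← ENNReal.ofReal_one, ← ENNReal.ofReal_sub _ (by linarith), ← ENNReal.ofReal_sub _ hh]
      exact (ENNReal.ofReal_lt_ofReal_iff (by linarith)).mpr (by linarith)
    filter_upwards [eventually_lt_of_lt_liminf hlt, self_mem_nhdsWithin] with s hs hs0
    rw [Set.mem_Ioi] at hs0
    have hV0 : volume (Metric.ball ρ s) ≠ 0 := by simpa [Real.volume_ball] using hs0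
    have hVt : volume (Metric.ball ρ s) ≠ ∞ := by
      rw [Real.volume_ball]; exact ENNReal.ofReal_ne_top
    have e := measure_inter_add_sdiff₀ (μ := volume) (Metric.ball ρ s) hS
    rw [Set.sdiff_eq] at e
    rw [ENNReal.lt_div_iff_mul_lt (Or.inl hV0) (Or.inl hVt)] at hs
    have hA : volume (Metric.ball ρ s ∩ S) ≠ ∞ :=
      ne_top_of_le_ne_top hVt (measure_mono Set.inter_subset_left)
    have e2 : volume (Metric.ball ρ s ∩ Sᶜ) =
        volume (Metric.ball ρ s) - volume (Metric.ball ρ s ∩ S) :=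
      ENNReal.eq_sub_of_add_eq hA (by rw [add_comm]; exact e)
    calc volume (Metric.ball ρ s ∩ Sᶜ)
        ≤ volume (Metric.ball ρ s) - (1 - ENNReal.ofReal (h + δ)) * volume (Metric.ball ρ s) := by
          rw [e2]; exact tsub_le_tsub_left hs.le _
      _ = volume (Metric.ball ρ s) - (volume (Metric.ball ρ s) -
            ENNReal.ofReal (h + δ) * volume (Metric.ball ρ s)) := by
          rw [ENNReal.sub_mul fun _ _ => hVt, one_mul]
      _ ≤ ENNReal.ofReal (h + δ) * volume (Metric.ball ρ s) := tsub_tsub_le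
      _ = _ := by rw [Real.volume_ball, ← ENNReal.ofReal_mul (by positivity)]

/-- For infinitely many small radii `r`, the proportion of the `T` in the ball of radius `r` that
move one of the points `ρ i` out of `S i`, or to a point with exceptional approximations, is at most
about the sum of the upper densities of the complements of the `S i`. -/
theorem frequently_measure_exists_le [MeasurableSpace SL2R] [BorelSpace SL2R] (μ : Measure SL2R)
    [μ.IsHaarMeasure] {ι : Type*} [Fintype ι] {ρ : ι → ℝ} {S : ι → Set ℝ} {s c₁ c₂ : ι → Bool → ℝ}
    (hs : ∀ i b, 2 < s i b) (h1 : ∀ i b, 0 < c₁ i b) (h2 : ∀ i b, c₁ i b < c₂ i b) {h : ℝ}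
    (hh : 0 ≤ h) (hS : ∀ i, ∀ δ : ℝ, 0 < δ → ∀ᶠ t in 𝓝[>] (0 : ℝ),
      volume (Metric.ball (ρ i) t ∩ (S i)ᶜ) ≤ ENNReal.ofReal ((h + δ) * (2 * t)))
    {ε : ℝ} (hε : 0 < ε) : ∃ᶠ r in 𝓝[>] (0 : ℝ),
      μ {T | T ∈ ballId r ∧ ∃ i, moebius T (ρ i) ∈
          (S i)ᶜ ∪ ⋃ b, badSet (s i b) (c₁ i b) (c₂ i b) (ρ i)} ≤
        ENNReal.ofReal (Fintype.card ι * h + ε) * μ (ballId r) := by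
  obtain ⟨ε', hε', hε'ε⟩ : ∃ ε' : ℝ, 0 < ε' ∧ Fintype.card ι * ε' ≤ ε := by
    refine ⟨ε / (Fintype.card ι + 1), by positivity, ?_⟩
    rw [mul_div_assoc', div_le_iff₀ (by positivity)]
    nlinarith
  -- `K r` dominates all radii required by `measure_moebius_le`; the radii used are `r = θ / 4 ^ L /
  -- K`.
  obtain ⟨K, hK, hK0⟩ : ∃ K : ℝ, (∀ i, 6 * (1 + ρ i ^ 2) ≤ K) ∧ 0 < K := by
    refine ⟨∑ i, 6 * (1 + ρ i ^ 2) + 1, fun i => ?_, by positivity⟩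
    have := Finset.single_le_sum (f := fun i => 6 * (1 + ρ i ^ 2)) (fun i _ => by positivity)
      (Finset.mem_univ i)
    linarith
  obtain ⟨θ, hθ0, hθ⟩ : ∃ θ : ℝ, 0 < θ ∧ ∀ p : ι × Bool, θ ≤ (1 - c₁ p.1 p.2 / c₂ p.1 p.2) / 2 := by
    have : ∀ᶠ θ in 𝓝[>] (0 : ℝ), ∀ p : ι × Bool, θ ≤ (1 - c₁ p.1 p.2 / c₂ p.1 p.2) / 2 := by
      refine eventually_all.mpr fun p => nhdsWithin_le_nhds ?_
      have hlt : c₁ p.1 p.2 / c₂ p.1 p.2 < 1 := by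
        rw [div_lt_one ((h1 _ _).trans (h2 _ _))]; exact h2 _ _
      exact eventually_le_nhds (by linarith)
    obtain ⟨θ, h, h0⟩ := (this.and self_mem_nhdsWithin).exists
    exact ⟨θ, h0, h⟩
  set C : ℝ := 129 ^ 4 with hC
  have hC0 : 0 < C := by positivity
  set δ₀ := ε' / 4 with hδ₀
  set δ₁ := ε' / (8 * C) with hδ₁
  have hδ₀0 : 0 < δ₀ := by positivity
  have hδ₁0 : 0 < δ₁ := by positivity
  -- The bad sets are controlled at the single radius `K r` only. This suffices for all smaller
  -- radii by monotonicity, because `measure_moebius_le` tolerates an error proportional to `r`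
  -- rather than to the smaller radius.
  have hbad := frequently_volume_badSet_le (ι := ι × Bool) (s := fun p => s p.1 p.2)
    (c₁ := fun p => c₁ p.1 p.2) (c₂ := fun p => c₂ p.1 p.2) (ρ := fun p => ρ p.1)
    (fun p => hs _ _) (fun p => h1 _ _) (fun p => h2 _ _) hθ0 hθ (δ := δ₁ / (2 * K)) (by positivity)
  have htend : Tendsto (fun L : ℕ => θ / 4 ^ L / K) atTop (𝓝[>] 0) := by
    refine tendsto_nhdsWithin_iff.mpr ⟨?_, Eventually.of_forall fun L => ?_⟩
    · have : Tendsto (fun L : ℕ => θ / K * (1 / 4 : ℝ) ^ L) atTop (𝓝 (θ / K * 0)) :=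
        (tendsto_pow_atTop_nhds_zero_of_lt_one (by norm_num) (by norm_num)).const_mul _
      rw [mul_zero] at this
      refine this.congr fun L => ?_
      rw [one_div, inv_pow]
      field_simp
    · rw [Set.mem_Ioi]; positivity
  have hsmall : ∀ᶠ r in 𝓝[>] (0 : ℝ), r ≤ 1 / 8 ∧ ∀ i, 30 * |ρ i| * r ≤ 1 ∧
      (6 * (h + δ₀) + 180 * (h + δ₀) * |ρ i|) * C * r ≤ ε' / 4 := by
    have hc : ∀ a b : ℝ, 0 < b → ∀ᶠ r in 𝓝[>] (0 : ℝ), a * r ≤ b := by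
      intro a b hb
      have : Tendsto (fun r : ℝ => a * r) (𝓝[>] 0) (𝓝 (a * 0)) :=
        (tendsto_id.mono_left nhdsWithin_le_nhds).const_mul a
      rw [mul_zero] at this
      exact this.eventually_le_const hb
    refine Eventually.and ?_ (eventually_all.mpr fun i => (hc _ _ one_pos).and (hc _ _ (by positivity)))
    simpa using hc 1 (1 / 8) (by norm_num)
  have hdens : ∀ᶠ r in 𝓝[>] (0 : ℝ), ∀ i, ∀ t, 0 < t → t ≤ 6 * (1 + ρ i ^ 2) * r →
      volume (Metric.ball (ρ i) t ∩ (S i)ᶜ) ≤ ENNReal.ofReal ((h + δ₀) * (2 * t)) := by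
    refine eventually_all.mpr fun i => ?_
    obtain ⟨u, hu, hu'⟩ := mem_nhdsGT_iff_exists_Ioo_subset.mp (hS i δ₀ hδ₀0)
    have hq : 0 < 6 * (1 + ρ i ^ 2) := by positivity
    rw [Set.mem_Ioi] at hu
    have : Set.Ioo 0 (u / (6 * (1 + ρ i ^ 2))) ∈ 𝓝[>] (0 : ℝ) :=
      Ioo_mem_nhdsGT (by positivity)
    filter_upwards [this] with r hr t ht0 ht
    refine hu' ⟨ht0, ht.trans_lt ?_⟩
    rw [← lt_div_iff₀' hq]
    exact hr.2
  refine htend.frequently ?_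
  refine (hbad.and_eventually ((htend.eventually hsmall).and ((htend.eventually hdens).and
    (htend.eventually self_mem_nhdsWithin)))).mono ?_
  rintro L ⟨hL1, ⟨hL2, hL3⟩, hL4, hL5⟩
  have hKr : θ / 4 ^ L = K * (θ / 4 ^ L / K) := by field_simp
  rw [hKr] at hL1
  generalize θ / 4 ^ L / K = r at *
  have hset : {T | T ∈ ballId r ∧ ∃ i, moebius T (ρ i) ∈
          (S i)ᶜ ∪ ⋃ b, badSet (s i b) (c₁ i b) (c₂ i b) (ρ i)} =
      ⋃ i, {T | T ∈ ballId r ∧ moebius T (ρ i) ∈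
          (S i)ᶜ ∪ ⋃ b, badSet (s i b) (c₁ i b) (c₂ i b) (ρ i)} := by
    ext T; simp only [Set.mem_ofPred_eq, Set.mem_iUnion, exists_and_left]
  have hone : ∀ i, μ {T | T ∈ ballId r ∧ moebius T (ρ i) ∈
      (S i)ᶜ ∪ ⋃ b, badSet (s i b) (c₁ i b) (c₂ i b) (ρ i)} ≤
      ENNReal.ofReal (h + ε') * μ (ballId r) := by
    intro i
    refine (measure_moebius_le μ (h := h + δ₀) (δ := δ₁) hL5 hL2 (hL3 i).1 (by positivity)
      hδ₁0.le fun t ht0 ht => ?_).trans ?_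
    · rw [Set.union_inter_distrib_right, Set.iUnion_inter]
      have hb : ∀ b, volume (badSet (s i b) (c₁ i b) (c₂ i b) (ρ i) ∩ Metric.ball (ρ i) t) ≤
          ENNReal.ofReal (δ₁ * r / 2) := by
        intro b
        have htK : t ≤ K * r := ht.trans (by gcongr; exact hK i)
        refine (measure_mono (Set.inter_subset_inter_right _ (Metric.ball_subset_ball htK))).trans
          ((hL1 (i, b)).trans_eq ?_)
        congr 1
        field_simp
      calc _ ≤ _ := measure_union_le _ _
        _ ≤ ENNReal.ofReal ((h + δ₀) * (2 * t)) +
            (ENNReal.ofReal (δ₁ * r / 2) + ENNReal.ofReal (δ₁ * r / 2)) := by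
          refine add_le_add ?_ ((measure_iUnion_le _).trans ?_)
          · rw [Set.inter_comm]; exact hL4 i t ht0 ht
          · rw [tsum_fintype, Fintype.sum_bool]
            exact add_le_add (hb _) (hb _)
        _ = _ := by
          rw [← ENNReal.ofReal_add (by positivity) (by positivity),
            ← ENNReal.ofReal_add (by positivity) (by positivity)]
          congr 1
          ring
    · gcongr ENNReal.ofReal ?_ * _
      have e : δ₁ * C = ε' / 8 := by rw [hδ₁]; field_simp
      have := (hL3 i).2
      calc h + δ₀ + (6 * (h + δ₀) * r + 180 * (h + δ₀) * |ρ i| * r + 2 * δ₁) * C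
          = h + ε' / 4 + (6 * (h + δ₀) + 180 * (h + δ₀) * |ρ i|) * C * r + 2 * (δ₁ * C) := by
            rw [← hδ₀]; ring
        _ ≤ _ := by rw [e]; linarith
  rw [hset]
  calc _ ≤ _ := measure_iUnion_le _
    _ = ∑ i, _ := tsum_fintype _
    _ ≤ ∑ _i : ι, ENNReal.ofReal (h + ε') * μ (ballId r) := Finset.sum_le_sum fun i _ => hone i
    _ = ENNReal.ofReal (Fintype.card ι * (h + ε')) * μ (ballId r) := by
      rw [Finset.sum_const, Finset.card_univ, nsmul_eq_mul, ← mul_assoc,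
        ENNReal.ofReal_mul (by positivity), ENNReal.ofReal_natCast]
    _ ≤ _ := by
      gcongr
      linarith

/-! ### The size of a form near and away from its root lines; tame roots. -/

theorem derivative_dehom (F : MvPolynomial (Fin 2) ℝ) :
    (dehom F).derivative = dehom (pderiv 0 F) := by
  induction F using MvPolynomial.induction_on with
  | C a => simp [dehom]
  | add p q hp hq => simp only [dehom, map_add] at hp hq ⊢; rw [hp, hq]
  | mul_X p k hp =>
    simp only [dehom, map_mul, Derivation.leibniz, smul_eq_mul, map_add,
      Polynomial.derivative_mul, aeval_X] at hp ⊢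
    rw [hp]
    fin_cases k
    · simp [pderiv_X]; ring
    · simp [pderiv_X]

section Form

variable {n : ℕ} {F : MvPolynomial (Fin 2) ℝ}

theorem mem_realRoots_iff {z : ℝ} : z ∈ realRoots F ↔ (dehom F).eval z = 0 := by
  rw [eval_dehom]; rfl

theorem eval_eq_pow_mul (hF : F.IsHomogeneous n) {v : Fin 2 → ℝ} (h1 : v 1 ≠ 0) :
    eval v F = v 1 ^ n * (dehom F).eval (v 0 / v 1) := by
  have hv' : v = v 1 • ![v 0 / v 1, 1] := by
    ext i; fin_cases i <;> simp [mul_div_cancel₀ _ h1]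
  conv_lhs => rw [hv']
  rw [eval_smul_of_isHomogeneous hF, eval_dehom]

theorem ne_zero_of_eval_eq_zero (hF : F.IsHomogeneous n) (hinf : eval ![1, 0] F ≠ 0)
    {v : Fin 2 → ℝ} (hv : v ≠ 0) (h : eval v F = 0) : v 1 ≠ 0 := by
  intro h1
  have h0 : v 0 ≠ 0 := by
    intro h0; apply hv; ext i; fin_cases i <;> simp [h0, h1]
  have hv' : v = v 0 • ![1, 0] := by ext i; fin_cases i <;> simp [h1]
  rw [hv', eval_smul_of_isHomogeneous hF] at h
  exact mul_ne_zero (pow_ne_zero _ h0) hinf h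

theorem div_mem_realRoots (hF : F.IsHomogeneous n) {v : Fin 2 → ℝ} (h1 : v 1 ≠ 0)
    (h : eval v F = 0) : v 0 / v 1 ∈ realRoots F := by
  rw [eval_eq_pow_mul hF h1, mul_eq_zero, or_iff_right (pow_ne_zero _ h1)] at h
  exact mem_realRoots_iff.mpr h

theorem finite_realRoots (hF : F.IsHomogeneous n) (hinf : eval ![1, 0] F ≠ 0) :
    (realRoots F).Finite := by
  have hne : dehom F ≠ 0 := by
    intro h
    rw [← coeff_dehom hF, h] at hinf
    simp at hinf
  refine (Polynomial.finite_setOfPred_isRoot hne).subset fun z hz => ?_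
  exact mem_realRoots_iff.mp hz

/-- At `(ρ, 1)` Euler's identity reads `ρ F_x + F_y = 0`, so `F_x = 0` would make the whole gradient
vanish. -/
theorem SimpleZeros.derivative_ne_zero (hF : F.IsHomogeneous n) (hs : SimpleZeros F) {ρ : ℝ}
    (hρ : ρ ∈ realRoots F) : (dehom F).derivative.eval ρ ≠ 0 := by
  rw [derivative_dehom, eval_dehom]
  intro h0
  have hρ' : eval ![ρ, 1] F = 0 := hρ
  have hE := congrArg (eval ![ρ, 1]) hF.sum_X_mul_pderiv
  simp only [Fin.sum_univ_two, map_add, map_mul, eval_X, map_nsmul, hρ', h0] at hE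
  obtain ⟨i, hi⟩ := hs ![ρ, 1] (fun h => by simpa using congrFun h 1) hρ'
  fin_cases i
  · exact hi h0
  · apply hi; simpa using hE

/-- Outside of cones around the real root lines, the form is of full size. -/
theorem exists_le_eval_of_far (hn : n ≠ 0) (hF : F.IsHomogeneous n) (hinf : eval ![1, 0] F ≠ 0)
    {κ : ℝ} (hκ : 0 < κ) : ∃ c : ℝ, 0 < c ∧ ∀ v : Fin 2 → ℝ,
      (∀ ρ ∈ realRoots F, κ * |v 1| ≤ |v 0 - ρ * v 1|) → c * ‖v‖ ^ n ≤ |eval v F| := by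
  have hcont : Continuous fun v : Fin 2 → ℝ => |eval v F| := (MvPolynomial.continuous_eval F).abs
  let A : Set (Fin 2 → ℝ) := {v | ∀ ρ ∈ realRoots F, κ * |v 1| ≤ |v 0 - ρ * v 1|}
  have hA : IsClosed A := by
    have : A = ⋂ ρ ∈ realRoots F, {v : Fin 2 → ℝ | κ * |v 1| ≤ |v 0 - ρ * v 1|} := by
      ext v; simp [A]
    rw [this]
    exact isClosed_biInter fun ρ _ => isClosed_le (by fun_prop) (by fun_prop)
  -- On this compact set the form has no zero, since every zero lies on a root line; homogeneity
  -- extends the resulting lower bound from the sphere.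
  have hK : IsCompact (Metric.sphere (0 : Fin 2 → ℝ) 1 ∩ A) := (isCompact_sphere _ _).inter_right hA
  obtain ⟨c, hc, hcK⟩ : ∃ c : ℝ, 0 < c ∧ ∀ u ∈ Metric.sphere (0 : Fin 2 → ℝ) 1 ∩ A,
      c ≤ |eval u F| := by
    obtain hem | hne := (Metric.sphere (0 : Fin 2 → ℝ) 1 ∩ A).eq_empty_or_nonempty
    · exact ⟨1, one_pos, by simp [hem]⟩
    · obtain ⟨u, hu, hmin⟩ := hK.exists_isMinOn hne hcont.continuousOn
      refine ⟨|eval u F|, abs_pos.mpr fun h => ?_, fun x hx => hmin hx⟩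
      have hu0 : u ≠ 0 := ne_zero_of_mem_unit_sphere ⟨u, hu.1⟩
      have h1 := ne_zero_of_eval_eq_zero hF hinf hu0 h
      have h2 := hu.2 _ (div_mem_realRoots hF h1 h)
      rw [div_mul_cancel₀ _ h1, sub_self, abs_zero] at h2
      have := abs_pos.mpr h1
      nlinarith
  refine ⟨c, hc, fun v hv => ?_⟩
  by_cases hv0 : v = 0
  · rw [hv0, norm_zero, zero_pow hn, mul_zero]; exact abs_nonneg _
  have hv1 : 0 < ‖v‖ := norm_pos_iff.mpr hv0
  have hmem : ‖v‖⁻¹ • v ∈ Metric.sphere (0 : Fin 2 → ℝ) 1 ∩ A := by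
    refine ⟨by simp [norm_smul, hv1.ne'], fun ρ hρ => ?_⟩
    have := mul_le_mul_of_nonneg_left (hv ρ hρ) (inv_nonneg.mpr hv1.le)
    simp only [Pi.smul_apply, smul_eq_mul]
    rw [abs_mul, show ‖v‖⁻¹ * v 0 - ρ * (‖v‖⁻¹ * v 1) = ‖v‖⁻¹ * (v 0 - ρ * v 1) by ring, abs_mul,
      abs_of_pos (inv_pos.mpr hv1)]
    linarith
  have h := hcK _ hmem
  rw [eval_smul_of_isHomogeneous hF, abs_mul, abs_of_pos (by positivity), inv_pow] at h
  rwa [← div_eq_inv_mul, le_div_iff₀ (by positivity)] at h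

/-- Near a simple root, the form is almost linear. -/
theorem exists_near_root (hF : F.IsHomogeneous n) (hs : SimpleZeros F) {ρ : ℝ}
    (hρ : ρ ∈ realRoots F) {t : ℝ} (ht : t < 1) : ∀ᶠ κ in 𝓝[>] (0 : ℝ), ∀ z : ℝ, |z - ρ| ≤ κ →
      t * |(dehom F).derivative.eval ρ| * |z - ρ| ≤ |(dehom F).eval z| ∧
      |(dehom F).eval z| ≤ (2 - t) * |(dehom F).derivative.eval ρ| * |z - ρ| := by
  have hD := abs_pos.mpr (hs.derivative_ne_zero hF hρ)
  set D := (dehom F).derivative.eval ρ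
  have hder := ((dehom F).hasDerivAt ρ).isLittleO.def
    (show 0 < (1 - t) * |D| by nlinarith)
  obtain ⟨κ, hκ, hball⟩ := Metric.eventually_nhds_iff_ball.mp hder
  filter_upwards [Ioo_mem_nhdsGT hκ] with κ' hκ' z hz
  have h := hball z (by rw [Metric.mem_ball, Real.dist_eq]; exact hz.trans_lt hκ'.2)
  rw [mem_realRoots_iff.mp hρ, sub_zero, smul_eq_mul, Real.norm_eq_abs, Real.norm_eq_abs] at h
  have h1 := abs_sub_abs_le_abs_sub ((dehom F).eval z) ((z - ρ) * D)
  have h2 := abs_sub_abs_le_abs_sub ((z - ρ) * D) ((dehom F).eval z)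
  rw [abs_sub_comm] at h2
  rw [abs_mul] at h1 h2
  constructor <;> nlinarith

/-- Irrational numbers whose rational approximations are of order at most `5 / 2`. -/
def tameSet : Set ℝ := {x | Irrational x ∧ ¬LiouvilleWith (5 / 2) x}

/-- Any exponent strictly between `2` and `3` would do: above `2` almost every number qualifies, and
below `3 ≤ n` the values of the form near a root line still grow. -/
theorem ae_mem_tameSet : ∀ᵐ x : ℝ, x ∈ tameSet := by
  have h1 : ∀ᵐ x : ℝ, Irrational x := by
    have := (Set.countable_range ((↑) : ℚ → ℝ)).ae_notMem volume
    exact this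
  filter_upwards [h1, ae_not_liouvilleWith] with x hx hx'
  exact ⟨hx, hx' _ (by norm_num)⟩

theorem eventually_le_of_mem_tameSet {x : ℝ} (hx : x ∈ tameSet) :
    ∀ᶠ b : ℕ in atTop, ∀ a : ℤ, 1 / (b : ℝ) ^ (5 / 2 : ℝ) ≤ |(a : ℝ) / b - x| := by
  have h := hx.2
  simp only [LiouvilleWith, not_exists] at h
  have := h 1
  rw [not_frequently] at this
  filter_upwards [this] with b hb a
  by_contra! hlt
  refine hb ⟨a, fun hxa => hx.1 ⟨(a : ℚ) / b, by rw [hxa]; push_cast; rfl⟩, ?_⟩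
  rwa [abs_sub_comm]

theorem exists_int_nat_div (X : ℤ) {Y : ℤ} (hY : Y ≠ 0) : ∃ (a : ℤ) (b : ℕ), 0 < b ∧
    (a : ℝ) / b = (X : ℝ) / Y ∧ (b : ℝ) = |(Y : ℝ)| ∧ b = Y.natAbs := by
  refine ⟨Y.sign * X, Y.natAbs, Int.natAbs_pos.mpr hY, ?_, by simp [Nat.cast_natAbs], rfl⟩
  have hY' : (Y : ℝ) ≠ 0 := by exact_mod_cast hY
  rw [Nat.cast_natAbs]
  obtain h | h := lt_or_gt_of_ne hY
  · rw [Int.sign_eq_neg_one_of_neg h, abs_of_neg h]; push_cast; field_simp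
  · rw [Int.sign_eq_one_of_pos h, abs_of_pos h]; push_cast; field_simp

/-- If all real roots of a form of degree at least `3` are tame, then it takes small values at
finitely many integer points only. -/
theorem finite_setOf_abs_eval_le (hn : 3 ≤ n) (hF : F.IsHomogeneous n)
    (hinf : eval ![1, 0] F ≠ 0) (hs : SimpleZeros F) (ht : ∀ ρ ∈ realRoots F, ρ ∈ tameSet) (C : ℝ) :
    {v : Fin 2 → ℤ | |eval (fun i => (v i : ℝ)) F| ≤ C}.Finite := by
  have hfin := finite_realRoots hF hinf
  obtain ⟨κ, hκ, hκ0⟩ : ∃ κ : ℝ, (∀ ρ ∈ realRoots F, ∀ z : ℝ, |z - ρ| ≤ κ →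
      1 / 2 * |(dehom F).derivative.eval ρ| * |z - ρ| ≤ |(dehom F).eval z|) ∧ 0 < κ := by
    have : ∀ᶠ κ in 𝓝[>] (0 : ℝ), ∀ ρ ∈ realRoots F, ∀ z : ℝ, |z - ρ| ≤ κ →
        1 / 2 * |(dehom F).derivative.eval ρ| * |z - ρ| ≤ |(dehom F).eval z| := by
      refine (eventually_all_finite hfin).mpr fun ρ hρ => ?_
      filter_upwards [exists_near_root hF hs hρ (t := 1 / 2) (by norm_num)] with κ h z hz
      exact (h z hz).1
    exact (this.and self_mem_nhdsWithin).exists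
  obtain ⟨c, hc, hfar⟩ := exists_le_eval_of_far (by omega : n ≠ 0) hF hinf hκ0
  have hNev : ∀ᶠ b : ℕ in atTop, ∀ ρ ∈ realRoots F,
      (∀ a : ℤ, 1 / (b : ℝ) ^ (5 / 2 : ℝ) ≤ |(a : ℝ) / b - ρ|) ∧
      C < 1 / 2 * |(dehom F).derivative.eval ρ| * (b : ℝ) ^ (1 / 2 : ℝ) := by
    refine (eventually_all_finite hfin).mpr fun ρ hρ =>
      (eventually_le_of_mem_tameSet (ht ρ hρ)).and ?_
    have hD := abs_pos.mpr (hs.derivative_ne_zero hF hρ)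
    exact (((tendsto_rpow_atTop (by norm_num : (0 : ℝ) < 1 / 2)).comp
      tendsto_natCast_atTop_atTop).const_mul_atTop (by positivity)).eventually_gt_atTop C
  obtain ⟨N, hN⟩ := eventually_atTop.mp hNev
  obtain ⟨R, hR⟩ := hfin.isBounded.exists_norm_le
  -- The entries bound vectors away from the root lines by `C / c`, and second and first coordinates
  -- of vectors near a root line by `N` and `(κ + R) * N`.
  obtain ⟨B, hB⟩ := exists_nat_ge (max (max 1 (C / c)) (max N ((κ + R) * N)))
  have hB1 : (1 : ℝ) ≤ B := (le_max_left _ _).trans ((le_max_left _ _).trans hB)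
  have hB2 : C / c ≤ B := (le_max_right _ _).trans ((le_max_left _ _).trans hB)
  have hB3 : (N : ℝ) ≤ B := (le_max_left _ _).trans ((le_max_right _ _).trans hB)
  have hB4 : (κ + R) * N ≤ B := (le_max_right _ _).trans ((le_max_right _ _).trans hB)
  refine (Set.finite_Icc (fun _ : Fin 2 => -(B : ℤ)) (fun _ => (B : ℤ))).subset fun v hv => ?_
  have hv' : |eval (fun i => (v i : ℝ)) F| ≤ C := hv
  suffices h : ∀ i, |(v i : ℝ)| ≤ B by
    constructor <;> intro i <;> have := abs_le.mp (h i)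
    · exact_mod_cast this.1
    · exact_mod_cast this.2
  by_cases hcone : ∀ ρ ∈ realRoots F, κ * |(v 1 : ℝ)| ≤ |(v 0 : ℝ) - ρ * v 1|
  · have h := (hfar (fun i => (v i : ℝ)) hcone).trans hv'
    have hnorm : ‖fun i => (v i : ℝ)‖ ≤ B := by
      by_contra! hlt
      have h1 : (1 : ℝ) ≤ ‖fun i => (v i : ℝ)‖ := hB1.trans hlt.le
      have h2 := le_self_pow₀ h1 (by omega : n ≠ 0)
      have h3 : c * ‖fun i => (v i : ℝ)‖ ≤ C := (mul_le_mul_of_nonneg_left h2 hc.le).trans h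
      rw [← le_div_iff₀' hc] at h3
      linarith
    exact fun i => (norm_le_pi_norm (fun i => (v i : ℝ)) i).trans hnorm
  · push Not at hcone
    obtain ⟨ρ, hρ, hlt⟩ := hcone
    have hY : v 1 ≠ 0 := by
      intro h0
      rw [h0, Int.cast_zero, abs_zero, mul_zero, mul_zero] at hlt
      exact absurd hlt (not_lt.mpr (abs_nonneg _))
    have hY' : (v 1 : ℝ) ≠ 0 := by exact_mod_cast hY
    obtain ⟨a, b, hb, hab, hbY, -⟩ := exists_int_nat_div (v 0) hY
    have hz : |(v 0 : ℝ) / v 1 - ρ| ≤ κ := by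
      have e : (v 0 : ℝ) / v 1 - ρ = (v 0 - ρ * v 1) / v 1 := by field_simp
      rw [e, abs_div, div_le_iff₀ (abs_pos.mpr hY')]
      exact hlt.le
    have hbN : b < N := by
      by_contra! hbN
      obtain ⟨h1, h2⟩ := hN b hbN ρ hρ
      have h3 := hκ ρ hρ _ hz
      have hb0 : (0 : ℝ) < b := by exact_mod_cast hb
      have hb1 : (1 : ℝ) ≤ b := by exact_mod_cast hb
      rw [eval_eq_pow_mul hF hY', abs_mul, abs_pow, ← hbY] at hv'
      -- `n - 5 / 2 ≥ 1 / 2`, which is where `n ≥ 3` enters.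
      have h4 : (b : ℝ) ^ (1 / 2 : ℝ) ≤ (b : ℝ) ^ n * (1 / (b : ℝ) ^ (5 / 2 : ℝ)) := by
        rw [mul_one_div, le_div_iff₀ (by positivity), ← Real.rpow_add hb0]
        norm_num
        exact_mod_cast pow_le_pow_right₀ hb1 hn
      have h5 := h1 a
      rw [hab] at h5
      have : 1 / 2 * |(dehom F).derivative.eval ρ| * (b : ℝ) ^ (1 / 2 : ℝ) ≤ C := by
        calc _ ≤ 1 / 2 * |(dehom F).derivative.eval ρ| *
              ((b : ℝ) ^ n * (1 / (b : ℝ) ^ (5 / 2 : ℝ))) := by gcongr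
          _ = (b : ℝ) ^ n * (1 / 2 * |(dehom F).derivative.eval ρ| *
              (1 / (b : ℝ) ^ (5 / 2 : ℝ))) := by ring
          _ ≤ (b : ℝ) ^ n * (1 / 2 * |(dehom F).derivative.eval ρ| * |(v 0 : ℝ) / v 1 - ρ|) := by
              gcongr
          _ ≤ (b : ℝ) ^ n * |(dehom F).eval ((v 0 : ℝ) / v 1)| := by gcongr
          _ ≤ C := hv'
      linarith
    have hYN : |(v 1 : ℝ)| ≤ N := by rw [← hbY]; exact_mod_cast hbN.le
    have hXN : |(v 0 : ℝ)| ≤ (κ + R) * N := by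
      have e : (v 0 : ℝ) = (v 0 - ρ * v 1) + ρ * v 1 := by ring
      have hRρ : |ρ| ≤ R := hR ρ hρ
      calc |(v 0 : ℝ)| ≤ |(v 0 : ℝ) - ρ * v 1| + |ρ * v 1| := by
            conv_lhs => rw [e]
            exact abs_add_le _ _
        _ ≤ κ * |(v 1 : ℝ)| + R * |(v 1 : ℝ)| := by
            rw [abs_mul]; gcongr
        _ = (κ + R) * |(v 1 : ℝ)| := by ring
        _ ≤ _ := by
            have : 0 ≤ R := (abs_nonneg _).trans hRρ
            gcongr
    intro i
    fin_cases i
    · exact hXN.trans hB4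
    · exact hYN.trans hB3

theorem bddBelow_formMin (F : MvPolynomial (Fin 2) ℝ) : BddBelow (Set.range
    fun v : {v : Fin 2 → ℤ // v ≠ 0} => |eval (fun i => (v.1 i : ℝ)) F|) :=
  ⟨0, by rintro _ ⟨v, rfl⟩; exact abs_nonneg _⟩

theorem formMin_le (F : MvPolynomial (Fin 2) ℝ) {v : Fin 2 → ℤ} (hv : v ≠ 0) :
    formMin F ≤ |eval (fun i => (v i : ℝ)) F| :=
  ciInf_le (bddBelow_formMin F) ⟨v, hv⟩

instance : Nonempty {v : Fin 2 → ℤ // v ≠ 0} :=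
  ⟨⟨![1, 0], fun h => by simpa using congrFun h 0⟩⟩

theorem le_formMin {c : ℝ} (h : ∀ v : Fin 2 → ℤ, v ≠ 0 → c ≤ |eval (fun i => (v i : ℝ)) F|) :
    c ≤ formMin F :=
  le_ciInf fun v => h v.1 v.2

theorem finitelyMinimized_of_tame (hn : 3 ≤ n) (hF : F.IsHomogeneous n)
    (hinf : eval ![1, 0] F ≠ 0) (hs : SimpleZeros F) (ht : ∀ ρ ∈ realRoots F, ρ ∈ tameSet) :
    FinitelyMinimized F := by
  obtain ⟨v₀, hv₀⟩ := (inferInstance : Nonempty {v : Fin 2 → ℤ // v ≠ 0})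
  let s : Set (Fin 2 → ℤ) := {v | v ≠ 0 ∧ |eval (fun i => (v i : ℝ)) F| ≤
    |eval (fun i => (v₀ i : ℝ)) F|}
  have hsf : s.Finite := (finite_setOf_abs_eval_le hn hF hinf hs ht
    (|eval (fun i => (v₀ i : ℝ)) F|)).subset fun v hv => hv.2
  obtain ⟨v, hv, hmin⟩ := hsf.exists_minimalFor (fun v => |eval (fun i => (v i : ℝ)) F|) s
    ⟨v₀, hv₀, le_rfl⟩
  refine ⟨v, hv.1, le_antisymm (le_formMin fun w hw => ?_) (formMin_le F hv.1)⟩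
  by_cases hws : |eval (fun i => (w i : ℝ)) F| ≤ |eval (fun i => (v₀ i : ℝ)) F|
  · by_contra! hlt
    exact absurd (hmin ⟨hw, hws⟩ hlt.le) (not_le.mpr hlt)
  · exact hv.2.trans (not_le.mp hws).le

theorem formMin_pos_of_tame (hn : 3 ≤ n) (hF : F.IsHomogeneous n)
    (hinf : eval ![1, 0] F ≠ 0) (hs : SimpleZeros F) (ht : ∀ ρ ∈ realRoots F, ρ ∈ tameSet) :
    0 < formMin F := by
  obtain ⟨v, hv, hmin⟩ := finitelyMinimized_of_tame hn hF hinf hs ht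
  rw [← hmin, abs_pos]
  intro h
  have hv' : (fun i => (v i : ℝ)) ≠ 0 := fun h => hv (by
    ext i; simpa using congrFun h i)
  have h1 := ne_zero_of_eval_eq_zero hF hinf hv' h
  refine (ht _ (div_mem_realRoots hF h1 h)).1 ⟨(v 0 : ℚ) / v 1, ?_⟩
  push_cast
  rfl

end Form

/-! ### Stability of the minimum under small deformations. -/

theorem mulVec_apply_zero (T : SL2R) (w : Fin 2 → ℝ) :
    T.1.mulVec w 0 = T.1 0 0 * w 0 + T.1 0 1 * w 1 := by
  simp [Matrix.mulVec, dotProduct, Fin.sum_univ_two]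

theorem mulVec_apply_one (T : SL2R) (w : Fin 2 → ℝ) :
    T.1.mulVec w 1 = T.1 1 0 * w 0 + T.1 1 1 * w 1 := by
  simp [Matrix.mulVec, dotProduct, Fin.sum_univ_two]

theorem mulVec_inv_mulVec (T : SL2R) (v : Fin 2 → ℝ) : T.1.mulVec ((T⁻¹).1.mulVec v) = v := by
  rw [Matrix.mulVec_mulVec, ← Matrix.SpecialLinearGroup.coe_mul, mul_inv_cancel,
    Matrix.SpecialLinearGroup.coe_one, Matrix.one_mulVec]

theorem mulVec_inv_ne_zero (T : SL2R) {v : Fin 2 → ℝ} (hv : v ≠ 0) : (T⁻¹).1.mulVec v ≠ 0 := by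
  intro h
  apply hv
  rw [← mulVec_inv_mulVec T v, h, Matrix.mulVec_zero]

theorem norm_mulVec_sub_le {r : ℝ} {T : SL2R} (hT : T ∈ ballId r) (w : Fin 2 → ℝ) :
    ‖T.1.mulVec w - w‖ ≤ 2 * r * ‖w‖ := by
  obtain ⟨h1, h2, h3, h4⟩ := entry_of_mem_ballId hT
  have hr : 0 ≤ r := (abs_nonneg _).trans h1.le
  have hw0 : |w 0| ≤ ‖w‖ := norm_le_pi_norm w 0
  have hw1 : |w 1| ≤ ‖w‖ := norm_le_pi_norm w 1
  have key : ∀ p q : ℝ, |p| < r → |q| < r → |p * w 0 + q * w 1| ≤ 2 * r * ‖w‖ := by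
    intro p q hp hq
    calc |p * w 0 + q * w 1| ≤ |p| * |w 0| + |q| * |w 1| := by
          rw [← abs_mul, ← abs_mul]; exact abs_add_le _ _
      _ ≤ r * ‖w‖ + r * ‖w‖ := by gcongr
      _ = _ := by ring
  refine (pi_norm_le_iff_of_nonneg (by positivity)).mpr fun i => ?_
  rw [Real.norm_eq_abs, Pi.sub_apply]
  fin_cases i
  · show |T.1.mulVec w 0 - w 0| ≤ _
    rw [mulVec_apply_zero, show T.1 0 0 * w 0 + T.1 0 1 * w 1 - w 0 =
      (T.1 0 0 - 1) * w 0 + T.1 0 1 * w 1 by ring]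
    exact key _ _ h1 h2
  · show |T.1.mulVec w 1 - w 1| ≤ _
    rw [mulVec_apply_one, show T.1 1 0 * w 0 + T.1 1 1 * w 1 - w 1 =
      T.1 1 0 * w 0 + (T.1 1 1 - 1) * w 1 by ring]
    exact key _ _ h3 h4

/-- Effect of an element close to the identity on a vector in a cone. -/
theorem near_identity_bounds {r R : ℝ} {T : SL2R} (hT : T ∈ ballId r) (hR : 0 ≤ R)
    (w : Fin 2 → ℝ) (hw : |w 0| ≤ R * |w 1|) {ρ : ℝ} (hρ : |ρ| ≤ R) :
    |T.1.mulVec w 1| ≤ (1 + r * (1 + R)) * |w 1| ∧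
    (1 - r * (1 + R)) * |w 1| ≤ |T.1.mulVec w 1| ∧
    |T.1.mulVec w 0 - ρ * T.1.mulVec w 1| ≤ |w 0 - ρ * w 1| + r * (1 + R) ^ 2 * |w 1| ∧
    1 - r * (1 + R) ≤ |denom T ρ| := by
  obtain ⟨h1, h2, h3, h4⟩ := entry_of_mem_ballId hT
  have hr : 0 ≤ r := (abs_nonneg _).trans h1.le
  have hw1 := abs_nonneg (w 1)
  rw [mulVec_apply_zero, mulVec_apply_one, denom]
  have key : ∀ p q : ℝ, |p| < r → |q| < r → |p * w 0 + q * w 1| ≤ r * (1 + R) * |w 1| := by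
    intro p q hp hq
    calc |p * w 0 + q * w 1| ≤ |p| * |w 0| + |q| * |w 1| := by
          rw [← abs_mul, ← abs_mul]; exact abs_add_le _ _
      _ ≤ r * (R * |w 1|) + r * |w 1| := by gcongr
      _ = _ := by ring
  have k1 := key _ _ h3 h4
  have k0 := key _ _ h1 h2
  have e1 : T.1 1 0 * w 0 + T.1 1 1 * w 1 = w 1 + (T.1 1 0 * w 0 + (T.1 1 1 - 1) * w 1) := by ring
  refine ⟨?_, ?_, ?_, ?_⟩
  · rw [e1]
    linarith [abs_add_le (w 1) (T.1 1 0 * w 0 + (T.1 1 1 - 1) * w 1)]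
  · rw [e1]
    have := abs_sub_abs_le_abs_sub (w 1) (-(T.1 1 0 * w 0 + (T.1 1 1 - 1) * w 1))
    rw [abs_neg, sub_neg_eq_add] at this
    linarith
  · have e : T.1 0 0 * w 0 + T.1 0 1 * w 1 - ρ * (T.1 1 0 * w 0 + T.1 1 1 * w 1) =
      (w 0 - ρ * w 1) + (((T.1 0 0 - 1) * w 0 + T.1 0 1 * w 1) -
        ρ * (T.1 1 0 * w 0 + (T.1 1 1 - 1) * w 1)) := by ring
    rw [e]
    calc _ ≤ |w 0 - ρ * w 1| + (|(T.1 0 0 - 1) * w 0 + T.1 0 1 * w 1| +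
          |ρ| * |T.1 1 0 * w 0 + (T.1 1 1 - 1) * w 1|) := by
          rw [← abs_mul]
          exact (abs_add_le _ _).trans (add_le_add_right (abs_sub _ _) _)
      _ ≤ |w 0 - ρ * w 1| + (r * (1 + R) * |w 1| + R * (r * (1 + R) * |w 1|)) := by gcongr
      _ = _ := by ring
  · have e : T.1 1 0 * ρ + T.1 1 1 = 1 + (T.1 1 0 * ρ + (T.1 1 1 - 1)) := by ring
    have k : |T.1 1 0 * ρ + (T.1 1 1 - 1)| ≤ r * (1 + R) := by
      calc _ ≤ |T.1 1 0| * |ρ| + |T.1 1 1 - 1| := by rw [← abs_mul]; exact abs_add_le _ _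
        _ ≤ r * R + r := by gcongr
        _ = _ := by ring
    rw [e]
    have := abs_sub_abs_le_abs_sub 1 (-(T.1 1 0 * ρ + (T.1 1 1 - 1)))
    rw [abs_neg, sub_neg_eq_add, abs_one] at this
    linarith

/-- The linear form cutting out the root line of `ρ` at `w` is proportional to the one cutting out
the line of `T(ρ)` at `T w`; the determinant `1` makes the factor exactly `denom T ρ`. -/
theorem sub_mul_eq_denom_mul {T : SL2R} {ρ : ℝ} (hq : denom T ρ ≠ 0) (w : Fin 2 → ℝ) :
    w 0 - ρ * w 1 = denom T ρ * (T.1.mulVec w 0 - moebius T ρ * T.1.mulVec w 1) := by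
  have hdet := det_entries T
  rw [mulVec_apply_zero, mulVec_apply_one, moebius, mul_sub, ← mul_assoc, mul_div_cancel₀ _ hq,
    denom]
  linear_combination (ρ * w 1 - w 0) * hdet

section Form

variable {n : ℕ} {F : MvPolynomial (Fin 2) ℝ}

/-- The value at `v` of the transformed form is not much smaller than the minimum of the form, if
`v` is close to a root line and the transformed root has no exceptional approximation. -/
theorem le_eval_of_near_root (hn : n ≠ 0) (hF : F.IsHomogeneous n) {M t r R κ ρ : ℝ}
    (hM : 0 < M) (hmin : M ≤ formMin F) (ht0 : 0 < t) (ht1 : t < 1) (hr : 0 < r)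
    (hκ0 : 0 < κ) (hκ1 : κ ≤ 1) (hρR : |ρ| + 1 ≤ R) (hD : (dehom F).derivative.eval ρ ≠ 0)
    (hκ : ∀ z : ℝ, |z - ρ| ≤ κ →
      t * |(dehom F).derivative.eval ρ| * |z - ρ| ≤ |(dehom F).eval z| ∧
      |(dehom F).eval z| ≤ (2 - t) * |(dehom F).derivative.eval ρ| * |z - ρ|)
    (hr1 : r * (1 + R) ≤ 1 / 2) (hr2 : r * (1 + R) ^ 2 ≤ κ / 4)
    (hr3 : t ≤ (1 - r * (1 + R)) * (1 / (1 + r * (1 + R))) ^ (n - 1))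
    {T : SL2R} (hT : T ∈ ballId r) (hbad : moebius T ρ ∉ badSet n
      (t ^ 2 * M / |(dehom F).derivative.eval ρ|) (t * M / |(dehom F).derivative.eval ρ|) ρ)
    {v : Fin 2 → ℤ} {w : Fin 2 → ℝ} (hw : T.1.mulVec w = fun i => (v i : ℝ))
    (hnear : |w 0 - ρ * w 1| < κ / 4 * |w 1|) : t ^ 4 * M ≤ |eval w F| := by
  set D := (dehom F).derivative.eval ρ
  have hD0 : 0 < |D| := abs_pos.mpr hD
  have hR : 0 ≤ R := by linarith [abs_nonneg ρ]
  have hw1 : w 1 ≠ 0 := by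
    intro h
    rw [h, abs_zero, mul_zero, mul_zero] at hnear
    exact absurd hnear (not_lt.mpr (abs_nonneg _))
  have hw1' : 0 < |w 1| := abs_pos.mpr hw1
  have hw0 : |w 0| ≤ R * |w 1| := by
    calc |w 0| = |(w 0 - ρ * w 1) + ρ * w 1| := by ring_nf
      _ ≤ |w 0 - ρ * w 1| + |ρ| * |w 1| := by rw [← abs_mul]; exact abs_add_le _ _
      _ ≤ 1 * |w 1| + |ρ| * |w 1| := by nlinarith
      _ ≤ _ := by rw [← add_mul]; gcongr; linarith
  obtain ⟨b1, b2, b3, b4⟩ := near_identity_bounds hT hR w hw0 (by linarith : |ρ| ≤ R)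
  have hq : denom T ρ ≠ 0 := by
    intro h; rw [h, abs_zero] at b4; linarith
  have hdist := sub_mul_eq_denom_mul hq w
  rw [hw] at b1 b2 b3 hdist
  simp only at b1 b2 b3 hdist
  have hY' : (v 1 : ℝ) ≠ 0 := by
    intro h; rw [h, abs_zero] at b2
    nlinarith
  have hY : v 1 ≠ 0 := by exact_mod_cast hY'
  have hYp := abs_pos.mpr hY'
  have hv : v ≠ 0 := fun h => hY (by rw [h]; rfl)
  obtain ⟨a, b, hb, hab, hbY, -⟩ := exists_int_nat_div (v 0) hY
  have hz : |(v 0 : ℝ) / v 1 - ρ| ≤ κ := by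
    have e : (v 0 : ℝ) / v 1 - ρ = (v 0 - ρ * v 1) / v 1 := by field_simp
    rw [e, abs_div, div_le_iff₀ hYp]
    nlinarith
  have hMv := hmin.trans (formMin_le F hv)
  rw [eval_eq_pow_mul hF hY', abs_mul, abs_pow, ← hbY] at hMv
  have hb0 : (0 : ℝ) < b := by exact_mod_cast hb
  -- The untransformed form is at least `M` at `v`. As `t (2 - t) ≤ 1`, this keeps `v 0 / v 1` at
  -- distance at least `t M / (|D| b ^ n)` from `ρ`. A closer approximation of `T(ρ)` would then be
  -- exceptional.
  have hgood : t ^ 2 * M / |D| / b ^ n ≤ |(v 0 : ℝ) / v 1 - moebius T ρ| := by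
    by_contra! hlt
    refine hbad ⟨a, b, hb, ?_, ?_⟩
    · rw [hab, Real.rpow_natCast]; exact hlt
    · rw [hab, Real.rpow_natCast, div_div, div_le_iff₀ (by positivity)]
      have h1 := (hκ _ hz).2
      have h2 : t * (2 - t) ≤ 1 := by nlinarith [sq_nonneg (t - 1)]
      have h3 : M ≤ (b : ℝ) ^ n * ((2 - t) * |D| * |(v 0 : ℝ) / v 1 - ρ|) :=
        hMv.trans (by gcongr)
      calc t * M ≤ t * ((b : ℝ) ^ n * ((2 - t) * |D| * |(v 0 : ℝ) / v 1 - ρ|)) := by gcongr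
        _ = (t * (2 - t)) * (|(v 0 : ℝ) / v 1 - ρ| * (|D| * (b : ℝ) ^ n)) := by ring
        _ ≤ 1 * (|(v 0 : ℝ) / v 1 - ρ| * (|D| * (b : ℝ) ^ n)) := by gcongr
        _ = _ := one_mul _
  have hz' : |w 0 / w 1 - ρ| ≤ κ := by
    have e : w 0 / w 1 - ρ = (w 0 - ρ * w 1) / w 1 := by field_simp
    rw [e, abs_div, div_le_iff₀ hw1']
    nlinarith
  have hfw := (hκ _ hz').1
  have e1 : |w 1| * |w 0 / w 1 - ρ| = |denom T ρ| * (b * |(v 0 : ℝ) / v 1 - moebius T ρ|) := by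
    rw [hbY, ← abs_mul, ← abs_mul, ← abs_mul]
    congr 1
    have l : w 1 * (w 0 / w 1 - ρ) = w 0 - ρ * w 1 := by field_simp
    rw [l, hdist]
    field_simp
  obtain ⟨m, rfl⟩ : ∃ m, n = m + 1 := ⟨n - 1, by omega⟩
  rw [Nat.add_sub_cancel] at hr3
  have hs0 : 0 ≤ r * (1 + R) := by positivity
  generalize r * (1 + R) = s at *
  have h1s : 0 ≤ 1 - s := by linarith
  have hτ : 1 / (1 + s) * b ≤ |w 1| := by
    rw [one_div_mul_eq_div, div_le_iff₀ (by positivity), hbY]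
    linarith
  rw [eval_eq_pow_mul hF hw1, abs_mul, abs_pow]
  -- Two factors `t` come from the constant of the bad set, one from the linear approximation at
  -- `ρ`, and one, by `hr3`, from the distortion of the second coordinate and of `denom T ρ`.
  calc t ^ 4 * M = t * (t ^ 3 * M) := by ring
    _ ≤ ((1 - s) * (1 / (1 + s)) ^ m) * (t ^ 3 * M) := by gcongr
    _ = (1 / (1 + s) * b) ^ m * (t * |D| * ((1 - s) * (b * (t ^ 2 * M / |D| / b ^ (m + 1))))) := by
        rw [mul_pow]
        field_simp
        ring
    _ ≤ |w 1| ^ m * (t * |D| * (|denom T ρ| * (b * |(v 0 : ℝ) / v 1 - moebius T ρ|))) := by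
        gcongr
    _ = |w 1| ^ (m + 1) * (t * |D| * |w 0 / w 1 - ρ|) := by rw [← e1]; ring
    _ ≤ _ := by gcongr

/-- Small deformations of a form that do not create exceptional approximations of the roots do not
decrease the minimum much. -/
theorem exists_le_formMin_act (hn : n ≠ 0) (hF : F.IsHomogeneous n) (hinf : eval ![1, 0] F ≠ 0)
    (hs : SimpleZeros F) (hM : 0 < formMin F) {δ : ℝ} (hδ : 0 < δ) :
    ∃ c₁ c₂ : ℝ → ℝ, (∀ ρ ∈ realRoots F, 0 < c₁ ρ ∧ c₁ ρ < c₂ ρ) ∧ ∀ᶠ r in 𝓝[>] (0 : ℝ),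
      ∀ T ∈ ballId r, (∀ ρ ∈ realRoots F, moebius T ρ ∉ badSet n (c₁ ρ) (c₂ ρ) ρ) →
        formMin F - δ ≤ formMin (act F T) := by
  have hfin := finite_realRoots hF hinf
  set M := formMin F
  obtain ⟨t, ht0, ht1, htM⟩ : ∃ t : ℝ, 0 < t ∧ t < 1 ∧ M - δ ≤ t ^ 4 * M := by
    have h1 : Tendsto (fun t : ℝ => t ^ 4 * M) (𝓝[<] 1) (𝓝 (1 ^ 4 * M)) :=
      (((continuous_id.pow 4).mul continuous_const).tendsto 1).mono_left nhdsWithin_le_nhds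
    have h2 := h1.eventually_const_le (show M - δ < 1 ^ 4 * M by linarith)
    obtain ⟨t, h, h0, h1⟩ := (h2.and (Ioo_mem_nhdsLT zero_lt_one)).exists
    exact ⟨t, h0, h1, h⟩
  refine ⟨fun ρ => t ^ 2 * M / |(dehom F).derivative.eval ρ|,
    fun ρ => t * M / |(dehom F).derivative.eval ρ|, fun ρ hρ => ?_, ?_⟩
  · have hD := abs_pos.mpr (hs.derivative_ne_zero hF hρ)
    exact ⟨by positivity, div_lt_div_of_pos_right (by nlinarith [mul_pos ht0 hM]) hD⟩
  obtain ⟨κ, hκ, hκ0, hκ1⟩ : ∃ κ : ℝ, (∀ ρ ∈ realRoots F, ∀ z : ℝ, |z - ρ| ≤ κ →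
      t * |(dehom F).derivative.eval ρ| * |z - ρ| ≤ |(dehom F).eval z| ∧
      |(dehom F).eval z| ≤ (2 - t) * |(dehom F).derivative.eval ρ| * |z - ρ|) ∧ 0 < κ ∧ κ < 1 :=
    (((eventually_all_finite hfin).mpr fun ρ hρ => exists_near_root hF hs hρ ht1).and
      (Ioo_mem_nhdsGT zero_lt_one)).exists
  obtain ⟨c, hc, hfar⟩ := exists_le_eval_of_far hn hF hinf (show 0 < κ / 4 by positivity)
  obtain ⟨R₀, hR₀⟩ := hfin.isBounded.exists_norm_le
  set R := |R₀| + 1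
  have hR : ∀ ρ ∈ realRoots F, |ρ| + 1 ≤ R := fun ρ hρ =>
    add_le_add_left ((hR₀ ρ hρ).trans (le_abs_self _)) _
  set B := max 1 (M / c)
  have hB1 : 1 ≤ B := le_max_left _ _
  have hunif := (isCompact_closedBall (0 : Fin 2 → ℝ) (B + 1)).uniformContinuousOn_of_continuous
    (MvPolynomial.continuous_eval F).continuousOn
  obtain ⟨η, hη, hunif⟩ := Metric.uniformContinuousOn_iff.mp hunif δ hδ
  have hlim : ∀ f : ℝ → ℝ, Continuous f → ∀ b, f 0 < b → ∀ᶠ r in 𝓝[>] (0 : ℝ), f r < b :=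
    fun f hf b hb => ((hf.tendsto 0).mono_left nhdsWithin_le_nhds).eventually_lt_const hb
  have hlim3 : ∀ᶠ r in 𝓝[>] (0 : ℝ), t < (1 - r * (1 + R)) * (1 / (1 + r * (1 + R))) ^ (n - 1) := by
    have : Tendsto (fun r : ℝ => (1 - r * (1 + R)) * (1 / (1 + r * (1 + R))) ^ (n - 1)) (𝓝 0)
        (𝓝 ((1 - 0 * (1 + R)) * (1 / (1 + 0 * (1 + R))) ^ (n - 1))) := by
      refine ContinuousAt.tendsto ?_
      refine ContinuousAt.mul (by fun_prop) (ContinuousAt.pow (ContinuousAt.div (by fun_prop)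
        (by fun_prop) (by simp)) _)
    exact (this.mono_left nhdsWithin_le_nhds).eventually_const_lt (by simpa using ht1)
  filter_upwards [hlim (fun r => r * (1 + R)) (by fun_prop) (1 / 2) (by simp),
    hlim (fun r => r * (1 + R) ^ 2) (by fun_prop) (κ / 4) (by simpa using hκ0), hlim3,
    hlim (fun r => 2 * r * B) (by fun_prop) η (by simpa using hη),
    hlim (fun r => 2 * r * B) (by fun_prop) 1 (by simp), self_mem_nhdsWithin]
    with r hr1 hr2 hr3 hr4 hr5 hr0 T hT hbad
  refine le_formMin fun v hv => ?_
  rw [eval_act]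
  have hwv := mulVec_inv_mulVec T (fun i => (v i : ℝ))
  set w := (T⁻¹).1.mulVec (fun i => (v i : ℝ))
  -- Away from the root lines, long vectors have values above `M` by growth. On bounded ones,
  -- uniform continuity compares `F w` with `F (T w)`, where `T w` is the integer vector `v`. Near a
  -- root line the hypothesis on `T(ρ)` is used.
  by_cases hcone : ∀ ρ ∈ realRoots F, κ / 4 * |w 1| ≤ |w 0 - ρ * w 1|
  · have h := hfar w hcone
    by_cases hwB : ‖w‖ ≤ B
    · have hTw : ‖T.1.mulVec w - w‖ ≤ 2 * r * B :=
        (norm_mulVec_sub_le hT w).trans (by have : 0 < r := hr0; gcongr)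
      have hTw' : ‖T.1.mulVec w‖ ≤ B + 1 := by
        calc ‖T.1.mulVec w‖ = ‖w + (T.1.mulVec w - w)‖ := by simp
          _ ≤ ‖w‖ + ‖T.1.mulVec w - w‖ := norm_add_le _ _
          _ ≤ _ := by linarith
      have := hunif (T.1.mulVec w) (by simpa using hTw') w
        (by simpa using hwB.trans (by linarith)) (by rw [dist_eq_norm]; linarith)
      rw [Real.dist_eq] at this
      have h1 := abs_sub_abs_le_abs_sub (eval (T.1.mulVec w) F) (eval w F)
      have h2 := formMin_le F hv
      rw [← hwv] at h2
      linarith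
    · rw [not_le] at hwB
      have h2 := le_self_pow₀ (hB1.trans hwB.le) hn
      have h3 : M / c < ‖w‖ ^ n := (le_max_right _ _).trans_lt (hwB.trans_le h2)
      rw [div_lt_iff₀' hc] at h3
      linarith
  · push Not at hcone
    obtain ⟨ρ, hρ, hnear⟩ := hcone
    exact htM.trans (le_eval_of_near_root hn hF hM le_rfl ht0 ht1 hr0 hκ0 hκ1.le (hR ρ hρ)
      (hs.derivative_ne_zero hF hρ) (hκ ρ hρ) hr1.le hr2.le hr3.le hT (hbad ρ hρ) hwv hnear)

end Form

/-! ### Mahler compactness and the existence of extremal lattices. -/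

/-- Reduction theory: every matrix in `SL₂(ℝ)` can be multiplied by an integral matrix so that the
result has size bounded in terms of the length of its first column. -/
theorem exists_reduced (g : SL2R) : ∃ γ : Matrix.SpecialLinearGroup (Fin 2) ℤ, ∀ δ : ℝ, 0 < δ →
    δ ≤ (g * γ.map (Int.castRingHom ℝ)).1 0 0 ^ 2 + (g * γ.map (Int.castRingHom ℝ)).1 1 0 ^ 2 →
    ∀ i j, |(g * γ.map (Int.castRingHom ℝ)).1 i j| ≤ 2 + 2 / δ := by
  -- With `M = γ g⁻¹` and bottom row `(c, d)`, the point `M i` has imaginary part `1 / (c ^ 2 + d ^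
  -- 2)`, and the first column of the reduced matrix `M⁻¹` is `(d, -c)`. The fundamental domain
  -- bounds `c` and `d`; a first column that is not short bounds the imaginary part from above.
  obtain ⟨γ, hγ⟩ := ModularGroup.exists_smul_mem_fd (g⁻¹ • UpperHalfPlane.I)
  have hsm : γ • (g⁻¹ • UpperHalfPlane.I) =
      (γ.map (Int.castRingHom ℝ) * g⁻¹) • UpperHalfPlane.I := by
    rw [mul_smul]; rfl
  have him := ModularGroup.three_le_four_mul_im_sq_of_mem_fd hγ
  have hre : |(γ • (g⁻¹ • UpperHalfPlane.I)).re| ≤ 1 / 2 := hγ.2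
  refine ⟨γ⁻¹, fun δ hδ => ?_⟩
  rw [hsm] at him hre
  have hinv : g * γ⁻¹.map (Int.castRingHom ℝ) = (γ.map (Int.castRingHom ℝ) * g⁻¹)⁻¹ := by
    rw [mul_inv_rev, inv_inv, map_inv]
  rw [hinv]
  set M : SL2R := γ.map (Int.castRingHom ℝ) * g⁻¹
  have hdet := det_entries M
  have e00 : (M⁻¹).1 0 0 = M.1 1 1 := by simp [Matrix.adjugate_fin_two]
  have e01 : (M⁻¹).1 0 1 = -M.1 0 1 := by simp [Matrix.adjugate_fin_two]
  have e10 : (M⁻¹).1 1 0 = -M.1 1 0 := by simp [Matrix.adjugate_fin_two]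
  have e11 : (M⁻¹).1 1 1 = M.1 0 0 := by simp [Matrix.adjugate_fin_two]
  have hτ := UpperHalfPlane.coe_specialLinearGroup_apply M UpperHalfPlane.I
  have hpos := (M • UpperHalfPlane.I).im_pos
  have hx : ((M • UpperHalfPlane.I : UpperHalfPlane) : ℂ).re = (M • UpperHalfPlane.I).re := rfl
  have hy : ((M • UpperHalfPlane.I : UpperHalfPlane) : ℂ).im = (M • UpperHalfPlane.I).im := rfl
  have hden : ((algebraMap ℝ ℝ (M.1 1 0) : ℝ) : ℂ) * (UpperHalfPlane.I : ℂ) +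
      ((algebraMap ℝ ℝ (M.1 1 1) : ℝ) : ℂ) ≠ 0 := by
    intro h
    have h1 := congrArg Complex.re h
    have h2 := congrArg Complex.im h
    simp at h1 h2
    rw [h1, h2] at hdet
    simp at hdet
  rw [eq_div_iff hden] at hτ
  have h1 := congrArg Complex.re hτ
  have h2 := congrArg Complex.im hτ
  simp only [Algebra.algebraMap_self, RingHom.id_apply, UpperHalfPlane.coe_I, Complex.mul_re,
    Complex.mul_im, Complex.add_re, Complex.add_im, Complex.ofReal_re, Complex.ofReal_im,
    Complex.I_re, Complex.I_im, hx, hy] at h1 h2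
  rw [e00, e10]
  generalize (M • UpperHalfPlane.I).re = x at *
  generalize (M • UpperHalfPlane.I).im = y at *
  intro hle
  suffices h : |M.1 0 0| ≤ 2 + 2 / δ ∧ |M.1 0 1| ≤ 2 + 2 / δ ∧ |M.1 1 0| ≤ 2 + 2 / δ ∧
      |M.1 1 1| ≤ 2 + 2 / δ by
    intro i j
    fin_cases i <;> fin_cases j
    · exact e00 ▸ h.2.2.2
    · show |(M⁻¹).1 0 1| ≤ _
      rw [e01, abs_neg]; exact h.2.1
    · show |(M⁻¹).1 1 0| ≤ _
      rw [e10, abs_neg]; exact h.2.2.1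
    · exact e11 ▸ h.1
  generalize M.1 0 0 = a at *
  generalize M.1 0 1 = b at *
  generalize M.1 1 0 = c at *
  generalize M.1 1 1 = d at *
  -- Real and imaginary parts of `a i + b = (x + i y) (c i + d)`.
  have ha : a = x * c + y * d := by linarith
  have hb : b = x * d - y * c := by linarith
  have hyN : y * (c ^ 2 + d ^ 2) = 1 := by rw [ha, hb] at hdet; linarith
  have hy34 : 3 / 4 ≤ y := by nlinarith
  have hN : c ^ 2 + d ^ 2 ≤ 4 / 3 := by nlinarith [sq_nonneg c, sq_nonneg d]
  have hyδ : y ≤ 1 / δ := by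
    rw [le_div_iff₀ hδ]; nlinarith
  have hc : |c| ≤ 5 / 4 := abs_le_of_sq_le_sq (by nlinarith [sq_nonneg d]) (by norm_num)
  have hd : |d| ≤ 5 / 4 := abs_le_of_sq_le_sq (by nlinarith [sq_nonneg c]) (by norm_num)
  have hδ' : 0 < 1 / δ := by positivity
  have h2δ : 2 / δ = 2 * (1 / δ) := by ring
  have hbd : ∀ p q : ℝ, |p| ≤ 5 / 4 → |q| ≤ 5 / 4 → |x * p| + |y * q| ≤ 2 + 2 / δ := by
    intro p q hp hq
    rw [abs_mul, abs_mul, abs_of_pos hpos, h2δ]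
    have : |x| * |p| ≤ 1 / 2 * (5 / 4) := by gcongr
    have : y * |q| ≤ 1 / δ * (5 / 4) := by gcongr
    linarith
  refine ⟨?_, ?_, by linarith, by linarith⟩
  · rw [ha]; exact (abs_add_le _ _).trans (hbd c d hc hd)
  · rw [hb]; exact (abs_sub _ _).trans (hbd d c hd hc)

theorem bddBelow_latticeMin (P : MvPolynomial (Fin 2) ℝ) (g : SL2R) : BddBelow (Set.range
    fun v : {v : Fin 2 → ℤ // v ≠ 0} => |eval (g.1.mulVec fun i => (v.1 i : ℝ)) P|) :=
  ⟨0, by rintro _ ⟨v, rfl⟩; exact abs_nonneg _⟩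

theorem map_mulVec_intCast (γ : Matrix.SpecialLinearGroup (Fin 2) ℤ) (v : Fin 2 → ℤ) :
    (γ.map (Int.castRingHom ℝ)).1.mulVec (fun i => (v i : ℝ)) =
      fun i => ((γ.1.mulVec v i : ℤ) : ℝ) := by
  ext i
  simp [Matrix.mulVec, dotProduct, Fin.sum_univ_two]

/-- An integral matrix of determinant `1` maps nonzero integer vectors to such vectors; this
inequality suffices for replacing a lattice basis by a reduced one. -/
theorem latticeMin_le_mul_map (P : MvPolynomial (Fin 2) ℝ) (g : SL2R)
    (γ : Matrix.SpecialLinearGroup (Fin 2) ℤ) :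
    latticeMin P g ≤ latticeMin P (g * γ.map (Int.castRingHom ℝ)) := by
  refine le_ciInf fun v => ?_
  rw [Matrix.SpecialLinearGroup.coe_mul, ← Matrix.mulVec_mulVec, map_mulVec_intCast]
  refine ciInf_le (bddBelow_latticeMin P g) ⟨γ.1.mulVec v.1, fun h => v.2 ?_⟩
  have := congrArg (γ⁻¹).1.mulVec h
  rwa [Matrix.mulVec_mulVec, ← Matrix.SpecialLinearGroup.coe_mul, inv_mul_cancel,
    Matrix.SpecialLinearGroup.coe_one, Matrix.one_mulVec, Matrix.mulVec_zero] at this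

theorem upperSemicontinuous_latticeMin (P : MvPolynomial (Fin 2) ℝ) :
    UpperSemicontinuous (latticeMin P) := by
  refine upperSemicontinuous_ciInf (bddBelow_latticeMin P) fun v =>
    Continuous.upperSemicontinuous ?_
  refine ((MvPolynomial.continuous_eval P).comp ?_).abs
  exact continuous_subtype_val.matrix_mulVec continuous_const

/-- If some lattice has a positive minimum, then there is a lattice with the largest minimum. -/
theorem exists_isGreatest_spec {n : ℕ} (hn : n ≠ 0) {P : MvPolynomial (Fin 2) ℝ}
    (hP : P.IsHomogeneous n) (hpos : ∃ g, 0 < latticeMin P g) :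
    ∃ g, IsGreatest (spec P) (latticeMin P g) := by
  obtain ⟨g₁, hg₁⟩ := hpos
  have h0 : eval (0 : Fin 2 → ℝ) P = 0 := by
    have := eval_smul_of_isHomogeneous hP 0 0
    rwa [zero_pow hn, zero_mul, smul_zero] at this
  have hc : Tendsto (fun v : Fin 2 → ℝ => |eval v P|) (𝓝 0) (𝓝 |eval (0 : Fin 2 → ℝ) P|) :=
    (MvPolynomial.continuous_eval P).abs.tendsto 0
  rw [h0, abs_zero] at hc
  -- Vectors shorter than `δ` have values below the minimum of `g₁`, so a lattice at least as good
  -- as that of `g₁` contains no nonzero ones and can be reduced into a fixed compact set.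
  obtain ⟨δ, hδ, hball⟩ := Metric.eventually_nhds_iff_ball.mp (hc.eventually_lt_const hg₁)
  have hred : ∀ g, latticeMin P g₁ ≤ latticeMin P g → ∃ h ∈ {T : SL2R | ∀ i j,
      |T.1 i j| ≤ 2 + 2 / (δ ^ 2)}, latticeMin P g ≤ latticeMin P h := by
    intro g hg
    obtain ⟨γ, hγ⟩ := exists_reduced g
    have hle := latticeMin_le_mul_map P g γ
    refine ⟨_, hγ (δ ^ 2) (by positivity) ?_, hle⟩
    set h := g * γ.map (Int.castRingHom ℝ)
    have h1 : latticeMin P g₁ ≤ |eval (h.1.mulVec fun i => ((![1, 0] : Fin 2 → ℤ) i : ℝ)) P| :=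
      (hg.trans hle).trans (ciInf_le (bddBelow_latticeMin P h)
        ⟨![1, 0], fun h => by simpa using congrFun h 0⟩)
    by_contra! hlt
    have h2 := hball (h.1.mulVec fun i => ((![1, 0] : Fin 2 → ℤ) i : ℝ)) ?_
    · exact absurd h2 (not_lt.mpr h1)
    · rw [Metric.mem_ball, dist_zero_right, pi_norm_lt_iff hδ]
      intro i
      rw [Real.norm_eq_abs]
      fin_cases i
      · show |h.1.mulVec _ 0| < δ
        rw [mulVec_apply_zero]
        refine abs_lt_of_sq_lt_sq ?_ hδ.le
        simp only [Matrix.cons_val_zero, Matrix.cons_val_one]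
        push_cast
        nlinarith [sq_nonneg (h.1 1 0)]
      · show |h.1.mulVec _ 1| < δ
        rw [mulVec_apply_one]
        refine abs_lt_of_sq_lt_sq ?_ hδ.le
        simp only [Matrix.cons_val_zero, Matrix.cons_val_one]
        push_cast
        nlinarith [sq_nonneg (h.1 0 0)]
  obtain ⟨h₁, hh₁, hle₁⟩ := hred g₁ le_rfl
  obtain ⟨g, hg, hmax⟩ := UpperSemicontinuousOn.exists_isMaxOn (f := latticeMin P) ⟨h₁, hh₁⟩
    (isCompact_setOf_entry_le (2 + 2 / δ ^ 2))
    ((upperSemicontinuous_latticeMin P).upperSemicontinuousOn _)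
  refine ⟨g, ⟨g, rfl⟩, ?_⟩
  rintro _ ⟨g', rfl⟩
  obtain hlt | hle := lt_or_ge (latticeMin P g') (latticeMin P g₁)
  · exact hlt.le.trans (hle₁.trans (hmax hh₁))
  · obtain ⟨h', hh', hle'⟩ := hred g' hle
    exact hle'.trans (hmax hh')

theorem exists_mulVec_eq {v : Fin 2 → ℝ} (hv : v ≠ 0) : ∃ g : SL2R, g.1.mulVec ![1, 0] = v := by
  have hN : v 0 ^ 2 + v 1 ^ 2 ≠ 0 := by
    intro h
    apply hv
    have h0 : v 0 = 0 := by nlinarith [sq_nonneg (v 0), sq_nonneg (v 1)]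
    have h1 : v 1 = 0 := by nlinarith [sq_nonneg (v 0), sq_nonneg (v 1)]
    ext i; fin_cases i <;> simp [h0, h1]
  refine ⟨⟨!![v 0, -v 1 / (v 0 ^ 2 + v 1 ^ 2); v 1, v 0 / (v 0 ^ 2 + v 1 ^ 2)], ?_⟩, ?_⟩
  · rw [Matrix.det_fin_two_of]; field_simp; ring
  · ext i; fin_cases i <;> simp

theorem eval_act_unipotent (F : MvPolynomial (Fin 2) ℝ) (t x y : ℝ) :
    eval ![x, y] (act F (unipotent t)) = eval ![x - t * y, y] F := by
  rw [eval_act]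
  congr 2
  ext i
  have : (unipotent t)⁻¹ = unipotent (-t) :=
    inv_eq_of_mul_eq_one_right (unipotent_mul_unipotent_neg t)
  rw [this]
  fin_cases i
  · simp [coe_unipotent, sub_eq_add_neg, mul_comm]
  · simp [coe_unipotent]

/-- Some unimodular lattice has a positive minimum. -/
theorem exists_latticeMin_pos {n : ℕ} (hn : 3 ≤ n) {P : MvPolynomial (Fin 2) ℝ}
    (hP : P.IsHomogeneous n) (hs : SimpleZeros P) : ∃ g, 0 < latticeMin P g := by
  obtain ⟨v, hv, hPv⟩ : ∃ v : Fin 2 → ℝ, v ≠ 0 ∧ eval v P ≠ 0 := by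
    by_contra! h
    have hP0 : P = 0 := by
      apply MvPolynomial.funext
      intro v
      by_cases hv : v = 0
      · have := eval_smul_of_isHomogeneous hP 0 v
        rw [zero_pow (by omega), zero_mul, zero_smul] at this
        rw [hv, this, map_zero]
      · rw [h v hv, map_zero]
    obtain ⟨i, hi⟩ := hs ![1, 0] (fun h => by simpa using congrFun h 0) (by rw [hP0, map_zero])
    rw [hP0, map_zero, map_zero] at hi
    exact hi rfl
  obtain ⟨g, hg⟩ := exists_mulVec_eq hv
  set F := act P g⁻¹
  have hF : F.IsHomogeneous n := isHomogeneous_act hP _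
  have hinf : eval ![1, 0] F ≠ 0 := by rwa [eval_act, inv_inv, hg]
  -- After `g` has removed roots at infinity, the translation by almost every `t` makes all the
  -- finitely many real roots tame.
  obtain ⟨t, ht⟩ : ∃ t : ℝ, ∀ ρ ∈ realRoots F, ρ + t ∈ tameSet := by
    have : ∀ᵐ t : ℝ, ∀ ρ ∈ realRoots F, ρ + t ∈ tameSet :=
      (ae_ball_iff (finite_realRoots hF hinf).countable).mpr fun ρ _ =>
        (measurePreserving_add_left volume ρ).quasiMeasurePreserving.ae ae_mem_tameSet
    exact this.exists
  refine ⟨(unipotent t * g⁻¹)⁻¹, ?_⟩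
  rw [← formMin_act, ← act_act]
  refine formMin_pos_of_tame hn (isHomogeneous_act hF _) ?_ ((hs.act _).act _) fun z hz => ?_
  · rw [eval_act_unipotent, mul_zero, sub_zero]; exact hinf
  · have hz' : eval ![z, 1] (act F (unipotent t)) = 0 := hz
    rw [eval_act_unipotent, mul_one] at hz'
    have := ht (z - t) hz'
    rwa [sub_add_cancel] at this

/-! ### Small transformations, transformed roots and their Diophantine minima. -/

theorem distId_inv (T : SL2R) : distId T⁻¹ = distId T := by
  have e00 : (T⁻¹).1 0 0 = T.1 1 1 := by simp [Matrix.adjugate_fin_two]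
  have e01 : (T⁻¹).1 0 1 = -T.1 0 1 := by simp [Matrix.adjugate_fin_two]
  have e10 : (T⁻¹).1 1 0 = -T.1 1 0 := by simp [Matrix.adjugate_fin_two]
  have e11 : (T⁻¹).1 1 1 = T.1 0 0 := by simp [Matrix.adjugate_fin_two]
  rw [distId_eq, distId_eq, e00, e01, e10, e11]
  congr 1
  ring

theorem mul_mem_ballId {r : ℝ} (hr : 0 < r) (hr1 : r ≤ 1) {T S : SL2R} (hT : T ∈ ballId (r / 8))
    (hS : S ∈ ballId (r / 8)) : T * S ∈ ballId r := by
  obtain ⟨t1, t2, t3, t4⟩ := entry_of_mem_ballId hT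
  obtain ⟨s1, s2, s3, s4⟩ := entry_of_mem_ballId hS
  have key : ∀ p q x y u w : ℝ, |p| < r / 8 → |q| < r / 8 → |x| < r / 8 → |y| < r / 8 →
      |u| < r / 8 → |w| < r / 8 → |p + q + x * y + u * w| ≤ 3 / 8 * r := by
    intro p q x y u w hp hq hx hy hu hw
    have h1 : |x * y| ≤ r / 8 * (1 / 8) := by
      rw [abs_mul]; gcongr; linarith
    have h2 : |u * w| ≤ r / 8 * (1 / 8) := by
      rw [abs_mul]; gcongr; linarith
    have := abs_add_le (p + q + x * y) (u * w)
    have := abs_add_le (p + q) (x * y)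
    have := abs_add_le p q
    linarith
  have e (i j : Fin 2) : (T * S).1 i j = T.1 i 0 * S.1 0 j + T.1 i 1 * S.1 1 j := by
    simp [Matrix.mul_apply, Fin.sum_univ_two]
  refine mem_ballId_of_entry hr ?_ ?_ ?_ ?_ <;> rw [e]
  · convert key _ _ _ _ _ _ t1 s1 t1 s1 t2 s3 using 2; ring
  · convert key _ _ _ _ _ _ t2 s2 t1 s2 t2 s4 using 2; ring
  · convert key _ _ _ _ _ _ t3 s3 t3 s1 t4 s3 using 2; ring
  · convert key _ _ _ _ _ _ t4 s4 t3 s2 t4 s4 using 2; ring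

theorem eventually_denom_ne_zero (ρ : ℝ) :
    ∀ᶠ r in 𝓝[>] (0 : ℝ), ∀ T ∈ ballId r, denom T ρ ≠ 0 := by
  have : Tendsto (fun r : ℝ => r * (1 + |ρ|)) (𝓝[>] 0) (𝓝 (0 * (1 + |ρ|))) :=
    (tendsto_id.mono_left nhdsWithin_le_nhds).mul_const _
  rw [zero_mul] at this
  filter_upwards [this.eventually_lt_const one_pos] with r hr T hT h
  have := (near_identity_bounds hT (abs_nonneg ρ) 0 (by simp) le_rfl).2.2.2
  rw [h, abs_zero] at this
  linarith

section Transport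

variable {n : ℕ} {F : MvPolynomial (Fin 2) ℝ} {T : SL2R}

theorem exists_moebius_eq (hF : F.IsHomogeneous n) (hinf : eval ![1, 0] F ≠ 0)
    (hden : ∀ ρ ∈ realRoots F, denom T ρ ≠ 0) {z : ℝ} (hz : z ∈ realRoots (act F T)) :
    ∃ ρ ∈ realRoots F, moebius T ρ = z := by
  have hz' : eval ![z, 1] (act F T) = 0 := hz
  rw [eval_act] at hz'
  have hv : (![z, 1] : Fin 2 → ℝ) ≠ 0 := fun h => by simpa using congrFun h 1
  have h1 := ne_zero_of_eval_eq_zero hF hinf (mulVec_inv_ne_zero T hv) hz'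
  have hρ := div_mem_realRoots hF h1 hz'
  refine ⟨_, hρ, ?_⟩
  have h2 := sub_mul_eq_denom_mul (hden _ hρ) ((T⁻¹).1.mulVec ![z, 1])
  rw [div_mul_cancel₀ _ h1, sub_self, mulVec_inv_mulVec, eq_comm, mul_eq_zero,
    or_iff_right (hden _ hρ)] at h2
  simp only [Matrix.cons_val_zero, Matrix.cons_val_one, mul_one] at h2
  exact (sub_eq_zero.mp h2).symm

theorem eval_act_infinity_ne_zero (hF : F.IsHomogeneous n) (hinf : eval ![1, 0] F ≠ 0)
    (hden : ∀ ρ ∈ realRoots F, denom T ρ ≠ 0) : eval ![1, 0] (act F T) ≠ 0 := by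
  intro hz'
  rw [eval_act] at hz'
  have hv : (![1, 0] : Fin 2 → ℝ) ≠ 0 := fun h => by simpa using congrFun h 0
  have h1 := ne_zero_of_eval_eq_zero hF hinf (mulVec_inv_ne_zero T hv) hz'
  have hρ := div_mem_realRoots hF h1 hz'
  have h2 := sub_mul_eq_denom_mul (hden _ hρ) ((T⁻¹).1.mulVec ![1, 0])
  rw [div_mul_cancel₀ _ h1, sub_self, mulVec_inv_mulVec, eq_comm, mul_eq_zero,
    or_iff_right (hden _ hρ)] at h2
  simp at h2

theorem finitelyMinimized_act (hn : 3 ≤ n) (hF : F.IsHomogeneous n) (hinf : eval ![1, 0] F ≠ 0)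
    (hs : SimpleZeros F) (hden : ∀ ρ ∈ realRoots F, denom T ρ ≠ 0)
    (ht : ∀ ρ ∈ realRoots F, moebius T ρ ∈ tameSet) : FinitelyMinimized (act F T) := by
  refine finitelyMinimized_of_tame hn (isHomogeneous_act hF T)
    (eval_act_infinity_ne_zero hF hinf hden) (hs.act T) fun z hz => ?_
  obtain ⟨ρ, hρ, rfl⟩ := exists_moebius_eq hF hinf hden hz
  exact ht ρ hρ

end Transport

theorem bddBelow_dioMin (n : ℕ) (ρ : ℝ) : BddBelow (Set.range
    fun p : ℤ × ℕ+ => |((p.2 : ℕ) : ℝ) ^ n * ((p.1 : ℝ) / ((p.2 : ℕ) : ℝ) - ρ)|) :=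
  ⟨0, by rintro _ ⟨p, rfl⟩; exact abs_nonneg _⟩

theorem dioMin_nonneg (n : ℕ) (ρ : ℝ) : 0 ≤ dioMin n ρ := Real.iInf_nonneg fun _ => abs_nonneg _

/-- Every fraction satisfies the second condition of the bad set when `c₂ ≤ dioMin n ρ`, so any
fraction that brings the minimum of `x` below `c₁` would put `x` there. -/
theorem le_dioMin_of_notMem_badSet {n : ℕ} {c₁ c₂ ρ x : ℝ} (hx : x ∉ badSet n c₁ c₂ ρ)
    (h : c₂ ≤ dioMin n ρ) : c₁ ≤ dioMin n x := by
  refine le_ciInf fun p => ?_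
  by_contra! hlt
  have hb : (0 : ℝ) < ((p.2 : ℕ) : ℝ) ^ n := by
    have := p.2.pos
    positivity
  have e (t : ℝ) : ((p.2 : ℕ) : ℝ) ^ n * |t| = |((p.2 : ℕ) : ℝ) ^ n * t| := by
    rw [abs_mul, abs_of_pos hb]
  apply hx
  refine ⟨p.1, p.2, p.2.pos, ?_, ?_⟩ <;> rw [Real.rpow_natCast]
  · rwa [lt_div_iff₀' hb, e]
  · rw [div_le_iff₀' hb, e]
    exact h.trans (ciInf_le (bddBelow_dioMin n ρ) p)

theorem exists_sub_lt_dioMin (n : ℕ) (ρ : ℝ) {ε : ℝ} (hε : 0 < ε) : ∃ c₁ c₂ : ℝ, 0 < c₁ ∧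
    c₁ < c₂ ∧ ∀ x ∉ badSet n c₁ c₂ ρ, dioMin n ρ - ε < dioMin n x := by
  obtain h | h := lt_or_ge (dioMin n ρ) ε
  -- If `dioMin n ρ < ε`, the claim is vacuous and the constants are arbitrary.
  · exact ⟨1, 2, one_pos, one_lt_two, fun x _ => (sub_neg.mpr h).trans_le (dioMin_nonneg n x)⟩
  · refine ⟨dioMin n ρ - ε / 2, dioMin n ρ, by linarith, by linarith, fun x hx => ?_⟩
    have := le_dioMin_of_notMem_badSet hx le_rfl
    linarith

theorem mem_approxSet_of_notMem_badSet {η ρ x : ℝ} (hx : x ∉ badSet (2 + η) 1 2 ρ) :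
    x ∈ approxSet η ρ := by
  intro a b hb h
  by_contra! h'
  exact hx ⟨a, b, hb, h, h'⟩

theorem tameSet_ae_eq_univ : tameSet =ᵐ[volume] Set.univ :=
  eventuallyEq_univ.mpr ae_mem_tameSet

theorem nullMeasurableSet_tameSet : NullMeasurableSet tameSet volume :=
  nullMeasurableSet_univ.congr tameSet_ae_eq_univ.symm

theorem lowerDensity_tameSet (ρ : ℝ) : lowerDensity tameSet ρ = 1 := by
  have : ∀ᶠ r in 𝓝[>] (0 : ℝ),
      volume (Metric.ball ρ r ∩ tameSet) / volume (Metric.ball ρ r) = 1 := by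
    filter_upwards [self_mem_nhdsWithin] with r hr
    rw [measure_congr ((ae_eq_refl (Metric.ball ρ r)).inter tameSet_ae_eq_univ), Set.inter_univ]
    exact ENNReal.div_self (Metric.measure_ball_pos volume ρ hr).ne' measure_ball_lt_top.ne
  rw [lowerDensity, liminf_congr this, liminf_const]

/-! ### The proportion of good transformations in small balls. -/

section Measure

variable [MeasurableSpace SL2R] [BorelSpace SL2R] (μ : Measure SL2R) [μ.IsHaarMeasure]

theorem frequently_le_measure_almostExtremalIn {n : ℕ} (hn : 3 ≤ n) {F : MvPolynomial (Fin 2) ℝ}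
    {k : ℕ} {ρ : Fin k → ℝ} (hρ : Set.range ρ = realRoots F) {S : Fin k → Set ℝ}
    (hS : ∀ i, NullMeasurableSet (S i) volume) {η ε δ h : ℝ} (hη : 0 < η) (hε : 0 < ε) (hδ : 0 < δ)
    (hh : 0 ≤ h) (hd : ∀ i, 1 - ENNReal.ofReal h ≤ lowerDensity (S i) (ρ i)) :
    ∃ᶠ r in 𝓝[>] (0 : ℝ), 1 - ENNReal.ofReal (k * h + δ) ≤
      μ (almostExtremalIn n F ρ ε S η ∩ ballId r) / μ (ballId r) := by
  choose c₁ c₂ h1 h2 hc using fun i => exists_sub_lt_dioMin n (ρ i) hε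
  have hn' : (2 : ℝ) < n := by exact_mod_cast hn
  -- Two kinds of exceptional approximation are excluded at each root: those of order `2 + η` with
  -- constants `1` and `2` encode `approxSet`, those of order `n` encode the drop of `dioMin`.
  have hfreq := frequently_measure_exists_le μ (ρ := ρ) (S := S)
    (s := fun _ b => bif b then 2 + η else n) (c₁ := fun i b => bif b then 1 else c₁ i)
    (c₂ := fun i b => bif b then 2 else c₂ i)
    (by rintro i (_ | _) <;> simp [hn', hη]) (by rintro i (_ | _) <;> simp [h1])
    (by rintro i (_ | _) <;> simp [h2]) hh
    (fun i δ hδ => eventually_volume_compl_le (hS i) hh hδ (hd i)) hδ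
  rw [Fintype.card_fin] at hfreq
  refine (hfreq.and_eventually ((eventually_all.mpr fun i => eventually_denom_ne_zero (ρ i)).and
    ((eventually_nhdsWithin_of_eventually_nhds (eventually_le_nhds hε)).and
      self_mem_nhdsWithin))).mono ?_
  rintro r ⟨hbad, hden, hrε, hr⟩
  have hpos := measure_ballId_pos μ hr
  have hfin := measure_ballId_ne_top μ r
  rw [ENNReal.le_div_iff_mul_le (Or.inl hpos.ne') (Or.inl hfin), ENNReal.sub_mul fun _ _ => hfin,
    one_mul, tsub_le_iff_right]
  refine (measure_mono ?_).trans ((measure_union_le _ _).trans (add_le_add_right hbad _))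
  intro T hT
  by_cases hTbad : ∃ i, moebius T (ρ i) ∈ (S i)ᶜ ∪ ⋃ b : Bool,
      badSet (bif b then 2 + η else n) (bif b then 1 else c₁ i) (bif b then 2 else c₂ i) (ρ i)
  · exact Or.inr ⟨hT, hTbad⟩
  · simp only [not_exists, Set.mem_union, not_or, Set.mem_compl_iff, not_not, Set.mem_iUnion] at hTbad
    refine Or.inl ⟨⟨⟨lt_of_lt_of_le hT hrε, ?_⟩, fun i => (hTbad i).1, fun i =>
      mem_approxSet_of_notMem_badSet ((hTbad i).2 true)⟩, hT⟩
    rw [← hρ]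
    rintro _ ⟨i, rfl⟩
    exact ⟨hden i T hT, hc i _ ((hTbad i).2 false)⟩

/-- Taking `h = 1 - inf` of the lower densities, the error `δ` tends to `0`. For `k = 0` the infimum
is `⊤` and the bound is `1`. -/
theorem le_limsup_measure_almostExtremalIn {n : ℕ} (hn : 3 ≤ n) {F : MvPolynomial (Fin 2) ℝ}
    {k : ℕ} {ρ : Fin k → ℝ} (hρ : Set.range ρ = realRoots F) {S : Fin k → Set ℝ}
    (hS : ∀ i, NullMeasurableSet (S i) volume) {η ε : ℝ} (hη : 0 < η) (hε : 0 < ε) :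
    1 - (k : ℝ≥0∞) * (1 - ⨅ i, lowerDensity (S i) (ρ i)) ≤
      limsup (fun r : ℝ => μ (almostExtremalIn n F ρ ε S η ∩ ballId r) / μ (ballId r))
        (𝓝[>] 0) := by
  set I := ⨅ i, lowerDensity (S i) (ρ i)
  have hI : ENNReal.ofReal (1 - I).toReal = 1 - I :=
    ENNReal.ofReal_toReal (ne_top_of_le_ne_top ENNReal.one_ne_top tsub_le_self)
  refine ENNReal.le_of_forall_pos_le_add fun δ hδ _ => ?_
  rw [tsub_le_iff_right]
  have := le_limsup_of_frequently_le (frequently_le_measure_almostExtremalIn μ hn hρ hS hη hε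
    (δ := δ) (by exact_mod_cast hδ) (h := (1 - I).toReal) ENNReal.toReal_nonneg fun i => by
      rw [hI]; exact tsub_tsub_le.trans (iInf_le _ i))
  rw [ENNReal.ofReal_add (by positivity) (by positivity), ENNReal.ofReal_mul (by positivity), hI,
    ENNReal.ofReal_natCast, ENNReal.ofReal_coe_nnreal, tsub_le_iff_right] at this
  rwa [add_assoc, add_comm (δ : ℝ≥0∞)]

/-- Tame numbers have full density, so only the arbitrarily small error remains. Avoiding bad sets
keeps the minimum, and tame transformed roots make it attained. -/
theorem frequently_measure_not_near_minimum_le {n : ℕ} (hn : 3 ≤ n)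
    {F : MvPolynomial (Fin 2) ℝ} (hF : F.IsHomogeneous n) (hinf : eval ![1, 0] F ≠ 0)
    (hs : SimpleZeros F) (hM : 0 < formMin F) {δ c : ℝ} (hδ : 0 < δ) (hc : 0 < c) :
    ∃ᶠ r in 𝓝[>] (0 : ℝ), μ {T | T ∈ ballId r ∧
      ¬(formMin F - δ ≤ formMin (act F T) ∧ FinitelyMinimized (act F T))} ≤
        ENNReal.ofReal c * μ (ballId r) := by
  obtain ⟨k, ρ, -, hρ⟩ := (finite_realRoots hF hinf).fin_param
  have hmem (i) : ρ i ∈ realRoots F := hρ ▸ Set.mem_range_self i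
  obtain ⟨c₁, c₂, h12, hev⟩ := exists_le_formMin_act (by omega) hF hinf hs hM hδ
  have hn' : (2 : ℝ) < n := by exact_mod_cast hn
  have hfreq := frequently_measure_exists_le μ (ρ := ρ) (S := fun _ => tameSet)
    (s := fun _ _ => n) (c₁ := fun i _ => c₁ (ρ i)) (c₂ := fun i _ => c₂ (ρ i))
    (fun _ _ => hn') (fun i _ => (h12 _ (hmem i)).1) (fun i _ => (h12 _ (hmem i)).2) le_rfl
    (fun i δ hδ => eventually_volume_compl_le nullMeasurableSet_tameSet le_rfl hδ (by
      rw [lowerDensity_tameSet]; exact tsub_le_self)) hc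
  rw [mul_zero, zero_add] at hfreq
  refine (hfreq.and_eventually
    ((eventually_all.mpr fun i => eventually_denom_ne_zero (ρ i)).and hev)).mono ?_
  rintro r ⟨hbad, hden, hr⟩
  refine (measure_mono ?_).trans hbad
  rintro T ⟨hT, hnot⟩
  refine ⟨hT, ?_⟩
  by_contra! hTbad
  simp only [Set.mem_union, not_or, Set.mem_compl_iff, not_not, Set.mem_iUnion, not_exists] at hTbad
  refine hnot ⟨hr T hT fun z hz => ?_, finitelyMinimized_act hn hF hinf hs (fun z hz => ?_)
    fun z hz => ?_⟩ <;> rw [← hρ] at hz <;> obtain ⟨i, rfl⟩ := hz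
  · exact (hTbad i).2 true
  · exact hden i T hT
  · exact (hTbad i).1

end Measure

theorem exists_almostExtremal_finitelyMinimized [MeasurableSpace SL2R] [BorelSpace SL2R]
    (μ : Measure SL2R) [μ.IsHaarMeasure] {n : ℕ} (hn : 3 ≤ n)
    {F : MvPolynomial (Fin 2) ℝ} (hF : F.IsHomogeneous n) (hinf : eval ![1, 0] F ≠ 0)
    (hs : SimpleZeros F) {ε : ℝ} (hε : 0 < ε) :
    ∃ T ∈ almostExtremal n F ε, FinitelyMinimized (act F T) := by
  obtain ⟨k, ρ, -, hρ⟩ := (finite_realRoots hF hinf).fin_param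
  obtain ⟨r, hr⟩ := (frequently_le_measure_almostExtremalIn μ hn hρ (η := 1)
    (S := fun _ => tameSet) (fun _ => nullMeasurableSet_tameSet) one_pos hε
    (δ := 1 / 2) (by norm_num) le_rfl fun i => by
      rw [lowerDensity_tameSet]; exact tsub_le_self).exists
  obtain hempty | ⟨T, ⟨hT, hTS, -⟩, -⟩ :=
    (almostExtremalIn n F ρ ε (fun _ => tameSet) 1 ∩ ballId r).eq_empty_or_nonempty
  · rw [hempty, measure_empty, ENNReal.zero_div, nonpos_iff_eq_zero, tsub_eq_zero_iff_le, mul_zero,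
      zero_add, ENNReal.one_le_ofReal] at hr
    norm_num at hr
  · refine ⟨T, hT, finitelyMinimized_act hn hF hinf hs (fun z hz => (hT.2 z hz).1) fun z hz => ?_⟩
    rw [← hρ] at hz
    obtain ⟨i, rfl⟩ := hz
    exact hTS i

/-! ### Lowering the minimum of a finitely minimized form. -/

/-- The matrices near the identity contracting a given vector. -/
theorem exists_inv_mulVec_eq_smul {v : Fin 2 → ℝ} (hv : v ≠ 0) : ∃ σ : ℝ, 0 < σ ∧ σ ≤ 1 / 2 ∧
    ∀ r : ℝ, 0 < r → r ≤ 1 → ∃ T ∈ ballId r, (T⁻¹).1.mulVec v = (1 - σ * r) • v := by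
  obtain ⟨g, hg⟩ := exists_mulVec_eq hv
  have hdet := det_entries g
  have hv0 : v 0 = g.1 0 0 := by rw [← hg, mulVec_apply_zero]; simp
  have hv1 : v 1 = g.1 1 0 := by rw [← hg, mulVec_apply_one]; simp
  generalize g.1 0 0 = a at *
  generalize g.1 0 1 = b at *
  generalize g.1 1 0 = c at *
  generalize g.1 1 1 = d at *
  set N := |a * d| + |b * c| + |a * b| + |c * d| + 1 with hN
  have hN1 : |a * d| + |b * c| ≤ N := by
    rw [hN]; linarith [abs_nonneg (a * b), abs_nonneg (c * d)]
  have hN2 : |a * b| ≤ N := by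
    rw [hN]; linarith [abs_nonneg (a * d), abs_nonneg (b * c), abs_nonneg (c * d)]
  have hN3 : |c * d| ≤ N := by
    rw [hN]; linarith [abs_nonneg (a * d), abs_nonneg (b * c), abs_nonneg (a * b)]
  have hN0 : 1 ≤ N := by
    rw [hN]
    linarith [abs_nonneg (a * d), abs_nonneg (b * c), abs_nonneg (a * b), abs_nonneg (c * d)]
  refine ⟨1 / (8 * N), by positivity, ?_, fun r hr hr1 => ?_⟩
  · rw [div_le_div_iff₀ (by positivity) (by norm_num)]; linarith
  set τ := 1 / (8 * N) * r with hτ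
  have hNτ : N * τ = r / 8 := by rw [hτ]; field_simp
  have hτ0 : 0 < τ := by positivity
  have hτ1 : τ ≤ 1 / 8 := by nlinarith
  have hq : 0 < 1 - τ := by linarith
  obtain ⟨p, hp⟩ : ∃ p : ℝ, p * (1 - τ) = 1 := ⟨1 / (1 - τ), by field_simp⟩
  have hp0 : 0 < p := pos_of_mul_pos_left (by rw [hp]; exact one_pos) hq.le
  have hp1 : |p - 1| ≤ 2 * τ := by
    rw [abs_le]; constructor <;> nlinarith
  have hq1 : |(1 - τ) - 1| ≤ 2 * τ := by rw [abs_le]; constructor <;> linarith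
  have hpq : |p - (1 - τ)| ≤ 3 * τ := by
    rw [abs_le] at *; constructor <;> nlinarith
  -- The matrix is `g diag(p, 1 - τ) g⁻¹` with `p = 1 / (1 - τ)`, where `v` is the first column of
  -- `g`.
  have hTdet : Matrix.det !![a * d * p - b * c * (1 - τ), -(a * b) * (p - (1 - τ));
      c * d * (p - (1 - τ)), a * d * (1 - τ) - b * c * p] = 1 := by
    rw [Matrix.det_fin_two_of]
    linear_combination (a * d - b * c) ^ 2 * hp + (a * d - b * c + 1) * hdet
  let T : SL2R := ⟨_, hTdet⟩
  have hTv : T.1.mulVec ((1 - τ) • v) = v := by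
    ext i
    fin_cases i
    · simp [T, hv0, hv1, Matrix.mulVec, dotProduct, Fin.sum_univ_two]
      linear_combination a * (a * d - b * c) * hp + a * hdet
    · simp [T, hv0, hv1, Matrix.mulVec, dotProduct, Fin.sum_univ_two]
      linear_combination c * (a * d - b * c) * hp + c * hdet
  refine ⟨T, ?_, ?_⟩
  · refine mem_ballId_of_entry hr ?_ ?_ ?_ ?_
    · show |a * d * p - b * c * (1 - τ) - 1| ≤ _
      have : a * d * p - b * c * (1 - τ) - 1 = a * d * (p - 1) - b * c * ((1 - τ) - 1) := by
        linear_combination hdet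
      rw [this]
      refine (abs_sub _ _).trans ?_
      rw [abs_mul, abs_mul (b * c)]
      nlinarith [abs_nonneg (a * d), abs_nonneg (b * c)]
    · show |-(a * b) * (p - (1 - τ))| ≤ _
      rw [abs_mul, abs_neg]
      nlinarith [abs_nonneg (a * b)]
    · show |c * d * (p - (1 - τ))| ≤ _
      rw [abs_mul]
      nlinarith [abs_nonneg (c * d)]
    · show |a * d * (1 - τ) - b * c * p - 1| ≤ _
      have : a * d * (1 - τ) - b * c * p - 1 = a * d * ((1 - τ) - 1) - b * c * (p - 1) := by
        linear_combination hdet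
      rw [this]
      refine (abs_sub _ _).trans ?_
      rw [abs_mul, abs_mul (b * c)]
      nlinarith [abs_nonneg (a * d), abs_nonneg (b * c)]
  · have := mulVec_inv_mulVec T⁻¹ ((1 - τ) • v)
    rwa [inv_inv, hTv] at this

/-- A polynomial is locally Lipschitz, and `S⁻¹` moves `v` by at most `2 r ‖v‖`. -/
theorem exists_eval_inv_mulVec_le (F : MvPolynomial (Fin 2) ℝ) (v : Fin 2 → ℝ) :
    ∃ C : ℝ, 0 < C ∧ ∀ᶠ r in 𝓝[>] (0 : ℝ), ∀ S ∈ ballId r,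
      |eval ((S⁻¹).1.mulVec v) F| ≤ |eval v F| + C * r := by
  have hF : ContDiffAt ℝ 1 (fun w => eval w F) v :=
    (AnalyticOnNhd.eval_mvPolynomial F v (Set.mem_univ v)).contDiffAt
  obtain ⟨K, t, ht, hK⟩ := hF.exists_lipschitzOnWith
  obtain ⟨ε, hε, hball⟩ := Metric.mem_nhds_iff.mp ht
  refine ⟨K * (2 * ‖v‖) + 1, by positivity, ?_⟩
  have : Tendsto (fun r : ℝ => 2 * r * ‖v‖) (𝓝[>] 0) (𝓝 (2 * 0 * ‖v‖)) :=
    ((tendsto_id.mono_left nhdsWithin_le_nhds).const_mul 2).mul_const _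
  rw [mul_zero, zero_mul] at this
  filter_upwards [this.eventually_lt_const hε, self_mem_nhdsWithin] with r hr hr0 S hS
  have hS' : S⁻¹ ∈ ballId r := by
    show distId S⁻¹ < r
    rw [distId_inv]; exact hS
  have h1 := norm_mulVec_sub_le hS' v
  have h2 := hK.dist_le_mul ((S⁻¹).1.mulVec v)
    (hball (by rw [Metric.mem_ball, dist_eq_norm]; exact h1.trans_lt hr)) v
    (hball (Metric.mem_ball_self hε))
  rw [Real.dist_eq, dist_eq_norm] at h2
  have h3 : (K : ℝ) * ‖(S⁻¹).1.mulVec v - v‖ ≤ K * (2 * r * ‖v‖) := by gcongr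
  have h4 := abs_sub_abs_le_abs_sub (eval ((S⁻¹).1.mulVec v) F) (eval v F)
  have hr0' : 0 < r := hr0
  linarith

/-- Let `T₀` shrink a minimal vector by the factor `1 - σ r / 8`. For `S` in a ball smaller by a
large factor `K`, the product `T₀ S` still lowers the value there. These products fill a proportion
of the ball of radius `r` bounded below independently of `r`, so for suitable `r` one of them does
not lower the minimum by more than `δ`. -/
theorem exists_formMin_act_lt [MeasurableSpace SL2R] [BorelSpace SL2R]
    (μ : Measure SL2R) [μ.IsHaarMeasure] {n : ℕ} (hn : 3 ≤ n)
    {F : MvPolynomial (Fin 2) ℝ} (hF : F.IsHomogeneous n) (hinf : eval ![1, 0] F ≠ 0)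
    (hs : SimpleZeros F) (hM : 0 < formMin F) (hfm : FinitelyMinimized F) {δ : ℝ} (hδ : 0 < δ) :
    ∃ T, formMin F - δ ≤ formMin (act F T) ∧ formMin (act F T) < formMin F := by
  obtain ⟨v, hv, hvM⟩ := hfm
  set w : Fin 2 → ℝ := fun i => (v i : ℝ)
  have hw : w ≠ 0 := fun h => hv (by ext i; simpa [w] using congrFun h i)
  obtain ⟨σ, hσ, hσ1, hT⟩ := exists_inv_mulVec_eq_smul hw
  obtain ⟨C, hC, hev⟩ := exists_eval_inv_mulVec_le F w
  -- Large enough that the perturbation `C r / K` by `S` is below the gain `σ (r / 8) * formMin F`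
  -- from `T₀`.
  obtain ⟨K, hK⟩ := exists_nat_gt (max 8 (C / (σ / 8 * formMin F)))
  have hK8 : (8 : ℝ) < K := (le_max_left _ _).trans_lt hK
  have hKC : C / (σ / 8 * formMin F) < K := (le_max_right _ _).trans_lt hK
  have hK0 : (0 : ℝ) < K := by linarith
  set D := (((16 * K + 1) ^ 4 : ℕ) : ℝ) with hD
  have hD0 : 0 < D := by rw [hD]; positivity
  have htend : Tendsto (fun r : ℝ => r / K) (𝓝[>] 0) (𝓝[>] 0) := by
    refine tendsto_nhdsWithin_iff.mpr ⟨?_, ?_⟩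
    · have : Tendsto (fun r : ℝ => r / K) (𝓝[>] 0) (𝓝 (0 / K)) :=
        (tendsto_id.mono_left nhdsWithin_le_nhds).div_const _
      rwa [zero_div] at this
    · filter_upwards [self_mem_nhdsWithin] with r hr
      exact div_pos hr hK0
  obtain ⟨r, hbad, hr1, hr0, hlip⟩ := ((frequently_measure_not_near_minimum_le μ hn hF hinf hs hM hδ
    (c := 1 / (2 * D)) (by positivity)).and_eventually
    ((eventually_nhdsWithin_of_eventually_nhds (eventually_le_nhds one_pos)).and
      (Eventually.and self_mem_nhdsWithin (htend.eventually hev)))).exists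
  have hr0' : 0 < r := hr0
  obtain ⟨T₀, hT₀, hT₀v⟩ := hT (r / 8) (by positivity) (by linarith)
  have hdoub := measure_ballId_mul_le μ K (r := r / K) (by positivity)
    (by rw [mul_div_cancel₀ _ hK0.ne']; exact hr1)
  rw [mul_div_cancel₀ _ hK0.ne'] at hdoub
  have hcast : (((16 * K + 1) ^ 4 : ℕ) : ℝ≥0∞) = ENNReal.ofReal D := by
    rw [hD, ENNReal.ofReal_natCast]
  -- The translate of the small ball has the measure of that ball, which by doubling is at least `1
  -- / D` of the large one, hence more than the bad proportion `1 / (2 D)`.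
  have hlt : ENNReal.ofReal (1 / (2 * D)) * μ (ballId r) <
      μ ((fun S => T₀⁻¹ * S) ⁻¹' ballId (r / K)) := by
    rw [measure_preimage_mul]
    have hpos := measure_ballId_pos μ (r := r / K) (by positivity)
    have hfin := measure_ballId_ne_top μ (r / K)
    calc _ ≤ ENNReal.ofReal (1 / (2 * D)) * (ENNReal.ofReal D * μ (ballId (r / K))) := by
          gcongr; rw [← hcast]; exact hdoub
      _ = ENNReal.ofReal (1 / 2) * μ (ballId (r / K)) := by
          rw [← mul_assoc, ← ENNReal.ofReal_mul (by positivity)]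
          congr 2
          field_simp
      _ < 1 * μ (ballId (r / K)) := by
          refine (ENNReal.mul_lt_mul_iff_left hpos.ne' hfin).mpr ?_
          rw [ENNReal.ofReal_lt_one]; norm_num
      _ = _ := one_mul _
  obtain ⟨T, hTS, hTbad⟩ : ∃ T ∈ (fun S => T₀⁻¹ * S) ⁻¹' ballId (r / K), T ∉ {T | T ∈ ballId r ∧
      ¬(formMin F - δ ≤ formMin (act F T) ∧ FinitelyMinimized (act F T))} := by
    by_contra h
    have hsub := fun T hT => not_not.mp (not_and.mp (not_exists.mp h T) hT)
    exact absurd ((measure_mono hsub).trans hbad) (not_le.mpr hlt)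
  set S := T₀⁻¹ * T with hS
  have hSr : S ∈ ballId (r / K) := hTS
  have hTS' : T = T₀ * S := by rw [hS, mul_inv_cancel_left]
  have hTr : T ∈ ballId r := by
    rw [hTS']
    refine mul_mem_ballId hr0' hr1 hT₀ (ballId_subset ?_ hSr)
    gcongr
  refine ⟨T, ?_, ?_⟩
  · by_contra h
    exact hTbad ⟨hTr, fun h' => h h'.1⟩
  · refine (formMin_le _ hv).trans_lt ?_
    rw [eval_act, hTS', mul_inv_rev, Matrix.SpecialLinearGroup.coe_mul, ← Matrix.mulVec_mulVec, hT₀v,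
      Matrix.mulVec_smul, eval_smul_of_isHomogeneous hF, abs_mul]
    have h1 := hlip S hSr
    rw [hvM] at h1
    have hτ : σ * (r / 8) ≤ 1 / 2 := by nlinarith
    have hτ0 : 0 < σ * (r / 8) := by positivity
    have h2 : |(1 - σ * (r / 8)) ^ n| ≤ 1 - σ * (r / 8) := by
      rw [abs_of_nonneg (pow_nonneg (by linarith) _)]
      exact pow_le_of_le_one (by linarith) (by linarith) (by omega)
    have h3 : C * (r / K) < σ * (r / 8) * formMin F := by
      rw [div_lt_iff₀ (by positivity)] at hKC
      rw [mul_div_assoc', div_lt_iff₀ hK0]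
      nlinarith
    have h4 : 0 < C * (r / K) := by positivity
    calc _ ≤ (1 - σ * (r / 8)) * (formMin F + C * (r / K)) := by
          gcongr
          linarith
      _ < formMin F := by nlinarith

theorem exists_finitelyMinimized_near_minimum [MeasurableSpace SL2R] [BorelSpace SL2R]
    (μ : Measure SL2R) [μ.IsHaarMeasure] {n : ℕ}
    (hn : 3 ≤ n) {F : MvPolynomial (Fin 2) ℝ} (hF : F.IsHomogeneous n)
    (hinf : eval ![1, 0] F ≠ 0) (hs : SimpleZeros F) (hM : 0 < formMin F) {δ : ℝ} (hδ : 0 < δ) :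
    ∃ T, formMin F - δ ≤ formMin (act F T) ∧ FinitelyMinimized (act F T) := by
  obtain ⟨r, hbad, hr⟩ := ((frequently_measure_not_near_minimum_le μ hn hF hinf hs hM hδ
    (c := 1 / 2) (by norm_num)).and_eventually self_mem_nhdsWithin).exists
  by_contra! h
  have : ballId r ⊆ {T | T ∈ ballId r ∧
      ¬(formMin F - δ ≤ formMin (act F T) ∧ FinitelyMinimized (act F T))} :=
    fun T hT => ⟨hT, fun h' => h T h'.1 h'.2⟩
  refine absurd ((measure_mono this).trans hbad) (not_le.mpr ?_)
  conv_rhs => rw [← one_mul (μ (ballId r))]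
  refine (ENNReal.mul_lt_mul_iff_left (measure_ballId_pos μ hr).ne'
    (measure_ballId_ne_top μ r)).mpr ?_
  rw [ENNReal.ofReal_lt_one]; norm_num

/-! ### Extremal forms, and accumulation of the spectrum at its maximum. -/

section Extremal

variable {n : ℕ} {P : MvPolynomial (Fin 2) ℝ}

theorem IsExtremal.formMin_pos (hn : 3 ≤ n) (hP : P.IsHomogeneous n) (hs : SimpleZeros P) {A : SL2R}
    (hA : IsExtremal (act P A)) : 0 < formMin (act P A) := by
  obtain ⟨g, hg⟩ := exists_latticeMin_pos hn hP hs
  exact hg.trans_le (hA.2 (by rw [spec_act]; exact ⟨g, rfl⟩))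

theorem eval_infinity_ne_zero_of_formMin_pos (hM : 0 < formMin P) : eval ![1, 0] P ≠ 0 := by
  intro h
  have := formMin_le P (v := ![1, 0]) fun h => by simpa using congrFun h 0
  have e : (fun i => ((![1, 0] : Fin 2 → ℤ) i : ℝ)) = ![1, 0] := by
    ext i; fin_cases i <;> simp
  rw [e, h, abs_zero] at this
  linarith

theorem exists_isExtremal_act (hn : 3 ≤ n) (hP : P.IsHomogeneous n) (hs : SimpleZeros P) :
    ∃ A : SL2R, IsExtremal (act P A) := by
  obtain ⟨g, hg⟩ := exists_isGreatest_spec (by omega) hP (exists_latticeMin_pos hn hP hs)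
  exact ⟨g⁻¹, by rwa [IsExtremal, spec_act, formMin_act, inv_inv]⟩

/-- If an extremal form is finitely minimized, a perturbation shrinking a minimal vector is used.
Otherwise a nearby finitely minimized form has a large minimum that cannot equal `M`, as that form
would be both extremal and finitely minimized. -/
theorem exists_mem_spec_lt [MeasurableSpace SL2R] [BorelSpace SL2R]
    (μ : Measure SL2R) [μ.IsHaarMeasure] (hn : 3 ≤ n)
    (hP : P.IsHomogeneous n) (hs : SimpleZeros P) {M : ℝ} (hM : IsGreatest (spec P) M) {δ : ℝ}
    (hδ : 0 < δ) : ∃ m ∈ spec P, M - δ ≤ m ∧ m < M := by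
  have hext {A : SL2R} (hA : IsExtremal (act P A)) : formMin (act P A) = M :=
    IsGreatest.unique (by rw [← spec_act P A]; exact hA) hM
  by_cases hcase : ∃ A : SL2R, IsExtremal (act P A) ∧ FinitelyMinimized (act P A)
  · obtain ⟨A, hA, hAf⟩ := hcase
    have hpos := hA.formMin_pos hn hP hs
    obtain ⟨T, h1, h2⟩ := exists_formMin_act_lt μ hn (isHomogeneous_act hP A)
      (eval_infinity_ne_zero_of_formMin_pos hpos) (hs.act A) hpos hAf hδ
    rw [hext hA, act_act] at h1 h2
    exact ⟨_, formMin_act_mem_spec P _, h1, h2⟩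
  · push Not at hcase
    obtain ⟨A, hA⟩ := exists_isExtremal_act hn hP hs
    have hpos := hA.formMin_pos hn hP hs
    obtain ⟨T, h1, h2⟩ := exists_finitelyMinimized_near_minimum μ hn (isHomogeneous_act hP A)
      (eval_infinity_ne_zero_of_formMin_pos hpos) (hs.act A) hpos hδ
    rw [act_act] at h1 h2
    rw [hext hA] at h1
    refine ⟨_, formMin_act_mem_spec P _, h1, (hM.2 (formMin_act_mem_spec P _)).lt_of_ne fun h => ?_⟩
    refine hcase (T * A) ?_ h2
    rwa [IsExtremal, spec_act, h]

end Extremal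

end BinForm

theorem mainTheorem5 [MeasurableSpace SL2R] [BorelSpace SL2R]
    (μ : Measure SL2R) [μ.IsHaarMeasure]
    (n : ℕ) (hn : 3 ≤ n) (P : MvPolynomial (Fin 2) ℝ) (hP : P.IsHomogeneous n)
    (hD : BinForm.discriminant n P ≠ 0) :
    (∃ A : SL2R, BinForm.IsExtremal (BinForm.act P A)) ∧
    (∀ A : SL2R, BinForm.IsExtremal (BinForm.act P A) →
      (∀ (k : ℕ) (ρ : Fin k → ℝ), Function.Injective ρ →
        Set.range ρ = BinForm.realRoots (BinForm.act P A) →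
        ∀ S : Fin k → Set ℝ, (∀ i, NullMeasurableSet (S i) volume) →
        ∀ η : ℝ, 0 < η → ∀ ε : ℝ, 0 < ε →
          1 - (k : ℝ≥0∞) * (1 - ⨅ i, BinForm.lowerDensity (S i) (ρ i)) ≤
            limsup (fun r : ℝ =>
              μ (BinForm.almostExtremalIn n (BinForm.act P A) ρ ε S η ∩ BinForm.ballId r) /
                μ (BinForm.ballId r)) (𝓝[>] 0)) ∧
      (∀ ε : ℝ, 0 < ε → ∃ T ∈ BinForm.almostExtremal n (BinForm.act P A) ε,
        BinForm.FinitelyMinimized (BinForm.act (BinForm.act P A) T))) ∧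
    (∃ M : ℝ, IsGreatest (BinForm.spec P) M ∧ AccPt M (𝓟 (BinForm.spec P))) := by
  have hs := BinForm.simpleZeros_of_discriminant_ne_zero (by omega) hP hD
  have hex := BinForm.exists_isExtremal_act hn hP hs
  refine ⟨hex, fun A hA => ⟨fun k ρ _ hρ S hS η hη ε hε =>
    BinForm.le_limsup_measure_almostExtremalIn μ hn hρ hS hη hε, fun ε hε =>
    BinForm.exists_almostExtremal_finitelyMinimized μ hn (BinForm.isHomogeneous_act hP A)
      (BinForm.eval_infinity_ne_zero_of_formMin_pos (hA.formMin_pos hn hP hs)) (hs.act A) hε⟩, ?_⟩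
  obtain ⟨A, hA⟩ := hex
  have hM : IsGreatest (BinForm.spec P) (BinForm.formMin (BinForm.act P A)) := by
    rw [← BinForm.spec_act P A]; exact hA
  refine ⟨_, hM, accPt_iff_frequently.mpr ?_⟩
  refine Metric.nhds_basis_ball.frequently_iff.mpr fun δ hδ => ?_
  obtain ⟨m, hm, h1, h2⟩ := BinForm.exists_mem_spec_lt μ hn hP hs hM (half_pos hδ)
  refine ⟨m, ?_, h2.ne, hm⟩
  rw [Metric.mem_ball, Real.dist_eq, abs_lt]
  constructor <;> linarith
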